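/- Let $\mathbb F_q$ be a finite field and let $a_1,b_1,a_2,b_2,a_3,b_3\in\mathbb F_q$ be non-zero. Consider the memoryless additive two-way wiretap channel $$Y_1=a_1X_1+b_1X_2+N_1,\qquad Y_2=a_2X_1+b_2X_2+N_2,\qquad Z=a_3X_1+b_3X_2+N_3,$$ where User $i$ inputs $X_i$ and receives $Y_i$ ($i=1,2$), the eavesdropper receives $Z$, and the noise triples $(N_1,N_2,N_3)$ of different channel uses are i.i.d. with an arbitrary joint law (for example, with independent components) and independent of the messages and of the randomness of the encoders. Logarithms are natural, $H$ is Shannon entropy, $I$ is (conditional) mutual information. A code of length $n$ consists of non-empty finite message sets $\mathcal M_1,\mathcal M_2$, two stochastic encoders and two deterministic decoders; the messages $M_1,M_2$ are independent and uniform, and the rates are $R_{i,n}=\frac1n\log|\mathcal M_i|$. A non-adaptive encoder of User $i$ draws $X_i^n$ given $M_i$; an adaptive one draws $X_{i,t}$ given $M_i$, its own previous inputs $X_i^{t-1}$ and the previous outputs $Y_i^{t-1}$, for $t=1,\dots,n$. A decoder of the 1st type estimates the other user's message from $(M_i,X_i^n,Y_i^n)$, one of the 2nd type from $(X_i^n,Y_i^n)$.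 The error probability $P_e^n$ is the probability that at least one of the two messages is decoded wrongly. For $a\in\{J,I\}$ (joint, individual), $b\in\{S,W\}$ (strong, weak), $c\in\{A,N\}$ (adaptive, non-adaptive) and $d\in\{1,2\}$, let $\mathcal C_{a,b,c,d}$ be the set of pairs $(R_1,R_2)$ for which there are codes of lengths $n=0,1,2,\dots$ with encoders of kind $c$ and decoders of type $d$ such that $R_{i,n}\to R_i$ for $i=1,2$, $P_e^n\le\epsilon_n$ and $$I(M_1,M_2;Z^n)\le\delta_n\ \text{ if } a=J,\qquad I(M_1;Z^n)\le\delta_n\ \text{and}\ I(M_2;Z^n)\le\delta_n\ \text{ if } a=I,$$ where $\epsilon_n\to0$, $\tau_n\to0$, and $\delta_n=\tau_n$ if $b=S$, $\delta_n=n\tau_n$ if $b=W$. (The rates in the term $n=0$ play no role.) Let $\mathcal R_{J,N}$ be the closure of the convex hull of the union, over all finite sets $\mathcal V_1,\mathcal V_2$ and all laws $P_{V_1}P_{X_1|V_1}P_{V_2}P_{X_2|V_2}$ on $\mathcal V_1\times\mathbb F_q\times\mathcal V_2\times\mathbb F_q$, of the sets of pairs $R_1,R_2\ge0$ with $$R_1\le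 I(Y_2;V_1|X_2)-I(Z;V_1),\qquad R_2\le I(Y_1;V_2|X_1)-I(Z;V_2),$$ $$R_1+R_2\le I(Y_2;V_1|X_2)+I(Y_1;V_2|X_1)-I(V_1,V_2;Z).$$ Put $$\mathcal A_O=\{(R_1,R_2)\in\mathbb R_{\ge0}^2: R_1\le\log q-H(N_2),\ R_2\le\log q-H(N_1)\},$$ $$\mathcal A_J=\{(R_1,R_2)\in\mathcal A_O: R_1+R_2\le\log q+H(N_3)-H(N_1)-H(N_2)\}.$$ (i) $\mathcal C_{I,W,A,1}\subseteq\mathcal A_O$. (ii) Suppose that there is a random variable $N_3'$ in $\mathbb F_q$ such that $N_3$ has the law of $\frac{b_3}{b_1}\tilde N_1+\frac{a_3}{a_2}\tilde N_2+N_3'$, where $\tilde N_1,\tilde N_2$ have the laws of $N_1,N_2$ and $\tilde N_1,\tilde N_2,N_3'$ are independent. Then $\mathcal C_{J,W,N,1}\subseteq\mathcal A_J$, and $$\mathcal C_{J,b,N,d}=\mathcal R_{J,N}=\mathcal A_J\qquad\text{for all } b\in\{S,W\},\ d\in\{1,2\}.$$ -/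

import Mathlib

open Filter Topology

universe u

noncomputable section

namespace TwoWayWiretap

/-! Shannon quantities of finite-valued random variables on a finite sample space `Ω`,
whose law is given by its mass function `p : Ω → ℝ`. Logarithms are natural. -/

section Information

variable {Ω A B C : Type*} [Fintype Ω] [Fintype A] [Fintype B] [Fintype C]

open Classical in
/-- The mass function of the random variable `f` when the sample space has mass function `p`. -/
def law (p : Ω → ℝ) (f : Ω → A) (a : A) : ℝ :=
  ∑ ω, if f ω = a then p ω else 0

/-- Shannon entropy `H(f) = - ∑ a, P(f = a) log P(f = a)`. -/
def entropy (p : Ω → ℝ) (f : Ω → A) : ℝ :=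
  ∑ a, Real.negMulLog (law p f a)

/-- Mutual information `I(f; g) = H(f) + H(g) - H(f, g)`. -/
def mutualInfo (p : Ω → ℝ) (f : Ω → A) (g : Ω → B) : ℝ :=
  entropy p f + entropy p g - entropy p (fun ω => (f ω, g ω))

/-- Conditional mutual information `I(f; g | h) = H(f, h) + H(g, h) - H(f, g, h) - H(h)`. -/
def condMutualInfo (p : Ω → ℝ) (f : Ω → A) (g : Ω → B) (h : Ω → C) : ℝ :=
  entropy p (fun ω => (f ω, h ω)) + entropy p (fun ω => (g ω, h ω))
    - entropy p (fun ω => (f ω, g ω, h ω)) - entropy p h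

/-- Shannon entropy of a probability mass function on a finite set. -/
def pmfEntropy (p : PMF A) : ℝ :=
  ∑ a, Real.negMulLog (p a).toReal

end Information

/-- One use of a two-way wiretap channel: inputs `x₁`, `x₂` of the two users are mapped to the
joint law of the outputs `(y₁, y₂, z)` of user 1, user 2 and the eavesdropper. -/
abbrev Channel (X₁ X₂ Y₁ Y₂ Z : Type*) := X₁ → X₂ → PMF (Y₁ × Y₂ × Z)

/-- The two kinds of encoders. -/
inductive EncoderKind
  | adaptive
  | nonadaptive

/-- The two kinds of decoders: the first one also sees the own message of the user. -/
inductive DecoderKind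
  | first
  | second

/-- Joint or individual secrecy. -/
inductive SecrecyKind
  | joint
  | individual

/-- Strong or weak secrecy. -/
inductive SecrecyStrength
  | strong
  | weak

/-- The first `t` entries of a sequence of length `n`. -/
def past {A : Type*} {n : ℕ} (t : Fin n) (x : Fin n → A) : Fin (t : ℕ) → A :=
  fun s => x (Fin.castLE t.isLt.le s)

/-- A stochastic encoder of block length `n` for messages in `M`, channel inputs in `X` and
received symbols in `Y`. A nonadaptive encoder draws the whole input sequence given the message;
an adaptive encoder draws the `t`-th input given the message, its own previous inputs and the
previously received symbols (so the randomization may be correlated over time). -/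
def Encoder (c : EncoderKind) (M : Type) (X Y : Type u) (n : ℕ) : Type u :=
  match c with
  | .adaptive => (t : Fin n) → M → (Fin (t : ℕ) → X) → (Fin (t : ℕ) → Y) → PMF X
  | .nonadaptive => M → PMF (Fin n → X)

/-- The factor that an encoder contributes to the joint law: the (causally conditioned)
probability that it emits `x` when the message is `m` and the received sequence is `y`. -/
def Encoder.prob {M : Type} {X Y : Type u} {n : ℕ} :
    {c : EncoderKind} → Encoder c M X Y n → M → (Fin n → X) → (Fin n → Y) → ℝ
  | .adaptive, φ, m, x, y => ∏ t : Fin n, (φ t m (past t x) (past t y) (x t)).toReal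
  | .nonadaptive, φ, m, x, _ => ((φ : M → PMF (Fin n → X)) m x).toReal

/-- A decoder of a user with own message in `M`, inputs in `X` and outputs in `Y`, which
estimates a message in `M'`. -/
def Decoder (d : DecoderKind) (M M' : Type) (X Y : Type u) (n : ℕ) : Type u :=
  match d with
  | .first => M → (Fin n → X) → (Fin n → Y) → M'
  | .second => (Fin n → X) → (Fin n → Y) → M'

/-- The estimate that a decoder makes. -/
def Decoder.estimate {M M' : Type} {X Y : Type u} {n : ℕ} :
    {d : DecoderKind} → Decoder d M M' X Y n → M → (Fin n → X) → (Fin n → Y) → M'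
  | .first, ψ, m, x, y => (ψ : M → (Fin n → X) → (Fin n → Y) → M') m x y
  | .second, ψ, _, x, y => (ψ : (Fin n → X) → (Fin n → Y) → M') x y

/-- A code of block length `n`: two nonempty message sets, two encoders, two decoders. -/
structure Code (X₁ X₂ Y₁ Y₂ : Type u) (c : EncoderKind) (d : DecoderKind) (n : ℕ) where
  size₁ : ℕ
  size₂ : ℕ
  size₁_pos : 0 < size₁
  size₂_pos : 0 < size₂
  enc₁ : Encoder c (Fin size₁) X₁ Y₁ n
  enc₂ : Encoder c (Fin size₂) X₂ Y₂ n
  dec₁ : Decoder d (Fin size₁) (Fin size₂) X₁ Y₁ n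
  dec₂ : Decoder d (Fin size₂) (Fin size₁) X₂ Y₂ n

section Codes

variable {X₁ X₂ Y₁ Y₂ Z : Type u} {c : EncoderKind} {d : DecoderKind} {n : ℕ}

/-- The rate `R₁` of user 1, determined by `e ^ (n R₁) = size₁`. -/
def Code.rate₁ (K : Code X₁ X₂ Y₁ Y₂ c d n) : ℝ := Real.log K.size₁ / n

/-- The rate `R₂` of user 2, determined by `e ^ (n R₂) = size₂`. -/
def Code.rate₂ (K : Code X₁ X₂ Y₁ Y₂ c d n) : ℝ := Real.log K.size₂ / n

/-- The values of `(M₁, M₂, X₁ⁿ, X₂ⁿ, Y₁ⁿ, Y₂ⁿ, Zⁿ)`. -/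
abbrev Code.Outcome (Z : Type u) (K : Code X₁ X₂ Y₁ Y₂ c d n) : Type u :=
  Fin K.size₁ × Fin K.size₂ × (Fin n → X₁) × (Fin n → X₂) × (Fin n → Y₁) × (Fin n → Y₂) ×
    (Fin n → Z)

/-- The joint mass function of `(M₁, M₂, X₁ⁿ, X₂ⁿ, Y₁ⁿ, Y₂ⁿ, Zⁿ)` when the messages are uniform
and independent and `n` independent uses of the channel `W` are made. -/
def Code.mass (K : Code X₁ X₂ Y₁ Y₂ c d n) (W : Channel X₁ X₂ Y₁ Y₂ Z) : K.Outcome Z → ℝ :=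
  fun (m₁, m₂, x₁, x₂, y₁, y₂, z) =>
    (1 / ((K.size₁ : ℝ) * (K.size₂ : ℝ))) * K.enc₁.prob m₁ x₁ y₁ * K.enc₂.prob m₂ x₂ y₂ *
      ∏ t : Fin n, (W (x₁ t) (x₂ t) (y₁ t, y₂ t, z t)).toReal

variable [Fintype X₁] [Fintype X₂] [Fintype Y₁] [Fintype Y₂] [Fintype Z]

/-- The average probability that at least one of the two messages is decoded wrongly. -/
def Code.errorProb (K : Code X₁ X₂ Y₁ Y₂ c d n) (W : Channel X₁ X₂ Y₁ Y₂ Z) : ℝ :=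
  ∑ ω : K.Outcome Z,
    match ω with
    | (m₁, m₂, x₁, x₂, y₁, y₂, _) =>
      if K.dec₂.estimate m₂ x₂ y₂ ≠ m₁ ∨ K.dec₁.estimate m₁ x₁ y₁ ≠ m₂ then K.mass W ω else 0

/-- `I(M₁, M₂; Zⁿ)`. -/
def Code.jointLeakage (K : Code X₁ X₂ Y₁ Y₂ c d n) (W : Channel X₁ X₂ Y₁ Y₂ Z) : ℝ :=
  mutualInfo (K.mass W) (fun (m₁, m₂, _, _, _, _, _) => (m₁, m₂))
    (fun (_, _, _, _, _, _, z) => z)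

/-- `I(M₁; Zⁿ)`. -/
def Code.leakage₁ (K : Code X₁ X₂ Y₁ Y₂ c d n) (W : Channel X₁ X₂ Y₁ Y₂ Z) : ℝ :=
  mutualInfo (K.mass W) (fun (m₁, _, _, _, _, _, _) => m₁) (fun (_, _, _, _, _, _, z) => z)

/-- `I(M₂; Zⁿ)`. -/
def Code.leakage₂ (K : Code X₁ X₂ Y₁ Y₂ c d n) (W : Channel X₁ X₂ Y₁ Y₂ Z) : ℝ :=
  mutualInfo (K.mass W) (fun (_, m₂, _, _, _, _, _) => m₂) (fun (_, _, _, _, _, _, z) => z)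

/-- The relevant leaked information of the code is at most `δ`. -/
def Code.LeaksAtMost (K : Code X₁ X₂ Y₁ Y₂ c d n) (W : Channel X₁ X₂ Y₁ Y₂ Z)
    (a : SecrecyKind) (δ : ℝ) : Prop :=
  match a with
  | .joint => K.jointLeakage W ≤ δ
  | .individual => K.leakage₁ W ≤ δ ∧ K.leakage₂ W ≤ δ

/-- The bound `τₙ` on the leaked information (strong secrecy) or `n τₙ` (weak secrecy). -/
def SecrecyStrength.bound (b : SecrecyStrength) (n : ℕ) (τ : ℝ) : ℝ :=
  match b with
  | .strong => τ
  | .weak => n * τ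

/-- The set of rate pairs that are achievable over the channel `W` under the secrecy constraint
of kind `a` and strength `b` by codes with encoders of kind `c` and decoders of kind `d`. -/
def capacityRegion (W : Channel X₁ X₂ Y₁ Y₂ Z) (a : SecrecyKind) (b : SecrecyStrength)
    (c : EncoderKind) (d : DecoderKind) : Set (ℝ × ℝ) :=
  {R | ∃ (K : (n : ℕ) → Code X₁ X₂ Y₁ Y₂ c d n) (ε τ : ℕ → ℝ),
    Tendsto (fun n => (K n).rate₁) atTop (𝓝 R.1) ∧
    Tendsto (fun n => (K n).rate₂) atTop (𝓝 R.2) ∧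
    Tendsto ε atTop (𝓝 0) ∧ Tendsto τ atTop (𝓝 0) ∧
    ∀ n, (K n).errorProb W ≤ ε n ∧ (K n).LeaksAtMost W a (b.bound n (τ n))}

end Codes

section SingleLetter

variable {X₁ X₂ Y₁ Y₂ Z : Type u} {V₁ V₂ : Type}

/-- The joint mass function of `(V₁, V₂, X₁, X₂, Y₁, Y₂, Z)` for independent pairs `(V₁, X₁)`,
`(V₂, X₂)`, given by the laws of `Vᵢ` and the conditional laws of `Xᵢ` given `Vᵢ`. -/
def singleLetterMass (W : Channel X₁ X₂ Y₁ Y₂ Z) (p₁ : PMF V₁) (p₂ : PMF V₂)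
    (κ₁ : V₁ → PMF X₁) (κ₂ : V₂ → PMF X₂) : V₁ × V₂ × X₁ × X₂ × Y₁ × Y₂ × Z → ℝ :=
  fun (v₁, v₂, x₁, x₂, y₁, y₂, z) =>
    (p₁ v₁).toReal * (κ₁ v₁ x₁).toReal * ((p₂ v₂).toReal * (κ₂ v₂ x₂).toReal) *
      (W x₁ x₂ (y₁, y₂, z)).toReal

variable [Fintype X₁] [Fintype X₂] [Fintype Y₁] [Fintype Y₂] [Fintype Z]
  [Fintype V₁] [Fintype V₂]

/-- The rate pairs with `R₁ ≤ I(Y₂; V₁ | X₂) - I(Z; V₁)`, `R₂ ≤ I(Y₁; V₂ | X₁) - I(Z; V₂)` and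
`R₁ + R₂ ≤ I(Y₂; V₁ | X₂) + I(Y₁; V₂ | X₁) - I(V₁, V₂; Z)`. -/
def jointSingleLetterRegion (W : Channel X₁ X₂ Y₁ Y₂ Z) (p₁ : PMF V₁) (p₂ : PMF V₂)
    (κ₁ : V₁ → PMF X₁) (κ₂ : V₂ → PMF X₂) : Set (ℝ × ℝ) :=
  let p := singleLetterMass W p₁ p₂ κ₁ κ₂
  let V₁' : V₁ × V₂ × X₁ × X₂ × Y₁ × Y₂ × Z → V₁ := fun (v₁, _, _, _, _, _, _) => v₁
  let V₂' : V₁ × V₂ × X₁ × X₂ × Y₁ × Y₂ × Z → V₂ := fun (_, v₂, _, _, _, _, _) => v₂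
  let X₁' : V₁ × V₂ × X₁ × X₂ × Y₁ × Y₂ × Z → X₁ := fun (_, _, x₁, _, _, _, _) => x₁
  let X₂' : V₁ × V₂ × X₁ × X₂ × Y₁ × Y₂ × Z → X₂ := fun (_, _, _, x₂, _, _, _) => x₂
  let Y₁' : V₁ × V₂ × X₁ × X₂ × Y₁ × Y₂ × Z → Y₁ := fun (_, _, _, _, y₁, _, _) => y₁
  let Y₂' : V₁ × V₂ × X₁ × X₂ × Y₁ × Y₂ × Z → Y₂ := fun (_, _, _, _, _, y₂, _) => y₂
  let Z' : V₁ × V₂ × X₁ × X₂ × Y₁ × Y₂ × Z → Z := fun (_, _, _, _, _, _, z) => z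
  {R | 0 ≤ R.1 ∧ 0 ≤ R.2 ∧
    R.1 ≤ condMutualInfo p Y₂' V₁' X₂' - mutualInfo p Z' V₁' ∧
    R.2 ≤ condMutualInfo p Y₁' V₂' X₁' - mutualInfo p Z' V₂' ∧
    R.1 + R.2 ≤ condMutualInfo p Y₂' V₁' X₂' + condMutualInfo p Y₁' V₂' X₁'
      - mutualInfo p (fun ω => (V₁' ω, V₂' ω)) Z'}

/-- The closure of the convex hull of the union of the single-letter regions over all finite
alphabets of the auxiliary variables and all laws for which `(V₁, X₁)`, `(V₂, X₂)` are
independent. -/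
def jointInnerRegion (W : Channel X₁ X₂ Y₁ Y₂ Z) : Set (ℝ × ℝ) :=
  closure (convexHull ℝ
    (⋃ (k₁ : ℕ) (k₂ : ℕ) (p₁ : PMF (Fin k₁)) (p₂ : PMF (Fin k₂))
      (κ₁ : Fin k₁ → PMF X₁) (κ₂ : Fin k₂ → PMF X₂),
      jointSingleLetterRegion W p₁ p₂ κ₁ κ₂))

end SingleLetter

section Additive

variable {F : Type u} [Field F]

/-- The additive two-way wiretap channel `Yᵢ = aᵢ X₁ + bᵢ X₂ + Nᵢ` (`i = 1, 2`),
`Z = a₃ X₁ + b₃ X₂ + N₃`, where `ν` is the joint law of `(N₁, N₂, N₃)`. -/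
def additiveChannel (a₁ b₁ a₂ b₂ a₃ b₃ : F) (ν : PMF (F × F × F)) : Channel F F F F F :=
  fun x₁ x₂ => ν.map fun (n₁, n₂, n₃) =>
    (a₁ * x₁ + b₁ * x₂ + n₁, a₂ * x₁ + b₂ * x₂ + n₂, a₃ * x₁ + b₃ * x₂ + n₃)

/-- The law of `N₁`. -/
def noise₁ (ν : PMF (F × F × F)) : PMF F := ν.map fun (n₁, _, _) => n₁

/-- The law of `N₂`. -/
def noise₂ (ν : PMF (F × F × F)) : PMF F := ν.map fun (_, n₂, _) => n₂

/-- The law of `N₃`. -/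
def noise₃ (ν : PMF (F × F × F)) : PMF F := ν.map fun (_, _, n₃) => n₃

/-- `N₃` has the law of `s N₁ + t N₂ + N₃'` for independent `N₁`, `N₂` and some `N₃'` that is
independent of them. -/
def NoiseDecomposes (s t : F) (ν : PMF (F × F × F)) : Prop :=
  ∃ ρ : PMF F, noise₃ ν =
    (noise₁ ν).bind fun n₁ => (noise₂ ν).bind fun n₂ => ρ.map fun n₃' => s * n₁ + t * n₂ + n₃'

variable [Fintype F]

/-- The region `R₁ ≤ log q - H(N₂)`, `R₂ ≤ log q - H(N₁)`. -/
def outerRegion (ν : PMF (F × F × F)) : Set (ℝ × ℝ) :=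
  {R | 0 ≤ R.1 ∧ 0 ≤ R.2 ∧
    R.1 ≤ Real.log (Fintype.card F) - pmfEntropy (noise₂ ν) ∧
    R.2 ≤ Real.log (Fintype.card F) - pmfEntropy (noise₁ ν)}

/-- The region `R₁ ≤ log q - H(N₂)`, `R₂ ≤ log q - H(N₁)`,
`R₁ + R₂ ≤ log q + H(N₃) - H(N₁) - H(N₂)`. -/
def jointRegion (ν : PMF (F × F × F)) : Set (ℝ × ℝ) :=
  {R | 0 ≤ R.1 ∧ 0 ≤ R.2 ∧
    R.1 ≤ Real.log (Fintype.card F) - pmfEntropy (noise₂ ν) ∧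
    R.2 ≤ Real.log (Fintype.card F) - pmfEntropy (noise₁ ν) ∧
    R.1 + R.2 ≤ Real.log (Fintype.card F) + pmfEntropy (noise₃ ν)
      - pmfEntropy (noise₁ ν) - pmfEntropy (noise₂ ν)}

end Additive

end TwoWayWiretap

end

open TwoWayWiretap

/-! A user can subtract its own input, so the two users face the point-to-point links S₁ = a₂X₁ + N₂
and S₂ = b₁X₂ + N₁, while the eavesdropper sees Z = a₃X₁ + b₃X₂ + N₃. Without feedback no
information quantity involves two noise components at once, so the correlation of the noises drops
out. The inequalities are proved for inputs in a finite `F`-module `G`: taking `G = F` gives the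
single-letter region, and taking `G` to be the sequences of length n gives the codes, because a
nonadaptive code is one use of the channel over that module with the messages as auxiliary variables
V₁, V₂.

Sum rate, upper bound. After Fano's inequality one has to bound I(V₁;S₁) + I(V₂;S₂) - I(V₁,V₂;Z).
The decomposition of N₃ provides a coupling with Z = (a₃/a₂)S₁ + (b₃/b₁)S₂ + N₃'. In it,
nonnegativity of I(S₁,S₂; X₁,X₂ | V₁,V₂,Z) reads H(V₁,V₂,Z) ≤ H(V₁,S₁) + H(V₂,S₂) + H(N₃) - H(N₁) -
H(N₂). With H(S₂) ≤ H(Z) and H(S₁) ≤ log |G| this is `signalInfo_add_signalInfo_sub_sumInfo_le`.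

Adaptive codes. Feedback ties the inputs to the noises, so `log_size₁_le_adaptive` changes the
measure instead: N₂ is made uniform and the conditional law of the other noises is kept. User 2 can
then only guess, and the mean log-likelihood ratio under the true law is n (log q - H(N₂)). The
other user follows by symmetry.

Achievability. Each message of User i gets about e^(n rᵢ) random codewords out of uniformly drawn
codebooks. Decoding message and codeword index succeeds if R₁ + r₁ < log q - H(N₂) and R₂ + r₂ < log
q - H(N₁) (`sum_decodingError_le`). Given the messages, Z is almost uniform if r₁ + r₂ > log q -
H(N₃), since the received words are pairwise independent and uniform
(`sum_log_card_sub_entropy_mixture_le`). Suitable r₁, r₂ ≥ 0 exist for pairs slightly inside the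
region; a user of rate 0 has a single message, which needs no decoding. Chernoff bounds replace
typicality.

The single-letter region attains all bounds with V = X uniform, because each input then masks the
other one completely. -/

noncomputable section

set_option linter.unusedSectionVars false

namespace TwoWayWiretap

/-! ### Entropy of finite-valued random variables. -/

section Toolbox

variable {Ω Ω' A B C : Type*} [Fintype Ω] [Fintype Ω'] [Fintype A] [Fintype B] [Fintype C]

/-- A mass function of a probability law on a finite set. -/
structure IsMass (p : Ω → ℝ) : Prop where
  nonneg : ∀ ω, 0 ≤ p ω
  sum_eq_one : ∑ ω, p ω = 1

theorem sum_law_mul (p : Ω → ℝ) (f : Ω → A) (φ : A → ℝ) :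
    ∑ a, law p f a * φ a = ∑ ω, p ω * φ (f ω) := by
  classical
  simp only [law, Finset.sum_mul]
  rw [Finset.sum_comm]
  refine Finset.sum_congr rfl fun ω _ => ?_
  rw [Finset.sum_eq_single (f ω)]
  · simp
  · intro a _ ha
    simp [Ne.symm ha]
  · simp

theorem law_eq_sum_mul (p : Ω → ℝ) (f : Ω → A) (a : A) [DecidableEq A] :
    law p f a = ∑ ω, p ω * (if f ω = a then 1 else 0) := by
  simp only [law, mul_ite, mul_one, mul_zero]
  refine Finset.sum_congr rfl fun ω _ => ?_
  split_ifs <;> rfl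

theorem law_law (p : Ω → ℝ) (f : Ω → A) (g : A → B) :
    law (law p f) g = law p (fun ω => g (f ω)) := by
  classical
  ext b
  rw [law_eq_sum_mul, law_eq_sum_mul, sum_law_mul]

theorem law_id (p : Ω → ℝ) : law p (fun ω => ω) = p := by
  classical
  ext ω
  rw [law_eq_sum_mul]
  simp

theorem sum_law (p : Ω → ℝ) (f : Ω → A) : ∑ a, law p f a = ∑ ω, p ω := by
  simpa using sum_law_mul p f (fun _ => 1)

theorem law_nonneg {p : Ω → ℝ} (hp : ∀ ω, 0 ≤ p ω) (f : Ω → A) (a : A) : 0 ≤ law p f a :=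
  Finset.sum_nonneg fun ω _ => by split_ifs <;> simp [hp]

theorem le_law {p : Ω → ℝ} (hp : ∀ ω, 0 ≤ p ω) (f : Ω → A) (ω : Ω) : p ω ≤ law p f (f ω) := by
  classical
  refine le_trans ?_ (Finset.single_le_sum (fun ω _ => ?_) (Finset.mem_univ ω))
  · simp
  · split_ifs <;> simp [hp]

theorem IsMass.law {p : Ω → ℝ} (hp : IsMass p) (f : Ω → A) : IsMass (law p f) :=
  ⟨law_nonneg hp.nonneg f, by rw [sum_law, hp.sum_eq_one]⟩

theorem law_comp_injective (p : Ω → ℝ) (f : Ω → A) {g : A → B} (hg : Function.Injective g)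
    (a : A) : law p (fun ω => g (f ω)) (g a) = law p f a := by
  classical
  simp only [law_eq_sum_mul, hg.eq_iff]

theorem law_comp_equiv (p : Ω → ℝ) (e : Ω' ≃ Ω) (f : Ω → A) :
    law (fun ω => p (e ω)) (fun ω => f (e ω)) = law p f := by
  classical
  ext a
  rw [law_eq_sum_mul, law_eq_sum_mul]
  exact e.sum_comp fun ω => p ω * (if f ω = a then 1 else 0)

theorem entropy_eq_sum (p : Ω → ℝ) (f : Ω → A) :
    entropy p f = -∑ ω, p ω * Real.log (law p f (f ω)) := by
  rw [← sum_law_mul p f (fun a => Real.log (law p f a)), ← Finset.sum_neg_distrib]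
  exact Finset.sum_congr rfl fun a _ => by rw [Real.negMulLog, neg_mul]

theorem entropy_law (p : Ω → ℝ) (f : Ω → A) (g : A → B) :
    entropy (law p f) g = entropy p (fun ω => g (f ω)) := by
  rw [entropy, law_law, entropy]

theorem mutualInfo_law (p : Ω → ℝ) (f : Ω → A) (g : A → B) (h : A → C) :
    mutualInfo (law p f) g h = mutualInfo p (fun ω => g (f ω)) (fun ω => h (f ω)) := by
  simp only [mutualInfo, entropy_law]

theorem entropy_comp_injective (p : Ω → ℝ) (f : Ω → A) {g : A → B} (hg : Function.Injective g) :
    entropy p (fun ω => g (f ω)) = entropy p f := by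
  rw [entropy_eq_sum, entropy_eq_sum]
  simp only [law_comp_injective p f hg]

/-- The entropy of a random variable only depends on the partition it induces. -/
theorem entropy_congr_of_injective (p : Ω → ℝ) {f : Ω → A} {f' : Ω → B} (g : A → B)
    (hg : Function.Injective g) (h : ∀ ω, f' ω = g (f ω)) : entropy p f' = entropy p f := by
  rw [← entropy_comp_injective p f hg]
  congr 1
  exact funext h

theorem entropy_pair_comm (p : Ω → ℝ) (f : Ω → A) (g : Ω → B) :
    entropy p (fun ω => (f ω, g ω)) = entropy p (fun ω => (g ω, f ω)) :=
  entropy_congr_of_injective p Prod.swap Prod.swap_injective fun _ => rfl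

/-- Gibbs' inequality. -/
theorem entropy_le_cross {p : Ω → ℝ} (hp : IsMass p) (f : Ω → A) {s : A → ℝ}
    (hs : ∀ a, 0 ≤ s a) (hs1 : ∑ a, s a ≤ 1) (hac : ∀ ω, 0 < p ω → 0 < s (f ω)) :
    entropy p f ≤ -∑ ω, p ω * Real.log (s (f ω)) := by
  rw [entropy_eq_sum, neg_le_neg_iff]
  -- This is log x ≤ x - 1 at x = s / law; summed over ω, the correction is at most ∑ s - 1 ≤ 0.
  have key : ∀ ω, p ω * Real.log (s (f ω)) ≤
      p ω * Real.log (law p f (f ω)) + (p ω * (s (f ω) / law p f (f ω)) - p ω) := by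
    intro ω
    rcases (hp.nonneg ω).eq_or_lt with h0 | h0
    · simp [← h0]
    · have hl := h0.trans_le (le_law hp.nonneg f ω)
      have := Real.log_le_sub_one_of_pos (div_pos (hac ω h0) hl)
      rw [Real.log_div (hac ω h0).ne' hl.ne'] at this
      nlinarith
  refine (Finset.sum_le_sum fun ω _ => key ω).trans ?_
  rw [Finset.sum_add_distrib, Finset.sum_sub_distrib, hp.sum_eq_one,
    ← sum_law_mul p f (fun a => s a / law p f a)]
  have : ∑ a, law p f a * (s a / law p f a) ≤ ∑ a, s a := by
    refine Finset.sum_le_sum fun a _ => ?_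
    rcases (law_nonneg hp.nonneg f a).eq_or_lt with h0 | h0
    · simp [← h0, hs]
    · rw [mul_div_cancel₀ _ h0.ne']
  linarith

theorem IsMass.nonempty {p : Ω → ℝ} (hp : IsMass p) : Nonempty Ω := by
  by_contra h
  rw [not_nonempty_iff] at h
  simpa using hp.sum_eq_one

theorem entropy_le_log_card {p : Ω → ℝ} (hp : IsMass p) (f : Ω → A) :
    entropy p f ≤ Real.log (Fintype.card A) := by
  have hA : Nonempty A := hp.nonempty.map f
  have hc : (0 : ℝ) < Fintype.card A := by exact_mod_cast Fintype.card_pos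
  have := entropy_le_cross hp f (s := fun _ => 1 / (Fintype.card A : ℝ))
    (fun _ => by positivity) (by simp [hc.ne']) (fun _ _ => by positivity)
  rwa [← Finset.sum_mul, hp.sum_eq_one, one_mul, one_div, Real.log_inv, neg_neg] at this

theorem sum_law_pair_left (p : Ω → ℝ) (f : Ω → A) (g : Ω → B) (b : B) :
    ∑ a, law p (fun ω => (f ω, g ω)) (a, b) = law p g b := by
  classical
  simp only [law_eq_sum_mul, Prod.mk.injEq]
  rw [Finset.sum_comm]
  refine Finset.sum_congr rfl fun ω _ => ?_
  rw [← Finset.mul_sum]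
  congr 1
  by_cases h : g ω = b <;> simp [h]

/-- Submodularity of entropy. -/
theorem entropy_submodular {p : Ω → ℝ} (hp : IsMass p) (f : Ω → A) (g : Ω → B) (h : Ω → C) :
    entropy p (fun ω => (f ω, g ω, h ω)) + entropy p h ≤
      entropy p (fun ω => (f ω, h ω)) + entropy p (fun ω => (g ω, h ω)) := by
  -- The comparison law makes f and g conditionally independent given h.
  have key := entropy_le_cross hp (fun ω => (f ω, g ω, h ω))
    (s := fun x => law p (fun ω => (f ω, h ω)) (x.1, x.2.2) *
      law p (fun ω => (g ω, h ω)) (x.2.1, x.2.2) / law p h x.2.2)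
    (fun x => div_nonneg (mul_nonneg (law_nonneg hp.nonneg _ _) (law_nonneg hp.nonneg _ _))
      (law_nonneg hp.nonneg _ _)) ?_ ?_
  · have e : ∀ ω, p ω * Real.log (law p (fun ω => (f ω, h ω)) (f ω, h ω) *
        law p (fun ω => (g ω, h ω)) (g ω, h ω) / law p h (h ω)) =
        p ω * Real.log (law p (fun ω => (f ω, h ω)) (f ω, h ω)) +
        p ω * Real.log (law p (fun ω => (g ω, h ω)) (g ω, h ω)) -
        p ω * Real.log (law p h (h ω)) := by
      intro ω
      rcases (hp.nonneg ω).eq_or_lt with h0 | h0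
      · simp [← h0]
      · have h1 := h0.trans_le (le_law hp.nonneg (fun ω => (f ω, h ω)) ω)
        have h2 := h0.trans_le (le_law hp.nonneg (fun ω => (g ω, h ω)) ω)
        have h3 := h0.trans_le (le_law hp.nonneg h ω)
        rw [Real.log_div (mul_pos h1 h2).ne' h3.ne', Real.log_mul h1.ne' h2.ne']
        ring
    simp only [e, Finset.sum_sub_distrib, Finset.sum_add_distrib] at key
    rw [entropy_eq_sum p h, entropy_eq_sum p (fun ω => (f ω, h ω)),
      entropy_eq_sum p (fun ω => (g ω, h ω))]
    linarith
  · rw [← hp.sum_eq_one, ← sum_law p h, Fintype.sum_prod_type]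
    simp only [Fintype.sum_prod_type]
    rw [Finset.sum_comm]
    simp only [Finset.sum_comm (s := (Finset.univ : Finset A)) (t := (Finset.univ : Finset C))]
    rw [Finset.sum_comm]
    refine Finset.sum_le_sum fun c _ => ?_
    simp only [mul_div_assoc, ← Finset.sum_mul, sum_law_pair_left, ← Finset.mul_sum]
    rw [← Finset.sum_div, sum_law_pair_left]
    -- Values of h of probability zero contribute 0, because division by zero gives 0.
    rcases (law_nonneg hp.nonneg h c).eq_or_lt with h0 | h0
    · simp [← h0]
    · rw [mul_div_cancel₀ _ h0.ne']
  · intro ω h0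
    exact div_pos (mul_pos (h0.trans_le (le_law hp.nonneg (fun ω => (f ω, h ω)) ω))
      (h0.trans_le (le_law hp.nonneg (fun ω => (g ω, h ω)) ω)))
      (h0.trans_le (le_law hp.nonneg h ω))

theorem entropy_const {p : Ω → ℝ} (hp : IsMass p) (b : B) : entropy p (fun _ => b) = 0 := by
  classical
  rw [entropy_eq_sum]
  simp [law_eq_sum_mul, hp.sum_eq_one]

theorem entropy_pair_le {p : Ω → ℝ} (hp : IsMass p) (f : Ω → A) (g : Ω → B) :
    entropy p (fun ω => (f ω, g ω)) ≤ entropy p f + entropy p g := by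
  have h := entropy_submodular hp f g (fun _ => ())
  rw [entropy_const hp,
    entropy_congr_of_injective p (f := f) (fun a => (a, ())) (fun a b h => (Prod.mk.inj h).1)
      (fun _ => rfl),
    entropy_congr_of_injective p (f := g) (fun a => (a, ())) (fun a b h => (Prod.mk.inj h).1)
      (fun _ => rfl),
    entropy_congr_of_injective p (f := fun ω => (f ω, g ω)) (fun a => (a.1, a.2, ()))
      (fun a b h => by simpa [Prod.ext_iff] using h) (fun _ => rfl)] at h
  linarith

/-- Submodularity with f in both slots says that I(f; f | g) = H(f | g) is nonnegative. -/
theorem entropy_snd_le {p : Ω → ℝ} (hp : IsMass p) (f : Ω → A) (g : Ω → B) :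
    entropy p g ≤ entropy p (fun ω => (f ω, g ω)) := by
  have h := entropy_submodular hp f f g
  rw [entropy_congr_of_injective p (f := fun ω => (f ω, g ω)) (fun a => (a.1, a.1, a.2))
      (fun a b h => by
        simp only [Prod.mk.injEq] at h
        exact Prod.ext h.1 h.2.2) (fun _ => rfl)] at h
  linarith

theorem entropy_fst_le {p : Ω → ℝ} (hp : IsMass p) (f : Ω → A) (g : Ω → B) :
    entropy p f ≤ entropy p (fun ω => (f ω, g ω)) := by
  rw [entropy_pair_comm]
  exact entropy_snd_le hp g f

theorem mutualInfo_nonneg {p : Ω → ℝ} (hp : IsMass p) (f : Ω → A) (g : Ω → B) :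
    0 ≤ mutualInfo p f g := by
  have := entropy_pair_le hp f g
  rw [mutualInfo]
  linarith

/-- The mass function of the product law. -/
def prodMass (p : Ω → ℝ) (q : Ω' → ℝ) : Ω × Ω' → ℝ := fun ω => p ω.1 * q ω.2

theorem IsMass.prod {p : Ω → ℝ} {q : Ω' → ℝ} (hp : IsMass p) (hq : IsMass q) :
    IsMass (prodMass p q) := by
  refine ⟨fun ω => mul_nonneg (hp.nonneg _) (hq.nonneg _), ?_⟩
  rw [Fintype.sum_prod_type]
  simp only [prodMass, ← Finset.mul_sum, hq.sum_eq_one, mul_one, hp.sum_eq_one]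

theorem law_prodMass (p : Ω → ℝ) (q : Ω' → ℝ) (f : Ω → A) (g : Ω' → B) :
    law (prodMass p q) (fun ω => (f ω.1, g ω.2)) = prodMass (law p f) (law q g) := by
  classical
  ext ⟨a, b⟩
  simp only [prodMass, law_eq_sum_mul, Fintype.sum_prod_type, Finset.sum_mul_sum, Prod.mk.injEq]
  refine Finset.sum_congr rfl fun x _ => Finset.sum_congr rfl fun y _ => ?_
  by_cases h1 : f x = a <;> by_cases h2 : g y = b <;> simp [h1, h2]

theorem law_prodMass_fst (p : Ω → ℝ) {q : Ω' → ℝ} (hq : IsMass q) (f : Ω → A) :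
    law (prodMass p q) (fun ω => f ω.1) = law p f := by
  classical
  ext a
  simp only [prodMass, law_eq_sum_mul, Fintype.sum_prod_type]
  refine Finset.sum_congr rfl fun x _ => ?_
  by_cases h : f x = a
  · simp [h, ← Finset.mul_sum, hq.sum_eq_one]
  · simp [h]

theorem law_prodMass_snd {p : Ω → ℝ} (hp : IsMass p) (q : Ω' → ℝ) (f : Ω' → A) :
    law (prodMass p q) (fun ω => f ω.2) = law q f := by
  classical
  ext a
  simp only [prodMass, law_eq_sum_mul, Fintype.sum_prod_type]
  rw [Finset.sum_comm]
  refine Finset.sum_congr rfl fun x _ => ?_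
  by_cases h : f x = a
  · simp [h, ← Finset.sum_mul, hp.sum_eq_one]
  · simp [h]

/-- The law of an output which depends on the input and on independent noise. -/
theorem law_prodMass_skew (p : Ω → ℝ) (q : Ω' → ℝ) (k : Ω → Ω' → A) (ω : Ω) (a : A) :
    law (prodMass p q) (fun x => (x.1, k x.1 x.2)) (ω, a) = p ω * law q (k ω) a := by
  classical
  simp only [prodMass, law_eq_sum_mul, Fintype.sum_prod_type, Finset.mul_sum, Prod.mk.injEq]
  rw [Finset.sum_eq_single ω]
  · refine Finset.sum_congr rfl fun y _ => ?_
    by_cases h : k ω y = a <;> simp [h]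
  · intro x _ hx
    simp [hx]
  · simp

theorem entropy_prodMass_fst (p : Ω → ℝ) {q : Ω' → ℝ} (hq : IsMass q) (f : Ω → A) :
    entropy (prodMass p q) (fun ω => f ω.1) = entropy p f := by
  rw [entropy, law_prodMass_fst p hq, entropy]

theorem entropy_prodMass_snd {p : Ω → ℝ} (hp : IsMass p) (q : Ω' → ℝ) (f : Ω' → A) :
    entropy (prodMass p q) (fun ω => f ω.2) = entropy q f := by
  rw [entropy, law_prodMass_snd hp q, entropy]

theorem entropy_prodMass {p : Ω → ℝ} {q : Ω' → ℝ} (hp : IsMass p) (hq : IsMass q)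
    (f : Ω → A) (g : Ω' → B) :
    entropy (prodMass p q) (fun ω => (f ω.1, g ω.2)) = entropy p f + entropy q g := by
  simp only [entropy, law_prodMass, prodMass, Real.negMulLog_mul, Fintype.sum_prod_type,
    Finset.sum_add_distrib]
  rw [Finset.sum_comm]
  simp only [← Finset.mul_sum, ← Finset.sum_mul, (hp.law f).sum_eq_one, (hq.law g).sum_eq_one,
    one_mul]

theorem entropy_id (p : Ω → ℝ) : entropy p (fun ω => ω) = ∑ ω, Real.negMulLog (p ω) := by
  rw [entropy, law_id]

end Toolbox

/-! ### The additive model over a module and the entropy inequality for the sum rate. -/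

section AdditiveModel

variable {A B N N' N'' : Type*} [Fintype A] [Fintype B] [Fintype N] [Fintype N'] [Fintype N'']

/-- The joint noise may have correlated components. This isolates the one component `k` that a
receiver sees, grouped with the input that it wants to recover and independent of the other input.
-/
theorem law_prodMass_left_noise (p : A → ℝ) (q : B → ℝ) (w : N → ℝ) (k : N → N') :
    law (prodMass (prodMass p q) w) (fun ω => ((ω.1.1, k ω.2), ω.1.2)) =
      prodMass (prodMass p (law w k)) q := by
  let e : (A × N) × B ≃ (A × B) × N :=
    ⟨fun x => ((x.1.1, x.2), x.1.2), fun x => ((x.1.1, x.2), x.1.2), fun _ => rfl, fun _ => rfl⟩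
  rw [← law_comp_equiv _ e]
  have h1 : (fun ω => prodMass (prodMass p q) w (e ω)) = prodMass (prodMass p w) q := by
    ext ω
    simp only [prodMass, e, Equiv.coe_fn_mk]
    ring
  rw [h1]
  refine (law_prodMass (prodMass p w) q (fun x => (x.1, k x.2)) (fun x => x)).trans ?_
  rw [law_id]
  congr 1
  refine (law_prodMass p w (fun x => x) k).trans ?_
  rw [law_id]

theorem law_prodMass_right_noise (p : A → ℝ) (q : B → ℝ) (w : N → ℝ) (k : N → N') :
    law (prodMass (prodMass p q) w) (fun ω => ((ω.1.2, k ω.2), ω.1.1)) =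
      prodMass (prodMass q (law w k)) p := by
  rw [← law_prodMass_left_noise,
    ← law_comp_equiv _ (Equiv.prodCongr (Equiv.prodComm A B) (Equiv.refl N))]
  congr 1
  ext ω
  simp only [prodMass, Equiv.prodCongr_apply, Equiv.prodComm_apply, Prod.map, Prod.fst_swap,
    Prod.snd_swap, Equiv.refl_apply]
  ring

theorem law_prodMass_noise (p : A → ℝ) (w : N → ℝ) (k : N → N') :
    law (prodMass p w) (fun ω => (ω.1, k ω.2)) = prodMass p (law w k) := by
  refine (law_prodMass p w (fun x => x) k).trans ?_
  rw [law_id]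

/-- Builds the coupling for the sum rate: each input is paired with the noise at the opposite
receiver, and the eavesdropper's noise becomes a function of these noises and a third one. -/
theorem law_prodMass_interleave (p : A → ℝ) (q : B → ℝ) (w : N → ℝ) (w' : N' → ℝ)
    (w'' : N'' → ℝ) {D : Type*} [Fintype D] (k : (N × N') × N'' → D) :
    law (prodMass (prodMass (prodMass p w') (prodMass q w)) w'')
      (fun ω => ((ω.1.1.1, ω.1.2.1), k ((ω.1.2.2, ω.1.1.2), ω.2))) =
      prodMass (prodMass p q) (law (prodMass (prodMass w w') w'') k) := by
  let e : (A × B) × ((N × N') × N'') ≃ ((A × N') × (B × N)) × N'' :=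
    ⟨fun x => (((x.1.1, x.2.1.2), (x.1.2, x.2.1.1)), x.2.2),
      fun x => ((x.1.1.1, x.1.2.1), ((x.1.2.2, x.1.1.2), x.2)), fun _ => rfl, fun _ => rfl⟩
  rw [← law_comp_equiv _ e, ← law_prodMass_noise]
  congr 1
  ext ω
  simp only [prodMass, e, Equiv.coe_fn_mk]
  ring

variable {F G V V₁ V₂ : Type*} [Field F] [AddCommGroup G] [Module F G] [Fintype G]
  [Fintype V] [Fintype V₁] [Fintype V₂]

/-- `I(V; a X + N)` when `(V, X)` has mass function `r` and the independent noise `N` has mass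
function `μ`. -/
def signalInfo (r : V × G → ℝ) (μ : G → ℝ) (a : F) : ℝ :=
  mutualInfo (prodMass r μ) (fun ω => ω.1.1) (fun ω => a • ω.1.2 + ω.2)

/-- `I(V₁, V₂; a X₁ + b X₂ + N)` for independent `(V₁, X₁)`, `(V₂, X₂)`, `N`. -/
def sumInfo (r₁ : V₁ × G → ℝ) (r₂ : V₂ × G → ℝ) (μ : G → ℝ) (a b : F) : ℝ :=
  mutualInfo (prodMass (prodMass r₁ r₂) μ) (fun ω => (ω.1.1.1, ω.1.2.1))
    (fun ω => a • ω.1.1.2 + b • ω.1.2.2 + ω.2)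

/-- The output has entropy at most log |G|, and conditioning on X in addition to V lowers its
conditional entropy to that of the noise. -/
theorem signalInfo_le {r : V × G → ℝ} {μ : G → ℝ} (hr : IsMass r) (hμ : IsMass μ) (a : F) :
    signalInfo r μ a ≤ Real.log (Fintype.card G) - ∑ g, Real.negMulLog (μ g) := by
  have hp := hr.prod hμ
  have h1 := entropy_le_log_card hp (fun ω => a • ω.1.2 + ω.2)
  have h2 := entropy_submodular hp (fun ω => ω.1.2) (fun ω => a • ω.1.2 + ω.2) (fun ω => ω.1.1)
  have h3 : entropy (prodMass r μ) (fun ω => (ω.1.2, a • ω.1.2 + ω.2, ω.1.1)) =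
      entropy r (fun ω => ω) + entropy μ (fun ω => ω) := by
    rw [← entropy_prodMass hr hμ]
    refine entropy_congr_of_injective _ (fun x => (x.1.2, a • x.1.2 + x.2, x.1.1)) ?_ fun _ => rfl
    rintro ⟨⟨v, x⟩, n⟩ ⟨⟨v', x'⟩, n'⟩ h
    simp only [Prod.mk.injEq] at h
    obtain ⟨rfl, h, rfl⟩ := h
    simpa using h
  have h4 : entropy (prodMass r μ) (fun ω => (ω.1.2, ω.1.1)) = entropy r (fun ω => ω) := by
    rw [entropy_prodMass_fst r hμ (fun x => (x.2, x.1))]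
    exact entropy_congr_of_injective _ Prod.swap Prod.swap_injective fun _ => rfl
  rw [h3, h4, entropy_id μ] at h2
  rw [signalInfo, mutualInfo, entropy_pair_comm]
  linarith

/-- The entropy inequality behind the bound on the sum rate. -/
theorem signalInfo_add_signalInfo_sub_sumInfo_le {r₁ : V₁ × G → ℝ} {r₂ : V₂ × G → ℝ}
    {μ₁ μ₂ ρ : G → ℝ} (hr₁ : IsMass r₁) (hr₂ : IsMass r₂) (hμ₁ : IsMass μ₁) (hμ₂ : IsMass μ₂)
    (hρ : IsMass ρ) {a₂ b₁ : F} (a₃ b₃ : F) (ha₂ : a₂ ≠ 0) (hb₁ : b₁ ≠ 0) (hb₃ : b₃ ≠ 0)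
    {μ₃ : G → ℝ} (hμ₃ : μ₃ = law (prodMass (prodMass μ₁ μ₂) ρ)
      (fun n => (b₃ / b₁) • n.1.1 + (a₃ / a₂) • n.1.2 + n.2)) :
    signalInfo r₁ μ₂ a₂ + signalInfo r₂ μ₁ b₁ - sumInfo r₁ r₂ μ₃ a₃ b₃ ≤
      Real.log (Fintype.card G) + ∑ g, Real.negMulLog (μ₃ g) - ∑ g, Real.negMulLog (μ₁ g)
        - ∑ g, Real.negMulLog (μ₂ g) := by
  have hs₁ := hr₁.prod hμ₂
  have hs₂ := hr₂.prod hμ₁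
  have hs := hs₁.prod hs₂
  have hq := hs.prod hρ
  have hμ₃' : IsMass μ₃ := hμ₃ ▸ ((hμ₁.prod hμ₂).prod hρ).law _
  -- On this space the noise of the eavesdropper is built from N₁, N₂ and N₃', yet it is still
  -- independent of the inputs and has mass function `μ₃`.
  have hT : law (prodMass (prodMass (prodMass r₁ μ₂) (prodMass r₂ μ₁)) ρ)
      (fun ω => ((ω.1.1.1, ω.1.2.1), (b₃ / b₁) • ω.1.2.2 + (a₃ / a₂) • ω.1.1.2 + ω.2)) =
      prodMass (prodMass r₁ r₂) μ₃ := by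
    rw [hμ₃]
    exact law_prodMass_interleave (D := G) r₁ r₂ μ₁ μ₂ ρ
      (fun n => (b₃ / b₁) • n.1.1 + (a₃ / a₂) • n.1.2 + n.2)
  set q := prodMass (prodMass (prodMass r₁ μ₂) (prodMass r₂ μ₁)) ρ with hqdef
  let SA : ((V₁ × G) × G) → G := fun ω => a₂ • ω.1.2 + ω.2
  let SB : ((V₂ × G) × G) → G := fun ω => b₁ • ω.1.2 + ω.2
  let Z : ((((V₁ × G) × G) × ((V₂ × G) × G)) × G) → G :=
    fun ω => a₃ • ω.1.1.1.2 + b₃ • ω.1.2.1.2 +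
      ((b₃ / b₁) • ω.1.2.2 + (a₃ / a₂) • ω.1.1.2 + ω.2)
  have hZ : ∀ ω, Z ω = (a₃ / a₂) • SA ω.1.1 + (b₃ / b₁) • SB ω.1.2 + ω.2 := by
    intro ω
    simp only [Z, SA, SB, smul_add, smul_smul, div_mul_cancel₀ _ ha₂, div_mul_cancel₀ _ hb₁]
    abel
  -- Nonnegativity of I(S₁,S₂; X₁,X₂ | V₁,V₂,Z). The three entropies other than H(V₁,V₂,Z) split
  -- into sums over independent blocks by injective changes of variables.
  have hsub := entropy_submodular hq (fun ω => (SA ω.1.1, SB ω.1.2))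
    (fun ω => (ω.1.1.1.2, ω.1.2.1.2)) (fun ω => ((ω.1.1.1.1, ω.1.2.1.1), Z ω))
  have hall : entropy q (fun ω => ((SA ω.1.1, SB ω.1.2), (ω.1.1.1.2, ω.1.2.1.2),
      ((ω.1.1.1.1, ω.1.2.1.1), Z ω))) = entropy r₁ (fun ω => ω) + entropy μ₂ (fun ω => ω) +
        (entropy r₂ (fun ω => ω) + entropy μ₁ (fun ω => ω)) + entropy ρ (fun ω => ω) := by
    rw [← entropy_prodMass hr₁ hμ₂, ← entropy_prodMass hr₂ hμ₁, ← entropy_prodMass hs₁ hs₂,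
      ← entropy_prodMass hs hρ]
    refine entropy_congr_of_injective _ (fun ω => ((SA ω.1.1, SB ω.1.2), (ω.1.1.1.2, ω.1.2.1.2),
      ((ω.1.1.1.1, ω.1.2.1.1), Z ω))) ?_ fun _ => rfl
    rintro ⟨⟨⟨⟨v, x⟩, n⟩, ⟨v', x'⟩, n'⟩, m⟩ ⟨⟨⟨⟨w, y⟩, k⟩, ⟨w', y'⟩, k'⟩, l⟩ h
    simp only [Prod.mk.injEq, SA, SB, Z] at h
    obtain ⟨⟨h1, h2⟩, ⟨rfl, rfl⟩, ⟨rfl, rfl⟩, h3⟩ := h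
    have h1 := add_left_cancel h1
    have h2 := add_left_cancel h2
    subst h1 h2
    simpa using h3
  have hAB : entropy q (fun ω => ((SA ω.1.1, SB ω.1.2), ((ω.1.1.1.1, ω.1.2.1.1), Z ω))) =
      entropy (prodMass r₁ μ₂) (fun ω => (ω.1.1, SA ω)) +
        entropy (prodMass r₂ μ₁) (fun ω => (ω.1.1, SB ω)) + entropy ρ (fun ω => ω) := by
    rw [← entropy_prodMass hs₁ hs₂, ← entropy_prodMass hs hρ]
    refine entropy_congr_of_injective _ (fun x => ((x.1.1.2, x.1.2.2), ((x.1.1.1, x.1.2.1),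
      (a₃ / a₂) • x.1.1.2 + (b₃ / b₁) • x.1.2.2 + x.2))) ?_ fun ω => by rw [hZ]
    rintro ⟨⟨⟨v, x⟩, v', x'⟩, m⟩ ⟨⟨⟨w, y⟩, w', y'⟩, l⟩ h
    simp only [Prod.mk.injEq] at h
    obtain ⟨⟨rfl, rfl⟩, ⟨rfl, rfl⟩, h3⟩ := h
    simpa using h3
  have hXX : entropy q (fun ω => ((ω.1.1.1.2, ω.1.2.1.2), ((ω.1.1.1.1, ω.1.2.1.1), Z ω))) =
      entropy r₁ (fun ω => ω) + entropy r₂ (fun ω => ω) + entropy μ₃ (fun ω => ω) := by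
    rw [← entropy_prodMass hr₁ hr₂, ← entropy_prodMass (hr₁.prod hr₂) hμ₃', ← hT, entropy_law]
    refine entropy_congr_of_injective _ (fun x => ((x.1.1.2, x.1.2.2), ((x.1.1.1, x.1.2.1),
      a₃ • x.1.1.2 + b₃ • x.1.2.2 + x.2))) ?_ fun ω => rfl
    rintro ⟨⟨⟨v, x⟩, v', x'⟩, m⟩ ⟨⟨⟨w, y⟩, w', y'⟩, l⟩ h
    simp only [Prod.mk.injEq] at h
    obtain ⟨⟨rfl, rfl⟩, ⟨rfl, rfl⟩, h3⟩ := h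
    simpa using h3
  -- Adding independent terms cannot lower entropy: given S₁ and N₃', the variable Z is a bijective
  -- function of S₂ since b₃ / b₁ ≠ 0.
  have hSB : entropy (prodMass r₂ μ₁) SB ≤ entropy q Z := by
    have h1 := entropy_pair_le hq Z (fun ω => (SA ω.1.1, ω.2))
    have h2 : entropy q (fun ω => (SA ω.1.1, ω.2)) =
        entropy (prodMass r₁ μ₂) SA + entropy ρ (fun ω => ω) := by
      rw [← entropy_prodMass_fst (prodMass r₁ μ₂) hs₂ SA,
        ← entropy_prodMass hs hρ (fun x => SA x.1)]
    have h3 : entropy q (fun ω => (Z ω, SA ω.1.1, ω.2)) = entropy (prodMass r₁ μ₂) SA +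
        entropy (prodMass r₂ μ₁) SB + entropy ρ (fun ω => ω) := by
      rw [← entropy_prodMass hs₁ hs₂, ← entropy_prodMass hs hρ]
      refine entropy_congr_of_injective _ (fun x =>
        ((a₃ / a₂) • x.1.1 + (b₃ / b₁) • x.1.2 + x.2, x.1.1, x.2)) ?_ fun ω => by rw [hZ]
      rintro ⟨⟨x, x'⟩, m⟩ ⟨⟨y, y'⟩, l⟩ h
      simp only [Prod.mk.injEq] at h
      obtain ⟨h3, rfl, rfl⟩ := h
      have h3 := add_left_cancel (add_right_cancel h3)
      have h4 := smul_right_injective G (div_ne_zero hb₃ hb₁) h3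
      simpa using h4
    linarith
  have hSA := entropy_le_log_card hs₁ SA
  have hsum : sumInfo r₁ r₂ μ₃ a₃ b₃ = entropy (prodMass r₁ μ₂) (fun ω => ω.1.1) +
      entropy (prodMass r₂ μ₁) (fun ω => ω.1.1) + entropy q Z -
      entropy q (fun ω => ((ω.1.1.1.1, ω.1.2.1.1), Z ω)) := by
    rw [sumInfo, ← hT, mutualInfo_law, mutualInfo, ← entropy_prodMass hs₁ hs₂,
      ← entropy_prodMass_fst (prodMass (prodMass r₁ μ₂) (prodMass r₂ μ₁)) hρ]
  rw [hsum, signalInfo, signalInfo, mutualInfo, mutualInfo]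
  simp only [entropy_id] at hall hAB hXX
  simp only [SA, SB] at *
  linarith

theorem isMass_uniform [Nonempty A] : IsMass (fun _ : A => 1 / (Fintype.card A : ℝ)) :=
  ⟨fun _ => by positivity, by simp⟩

section Base

variable {r : V × G → ℝ} {μ : G → ℝ} {r' : B → ℝ}

/-- The receiver's own contribution `c (x' ω.2)` is known under the conditioning, so it can be
subtracted; what remains is independent of the receiver's own variables. -/
theorem condMutualInfo_eq_signalInfo (hr : IsMass r) (hμ : IsMass μ) (hr' : IsMass r') (a : F)
    (x' : B → N) (c : N → G) :
    condMutualInfo (prodMass (prodMass r μ) r')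
      (fun ω => a • ω.1.1.2 + ω.1.2 + c (x' ω.2)) (fun ω => ω.1.1.1) (fun ω => x' ω.2) =
      signalInfo r μ a := by
  have hs := hr.prod hμ
  have e1 : entropy (prodMass (prodMass r μ) r')
      (fun ω => (a • ω.1.1.2 + ω.1.2 + c (x' ω.2), x' ω.2)) =
      entropy (prodMass r μ) (fun ω => a • ω.1.2 + ω.2) + entropy r' x' := by
    rw [← entropy_prodMass hs hr']
    refine entropy_congr_of_injective _ (fun y => (y.1 + c y.2, y.2)) ?_ fun _ => rfl
    rintro ⟨y, x⟩ ⟨y', x'⟩ h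
    simp only [Prod.mk.injEq] at h
    obtain ⟨h, rfl⟩ := h
    simpa using h
  have e2 : entropy (prodMass (prodMass r μ) r')
      (fun ω => (a • ω.1.1.2 + ω.1.2 + c (x' ω.2), ω.1.1.1, x' ω.2)) =
      entropy (prodMass r μ) (fun ω => (ω.1.1, a • ω.1.2 + ω.2)) + entropy r' x' := by
    rw [← entropy_prodMass hs hr']
    refine entropy_congr_of_injective _ (fun y => (y.1.2 + c y.2, y.1.1, y.2)) ?_ fun _ => rfl
    rintro ⟨⟨v, y⟩, x⟩ ⟨⟨v', y'⟩, x'⟩ h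
    simp only [Prod.mk.injEq] at h
    obtain ⟨h, rfl, rfl⟩ := h
    simpa using h
  rw [condMutualInfo, e1, e2, entropy_prodMass_snd hs r' x',
    entropy_prodMass hs hr' (fun ω => ω.1.1), signalInfo, mutualInfo]
  ring

/-- The version for Fano's inequality: the receiver's side information is part of the observation
and is independent of the wanted signal. -/
theorem mutualInfo_eq_signalInfo (hr : IsMass r) (hμ : IsMass μ) (hr' : IsMass r') (a : F)
    (c : B → G) :
    mutualInfo (prodMass (prodMass r μ) r') (fun ω => ω.1.1.1)
      (fun ω => (ω.2, a • ω.1.1.2 + ω.1.2 + c ω.2)) = signalInfo r μ a := by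
  have hs := hr.prod hμ
  have e1 : entropy (prodMass (prodMass r μ) r')
      (fun ω => (ω.2, a • ω.1.1.2 + ω.1.2 + c ω.2)) =
      entropy (prodMass r μ) (fun ω => a • ω.1.2 + ω.2) + entropy r' (fun ω => ω) := by
    rw [← entropy_prodMass hs hr']
    refine entropy_congr_of_injective _ (fun y => (y.2, y.1 + c y.2)) ?_ fun _ => rfl
    rintro ⟨y, x⟩ ⟨y', x'⟩ h
    simp only [Prod.mk.injEq] at h
    obtain ⟨rfl, h⟩ := h
    simpa using h
  have e2 : entropy (prodMass (prodMass r μ) r')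
      (fun ω => (ω.1.1.1, ω.2, a • ω.1.1.2 + ω.1.2 + c ω.2)) =
      entropy (prodMass r μ) (fun ω => (ω.1.1, a • ω.1.2 + ω.2)) + entropy r' (fun ω => ω) := by
    rw [← entropy_prodMass hs hr']
    refine entropy_congr_of_injective _ (fun y => (y.1.1, y.2, y.1.2 + c y.2)) ?_ fun _ => rfl
    rintro ⟨⟨v, y⟩, x⟩ ⟨⟨v', y'⟩, x'⟩ h
    simp only [Prod.mk.injEq] at h
    obtain ⟨rfl, rfl, h⟩ := h
    simpa using h
  rw [mutualInfo, e1, e2, entropy_prodMass_fst (prodMass r μ) hr' (fun ω => ω.1.1), signalInfo, mutualInfo]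
  ring

end Base

end AdditiveModel

/-! ### Change of measure, Fano's inequality and independent copies. -/

section Converse

variable {Ω A B C D N : Type*} [Fintype Ω] [Fintype A] [Fintype B] [Fintype C] [Fintype D]
  [Fintype N]

theorem condMutualInfo_law (p : Ω → ℝ) (f : Ω → A) (g : A → B) (h : A → C) (k : A → D) :
    condMutualInfo (law p f) g h k =
      condMutualInfo p (fun ω => g (f ω)) (fun ω => h (f ω)) (fun ω => k (f ω)) := by
  simp only [condMutualInfo, entropy_law]

/-- A change of measure bound: an event that has probability at most `1 / M` under `Q` can only
be likely under `p` if the mean of the log-likelihood ratio `i` is large. -/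
theorem prob_mul_log_sub_one_le {p Q i : Ω → ℝ} (hp : IsMass p) (hQ1 : ∑ ω, Q ω ≤ 1)
    (hQ : ∀ ω, 0 ≤ Q ω)
    (hi : ∀ ω, p ω * Real.exp (-i ω) ≤ Q ω) (E : Ω → Prop) [DecidablePred E] {M : ℝ}
    (hM : 0 < M)
    (hE : ∑ ω, (if E ω then Q ω else 0) ≤ 1 / M) :
    (∑ ω, if E ω then p ω else 0) * Real.log M - 1 ≤ ∑ ω, p ω * i ω := by
  have key : ∀ ω, p ω + (if E ω then p ω else 0) * Real.log M - Q ω -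
      M * (if E ω then Q ω else 0) ≤ p ω * i ω := by
    intro ω
    -- This is 1 + log x ≤ x at x = s e^(-i). It is used with s = M on the event and with s = 1 off
    -- it.
    have gen : ∀ s : ℝ, 0 < s → p ω * (1 + Real.log s) - s * Q ω ≤ p ω * i ω := by
      intro s hs
      have h1 : Real.log s - i ω + 1 ≤ s * Real.exp (-i ω) := by
        have := Real.add_one_le_exp (Real.log s - i ω)
        rwa [sub_eq_add_neg (Real.log s), Real.exp_add, Real.exp_log hs, ← sub_eq_add_neg] at this
      have h2 := mul_le_mul_of_nonneg_left h1 (hp.nonneg ω)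
      have h3 := mul_le_mul_of_nonneg_left (hi ω) hs.le
      nlinarith
    split_ifs with h
    · have := gen M hM
      have := hQ ω
      linarith
    · have := gen 1 one_pos
      rw [Real.log_one] at this
      linarith
  have := Finset.sum_le_sum fun ω (_ : ω ∈ Finset.univ) => key ω
  rw [Finset.sum_sub_distrib, Finset.sum_sub_distrib, Finset.sum_add_distrib, hp.sum_eq_one,
    ← Finset.sum_mul, ← Finset.mul_sum] at this
  have h1 : M * ∑ ω, (if E ω then Q ω else 0) ≤ 1 := by
    have := mul_le_mul_of_nonneg_left hE hM.le
    rwa [mul_one_div_cancel hM.ne'] at this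
  linarith

theorem mutualInfo_eq_sum (p : Ω → ℝ) (f : Ω → A) (g : Ω → B) :
    mutualInfo p f g = ∑ ω, p ω * (Real.log (law p (fun ω => (f ω, g ω)) (f ω, g ω)) -
      Real.log (law p f (f ω)) - Real.log (law p g (g ω))) := by
  rw [mutualInfo, entropy_eq_sum, entropy_eq_sum, entropy_eq_sum]
  simp only [mul_sub, Finset.sum_sub_distrib]
  ring

/-- A form of Fano's inequality. -/
theorem prob_mul_log_card_sub_one_le [Nonempty A] [DecidableEq A] {p : Ω → ℝ} (hp : IsMass p) (f : Ω → A)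
    (g : Ω → B) (hf : ∀ a, law p f a = 1 / (Fintype.card A : ℝ)) (d : B → A) :
    (∑ ω, if d (g ω) = f ω then p ω else 0) * Real.log (Fintype.card A) - 1 ≤
      mutualInfo p f g := by
  have hc : (0 : ℝ) < Fintype.card A := by exact_mod_cast Fintype.card_pos
  set P := law p (fun ω => (f ω, g ω)) with hP
  have hPm : IsMass P := hp.law _
  have h1 : law P Prod.fst = law p f := law_law p _ _
  have h2 : law P Prod.snd = law p g := law_law p _ _
  have h3 : law P (fun x => (x.1, x.2)) = P := law_id P
  -- Under `Q` the observation is independent of the uniform message, so every decoder succeeds with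
  -- probability 1 / |A|; the mean of `i` under `P` is the mutual information.
  have key := prob_mul_log_sub_one_le hPm (Q := fun x => 1 / Fintype.card A * law p g x.2)
    (i := fun x => Real.log (P x) - Real.log (1 / Fintype.card A) - Real.log (law p g x.2))
    ?_ ?_ ?_ (fun x => d x.2 = x.1) hc ?_
  · convert key using 1
    · congr 2
      have := sum_law_mul p (fun ω => (f ω, g ω)) (fun x => if d x.2 = x.1 then 1 else 0)
      simpa using this.symm
    · rw [← mutualInfo_law p (fun ω => (f ω, g ω)) Prod.fst Prod.snd, mutualInfo_eq_sum]
      refine Finset.sum_congr rfl fun x _ => ?_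
      rw [← hP, h1, h2, h3, hf]
  · simp only [Fintype.sum_prod_type, ← Finset.mul_sum, (hp.law g).sum_eq_one]
    simp [hc.ne']
  · exact fun x => mul_nonneg (by positivity) (law_nonneg hp.nonneg _ _)
  · rintro ⟨a, b⟩
    rcases (hPm.nonneg (a, b)).eq_or_lt with h0 | h0
    · simp only [← h0, zero_mul]
      exact mul_nonneg (by positivity) (law_nonneg hp.nonneg _ _)
    · have hb : 0 < law p g b := by
        rw [← h2]
        exact h0.trans_le (le_law hPm.nonneg Prod.snd (a, b))
      have hc' : 0 < 1 / (Fintype.card A : ℝ) := by positivity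
      have : -(Real.log (P (a, b)) - Real.log (1 / Fintype.card A) - Real.log (law p g b)) =
          Real.log (1 / Fintype.card A) + Real.log (law p g b) - Real.log (P (a, b)) := by ring
      simp only [this, Real.exp_sub, Real.exp_add, Real.exp_log h0, Real.exp_log hb,
        Real.exp_log hc', mul_div_cancel₀ _ h0.ne', le_refl]
  · rw [Fintype.sum_prod_type, Finset.sum_comm]
    simp only [Finset.sum_ite_eq, Finset.mem_univ, if_true, ← Finset.mul_sum,
      (hp.law g).sum_eq_one, mul_one, le_refl]

/-- The mass function of a probability mass function. -/
def pmfMass (p : PMF A) : A → ℝ := fun a => (p a).toReal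

theorem isMass_pmfMass (p : PMF A) : IsMass (pmfMass p) := by
  refine ⟨fun _ => ENNReal.toReal_nonneg, ?_⟩
  have h := p.tsum_coe
  rw [tsum_fintype] at h
  simp only [pmfMass]
  rw [← ENNReal.toReal_sum (fun a _ => p.apply_ne_top a), h, ENNReal.toReal_one]

theorem pmfMass_map (p : PMF A) (f : A → B) : pmfMass (p.map f) = law (pmfMass p) f := by
  classical
  ext b
  rw [pmfMass, PMF.map_apply, tsum_fintype, ENNReal.toReal_sum]
  · rw [law_eq_sum_mul]
    refine Finset.sum_congr rfl fun a _ => ?_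
    by_cases h : f a = b
    · simp [h, pmfMass]
    · simp [h, Ne.symm h]
  · intro a _
    split_ifs
    · exact p.apply_ne_top a
    · simp

theorem pmfMass_bind_map (p : PMF A) (q : PMF B) (f : A → B → C) :
    pmfMass (p.bind fun a => q.map (f a)) =
      law (prodMass (pmfMass p) (pmfMass q)) (fun ω => f ω.1 ω.2) := by
  classical
  ext c
  rw [pmfMass, PMF.bind_apply, tsum_fintype, ENNReal.toReal_sum]
  · rw [law_eq_sum_mul, Fintype.sum_prod_type]
    refine Finset.sum_congr rfl fun a _ => ?_
    have := congrFun (pmfMass_map q (f a)) c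
    rw [pmfMass, law_eq_sum_mul] at this
    rw [ENNReal.toReal_mul, this, Finset.mul_sum]
    simp only [prodMass, pmfMass, mul_assoc]
  · exact fun a _ => ENNReal.mul_ne_top (p.apply_ne_top a) (PMF.apply_ne_top _ _)

/-- The mass function of `n` independent copies. -/
def powMass (μ : A → ℝ) (n : ℕ) : (Fin n → A) → ℝ := fun x => ∏ t, μ (x t)

theorem sum_prod_apply {n : ℕ} (g : Fin n → A → ℝ) :
    ∑ x : Fin n → A, ∏ t, g t (x t) = ∏ t, ∑ a, g t a := by
  classical
  rw [Finset.prod_univ_sum, Fintype.piFinset_univ]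

theorem IsMass.pow {μ : A → ℝ} (hμ : IsMass μ) (n : ℕ) : IsMass (powMass μ n) :=
  ⟨fun x => Finset.prod_nonneg fun t _ => hμ.nonneg _, by
    simp only [powMass]
    rw [sum_prod_apply]
    simp [hμ.sum_eq_one]⟩

theorem law_powMass {n : ℕ} (μ : A → ℝ) (f : Fin n → A → B) (y : Fin n → B) :
    law (powMass μ n) (fun x t => f t (x t)) y = ∏ t, law μ (f t) (y t) := by
  classical
  simp only [law_eq_sum_mul]
  rw [← sum_prod_apply]
  refine Finset.sum_congr rfl fun x _ => ?_
  rw [Finset.prod_mul_distrib, Finset.prod_ite_zero]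
  simp [powMass, funext_iff]

theorem sum_powMass_mul {μ : A → ℝ} (hμ : IsMass μ) {n : ℕ} (t : Fin n) (φ : A → ℝ) :
    ∑ x, powMass μ n x * φ (x t) = ∑ a, μ a * φ a := by
  classical
  have : ∀ x : Fin n → A, powMass μ n x * φ (x t) =
      ∏ s, (μ (x s) * if s = t then φ (x s) else 1) := by
    intro x
    rw [Finset.prod_mul_distrib, Finset.prod_ite_eq' Finset.univ t fun s => φ (x s)]
    simp [powMass]
  simp only [this]
  rw [sum_prod_apply (fun s a => μ a * if s = t then φ a else 1),
    Finset.prod_eq_single t]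
  · simp
  · intro s _ hs
    simp [hs, hμ.sum_eq_one]
  · simp

theorem powMass_mul_log (μ : A → ℝ) {n : ℕ} (x : Fin n → A) :
    powMass μ n x * Real.log (powMass μ n x) = powMass μ n x * ∑ t, Real.log (μ (x t)) := by
  by_cases h : powMass μ n x = 0
  · simp [h]
  · rw [powMass, Real.log_prod]
    exact fun t ht => Finset.prod_ne_zero_iff.1 h t ht

theorem sum_negMulLog_powMass {μ : A → ℝ} (hμ : IsMass μ) (n : ℕ) :
    ∑ x, Real.negMulLog (powMass μ n x) = n * ∑ a, Real.negMulLog (μ a) := by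
  simp only [Real.negMulLog, neg_mul, powMass_mul_log, Finset.sum_neg_distrib, Finset.mul_sum]
  rw [Finset.sum_comm]
  simp only [sum_powMass_mul hμ _ fun a => Real.log (μ a)]
  simp [Finset.mul_sum]

variable {F G V V₁ V₂ : Type*} [Field F] [AddCommGroup G] [Module F G] [Fintype G]
  [Fintype V] [Fintype V₁] [Fintype V₂]

/-- The tuple `(V₁, V₂, X₁, X₂, Y₁, Y₂, Z)` as a function of `(V₁, X₁)`, `(V₂, X₂)` and a noise
variable, of which the three noises are functions. -/
def outMap (a₁ b₁ a₂ b₂ a₃ b₃ : F) (k : N → G × G × G) :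
    ((V₁ × G) × (V₂ × G)) × N → V₁ × V₂ × G × G × G × G × G :=
  fun ω => (ω.1.1.1, ω.1.2.1, ω.1.1.2, ω.1.2.2, a₁ • ω.1.1.2 + b₁ • ω.1.2.2 + (k ω.2).1,
    a₂ • ω.1.1.2 + b₂ • ω.1.2.2 + (k ω.2).2.1, a₃ • ω.1.1.2 + b₃ • ω.1.2.2 + (k ω.2).2.2)

variable (a₁ b₁ a₂ b₂ a₃ b₃ : F) (k : N → G × G × G)

/-- Identifies both kinds of joint law with laws of `outMap`: the single-letter one, where `k` is
the identity, and that of a nonadaptive code, where `k` is `unzip₃`. -/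
theorem law_outMap (r₁ : V₁ × G → ℝ) (r₂ : V₂ × G → ℝ) (w : N → ℝ) (v₁ : V₁) (v₂ : V₂)
    (x₁ x₂ y₁ y₂ z : G) :
    law (prodMass (prodMass r₁ r₂) w) (outMap a₁ b₁ a₂ b₂ a₃ b₃ k) (v₁, v₂, x₁, x₂, y₁, y₂, z) =
      r₁ (v₁, x₁) * r₂ (v₂, x₂) * law w (fun n => (a₁ • x₁ + b₁ • x₂ + (k n).1,
        a₂ • x₁ + b₂ • x₂ + (k n).2.1, a₃ • x₁ + b₃ • x₂ + (k n).2.2)) (y₁, y₂, z) := by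
  have h := law_prodMass_skew (prodMass r₁ r₂) w (fun x n =>
    (a₁ • x.1.2 + b₁ • x.2.2 + (k n).1, a₂ • x.1.2 + b₂ • x.2.2 + (k n).2.1,
      a₃ • x.1.2 + b₃ • x.2.2 + (k n).2.2)) ((v₁, x₁), (v₂, x₂)) (y₁, y₂, z)
  simp only [prodMass] at h
  rw [← h]
  exact law_comp_injective (prodMass (prodMass r₁ r₂) w)
    (fun x => (x.1, (a₁ • x.1.1.2 + b₁ • x.1.2.2 + (k x.2).1,
      a₂ • x.1.1.2 + b₂ • x.1.2.2 + (k x.2).2.1, a₃ • x.1.1.2 + b₃ • x.1.2.2 + (k x.2).2.2)))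
    (g := fun y => (y.1.1.1, y.1.2.1, y.1.1.2, y.1.2.2, y.2.1, y.2.2.1, y.2.2.2))
    (fun y y' h => by simpa [Prod.ext_iff, and_assoc, and_left_comm] using h)
    (((v₁, x₁), (v₂, x₂)), (y₁, y₂, z))

variable {r₁ : V₁ × G → ℝ} {r₂ : V₂ × G → ℝ} {w : N → ℝ}

theorem condMutualInfo_outMap_left (hr₁ : IsMass r₁) (hr₂ : IsMass r₂) (hw : IsMass w) :
    condMutualInfo (law (prodMass (prodMass r₁ r₂) w) (outMap a₁ b₁ a₂ b₂ a₃ b₃ k))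
      (fun y => y.2.2.2.2.2.1) (fun y => y.1) (fun y => y.2.2.2.1) =
      signalInfo r₁ (law w fun n => (k n).2.1) a₂ := by
  rw [← condMutualInfo_eq_signalInfo hr₁ (hw.law _) hr₂ a₂ (fun x => x.2) (fun x => b₂ • x),
    ← law_prodMass_left_noise, condMutualInfo_law, condMutualInfo_law]
  congr 1
  ext ω
  simp only [outMap]
  abel

theorem condMutualInfo_outMap_right (hr₁ : IsMass r₁) (hr₂ : IsMass r₂) (hw : IsMass w) :
    condMutualInfo (law (prodMass (prodMass r₁ r₂) w) (outMap a₁ b₁ a₂ b₂ a₃ b₃ k))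
      (fun y => y.2.2.2.2.1) (fun y => y.2.1) (fun y => y.2.2.1) =
      signalInfo r₂ (law w fun n => (k n).1) b₁ := by
  rw [← condMutualInfo_eq_signalInfo hr₂ (hw.law _) hr₁ b₁ (fun x => x.2) (fun x => a₁ • x),
    ← law_prodMass_right_noise, condMutualInfo_law, condMutualInfo_law]
  congr 1
  ext ω
  simp only [outMap]
  abel

theorem mutualInfo_outMap_left (hr₁ : IsMass r₁) (hr₂ : IsMass r₂) (hw : IsMass w) :
    mutualInfo (law (prodMass (prodMass r₁ r₂) w) (outMap a₁ b₁ a₂ b₂ a₃ b₃ k))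
      (fun y => y.1) (fun y => ((y.2.1, y.2.2.2.1), y.2.2.2.2.2.1)) =
      signalInfo r₁ (law w fun n => (k n).2.1) a₂ := by
  rw [← mutualInfo_eq_signalInfo hr₁ (hw.law _) hr₂ a₂ (fun x => b₂ • x.2),
    ← law_prodMass_left_noise, mutualInfo_law, mutualInfo_law]
  congr 1
  ext ω
  · rfl
  · rfl
  · simp only [outMap]
    abel

theorem mutualInfo_outMap_right (hr₁ : IsMass r₁) (hr₂ : IsMass r₂) (hw : IsMass w) :
    mutualInfo (law (prodMass (prodMass r₁ r₂) w) (outMap a₁ b₁ a₂ b₂ a₃ b₃ k))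
      (fun y => y.2.1) (fun y => ((y.1, y.2.2.1), y.2.2.2.2.1)) =
      signalInfo r₂ (law w fun n => (k n).1) b₁ := by
  rw [← mutualInfo_eq_signalInfo hr₂ (hw.law _) hr₁ b₁ (fun x => a₁ • x.2),
    ← law_prodMass_right_noise, mutualInfo_law, mutualInfo_law]
  congr 1
  ext ω
  · rfl
  · rfl
  · simp only [outMap]
    abel

theorem mutualInfo_outMap_sum :
    mutualInfo (law (prodMass (prodMass r₁ r₂) w) (outMap a₁ b₁ a₂ b₂ a₃ b₃ k))
      (fun y => (y.1, y.2.1)) (fun y => y.2.2.2.2.2.2) =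
      sumInfo r₁ r₂ (law w fun n => (k n).2.2) a₃ b₃ := by
  rw [sumInfo, ← law_prodMass_noise, mutualInfo_law, mutualInfo_law]
  rfl

end Converse

/-! ### The single-letter region is contained in the explicit region. -/

section SingleLetterConverse

variable {A B C D : Type*} [Fintype A] [Fintype B] [Fintype C] [Fintype D]

/-- The mass function of `(V, X)` given the mass function of `V` and the conditional laws. -/
def jointMass (q : A → ℝ) (κ : A → PMF B) : A × B → ℝ := fun v => q v.1 * pmfMass (κ v.1) v.2

theorem IsMass.joint {q : A → ℝ} (hq : IsMass q) (κ : A → PMF B) : IsMass (jointMass q κ) := by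
  refine ⟨fun v => mul_nonneg (hq.nonneg _) ENNReal.toReal_nonneg, ?_⟩
  simp only [jointMass, Fintype.sum_prod_type, ← Finset.mul_sum, (isMass_pmfMass _).sum_eq_one,
    mul_one, hq.sum_eq_one]

theorem law_jointMass_fst (q : A → ℝ) (κ : A → PMF B) :
    law (jointMass q κ) Prod.fst = q := by
  classical
  ext a
  rw [law_eq_sum_mul, Fintype.sum_prod_type, Finset.sum_eq_single a]
  · simp only [jointMass, if_true, mul_one, ← Finset.mul_sum, (isMass_pmfMass _).sum_eq_one]
  · intro b _ hb
    simp [hb]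
  · simp

/-- Carries the decomposition of N₃ over to n independent channel uses. -/
theorem powMass_prodMass_law (p : A → ℝ) (q : B → ℝ) (r : C → ℝ) (f : (A × B) × C → D) (n : ℕ) :
    powMass (law (prodMass (prodMass p q) r) f) n =
      law (prodMass (prodMass (powMass p n) (powMass q n)) (powMass r n))
        (fun x t => f ((x.1.1 t, x.1.2 t), x.2 t)) := by
  let e : ((Fin n → A) × (Fin n → B)) × (Fin n → C) ≃ (Fin n → (A × B) × C) :=
    ⟨fun x t => ((x.1.1 t, x.1.2 t), x.2 t),
      fun x => ((fun t => (x t).1.1, fun t => (x t).1.2), fun t => (x t).2),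
      fun _ => rfl, fun _ => rfl⟩
  ext y
  rw [powMass, ← law_powMass, ← law_comp_equiv _ e]
  congr 1
  ext x
  simp only [powMass, prodMass, e, Equiv.coe_fn_mk, Finset.prod_mul_distrib]

variable {F : Type*} [Field F] [Fintype F] (a₁ b₁ a₂ b₂ a₃ b₃ : F) (ν : PMF (F × F × F))

theorem singleLetterMass_additiveChannel {V₁ V₂ : Type} [Fintype V₁] [Fintype V₂]
    (p₁ : PMF V₁) (p₂ : PMF V₂) (κ₁ : V₁ → PMF F) (κ₂ : V₂ → PMF F) :
    singleLetterMass (additiveChannel a₁ b₁ a₂ b₂ a₃ b₃ ν) p₁ p₂ κ₁ κ₂ =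
      law (prodMass (prodMass (jointMass (pmfMass p₁) κ₁) (jointMass (pmfMass p₂) κ₂))
        (pmfMass ν)) (outMap a₁ b₁ a₂ b₂ a₃ b₃ fun n => n) := by
  ext ⟨v₁, v₂, x₁, x₂, y₁, y₂, z⟩
  rw [law_outMap, ← pmfMass_map]
  rfl

theorem pmfMass_noise₁ : pmfMass (noise₁ ν) = law (pmfMass ν) fun n => n.1 := pmfMass_map _ _

theorem pmfMass_noise₂ : pmfMass (noise₂ ν) = law (pmfMass ν) fun n => n.2.1 := pmfMass_map _ _

theorem pmfMass_noise₃ : pmfMass (noise₃ ν) = law (pmfMass ν) fun n => n.2.2 := pmfMass_map _ _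

theorem pmfEntropy_eq (p : PMF A) : pmfEntropy p = ∑ a, Real.negMulLog (pmfMass p a) := rfl

variable {ν} in
theorem NoiseDecomposes.exists_mass {s t : F} (h : NoiseDecomposes s t ν) :
    ∃ ρ : PMF F, pmfMass (noise₃ ν) =
      law (prodMass (prodMass (pmfMass (noise₁ ν)) (pmfMass (noise₂ ν))) (pmfMass ρ))
        (fun n => s * n.1.1 + t * n.1.2 + n.2) := by
  obtain ⟨ρ, h⟩ := h
  refine ⟨ρ, ?_⟩
  have h1 : noise₃ ν = ((noise₁ ν).bind fun n₁ => (noise₂ ν).map fun n₂ => (n₁, n₂)).bind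
      fun n => ρ.map fun n' => s * n.1 + t * n.2 + n' := by
    rw [h, PMF.bind_bind]
    congr 1
    funext n₁
    rw [PMF.bind_map]
    rfl
  rw [h1, pmfMass_bind_map, pmfMass_bind_map (noise₁ ν) (noise₂ ν) Prod.mk]
  congr 2
  exact law_id _

theorem isClosed_jointRegion : IsClosed (jointRegion ν) := by
  simp only [jointRegion, Set.ofPred_and]
  refine (isClosed_le continuous_const continuous_fst).inter
    ((isClosed_le continuous_const continuous_snd).inter
    ((isClosed_le continuous_fst continuous_const).inter
    ((isClosed_le continuous_snd continuous_const).inter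
    (isClosed_le (continuous_fst.add continuous_snd) continuous_const))))

theorem convex_jointRegion : Convex ℝ (jointRegion ν) := by
  rintro ⟨x₁, x₂⟩ ⟨hx1, hx2, hx3, hx4, hx5⟩ ⟨y₁, y₂⟩ ⟨hy1, hy2, hy3, hy4, hy5⟩ a b ha hb hab
  obtain rfl : b = 1 - a := by linarith
  simp only [jointRegion, Set.mem_ofPred_eq, Prod.smul_mk, Prod.mk_add_mk, smul_eq_mul] at *
  refine ⟨by positivity, by positivity, ?_, ?_, ?_⟩ <;> nlinarith

variable {a₁ b₁ a₂ b₂ a₃ b₃} {ν}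

/-- The target is closed and convex, so it suffices to treat one choice of auxiliary variables.
There the bounds are the entropy inequalities with `G = F`, the subtracted terms I(Z; Vᵢ) being
nonnegative. -/
theorem jointInnerRegion_subset (hb₁ : b₁ ≠ 0) (ha₂ : a₂ ≠ 0) (hb₃ : b₃ ≠ 0)
    (hν : NoiseDecomposes (b₃ / b₁) (a₃ / a₂) ν) :
    jointInnerRegion (additiveChannel a₁ b₁ a₂ b₂ a₃ b₃ ν) ⊆ jointRegion ν := by
  refine closure_minimal (convexHull_min ?_ (convex_jointRegion ν)) (isClosed_jointRegion ν)
  simp only [Set.iUnion_subset_iff]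
  intro k₁ k₂ p₁ p₂ κ₁ κ₂ R hR
  obtain ⟨ρ, hρ⟩ := hν.exists_mass
  have hr₁ := (isMass_pmfMass p₁).joint κ₁
  have hr₂ := (isMass_pmfMass p₂).joint κ₂
  have hw := isMass_pmfMass ν
  obtain ⟨h1, h2, h3, h4, h5⟩ := hR
  have hm := singleLetterMass_additiveChannel a₁ b₁ a₂ b₂ a₃ b₃ ν p₁ p₂ κ₁ κ₂
  rw [hm] at h3 h4 h5
  have hp := ((hr₁.prod hr₂).prod hw).law (outMap a₁ b₁ a₂ b₂ a₃ b₃ fun n => n)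
  have e1 := condMutualInfo_outMap_left a₁ b₁ a₂ b₂ a₃ b₃ (fun n => n) hr₁ hr₂ hw
  have e2 := condMutualInfo_outMap_right a₁ b₁ a₂ b₂ a₃ b₃ (fun n => n) hr₁ hr₂ hw
  have e3 := mutualInfo_outMap_sum a₁ b₁ a₂ b₂ a₃ b₃ (fun n => n)
    (r₁ := jointMass (pmfMass p₁) κ₁) (r₂ := jointMass (pmfMass p₂) κ₂) (w := pmfMass ν)
  rw [← pmfMass_noise₂] at e1
  rw [← pmfMass_noise₁] at e2
  rw [← pmfMass_noise₃] at e3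
  have i1 := signalInfo_le hr₁ (isMass_pmfMass (noise₂ ν)) a₂
  have i2 := signalInfo_le hr₂ (isMass_pmfMass (noise₁ ν)) b₁
  have i3 := signalInfo_add_signalInfo_sub_sumInfo_le hr₁ hr₂ (isMass_pmfMass (noise₁ ν))
    (isMass_pmfMass (noise₂ ν)) (isMass_pmfMass ρ) a₃ b₃ ha₂ hb₁ hb₃ hρ
  have j1 := mutualInfo_nonneg hp (fun y => y.2.2.2.2.2.2) (fun y => y.1)
  have j2 := mutualInfo_nonneg hp (fun y => y.2.2.2.2.2.2) (fun y => y.2.1)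
  have h3' := h3.trans_eq (congrArg₂ (· - ·) e1 rfl)
  have h4' := h4.trans_eq (congrArg₂ (· - ·) e2 rfl)
  have h5' := h5.trans_eq (congrArg₂ (· - ·) (congrArg₂ (· + ·) e1 e2) e3)
  refine ⟨h1, h2, ?_, ?_, ?_⟩
  · rw [pmfEntropy_eq]
    exact h3'.trans ((sub_le_self _ j1).trans i1)
  · rw [pmfEntropy_eq]
    exact h4'.trans ((sub_le_self _ j2).trans i2)
  · rw [pmfEntropy_eq, pmfEntropy_eq, pmfEntropy_eq]
    exact h5'.trans i3

end SingleLetterConverse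

/-! ### The converse for nonadaptive codes. -/

section CodeConverse

variable {F : Type*} [Field F] [Fintype F] (a₁ b₁ a₂ b₂ a₃ b₃ : F) (ν : PMF (F × F × F))
  {c : EncoderKind} {d : DecoderKind} {n : ℕ}

/-- The three noise sequences. -/
def unzip₃ (x : Fin n → F × F × F) : (Fin n → F) × (Fin n → F) × (Fin n → F) :=
  (fun t => (x t).1, fun t => (x t).2.1, fun t => (x t).2.2)

theorem unzip₃_injective : Function.Injective (unzip₃ : (Fin n → F × F × F) → _) := by
  intro x y h
  simp only [unzip₃, Prod.mk.injEq, funext_iff] at h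
  exact funext fun t => Prod.ext (h.1 t) (Prod.ext (h.2.1 t) (h.2.2 t))

theorem prod_additiveChannel (x₁ x₂ y₁ y₂ z : Fin n → F) :
    ∏ t, (additiveChannel a₁ b₁ a₂ b₂ a₃ b₃ ν (x₁ t) (x₂ t) (y₁ t, y₂ t, z t)).toReal =
      law (powMass (pmfMass ν) n) (fun m => (a₁ • x₁ + b₁ • x₂ + (unzip₃ m).1,
        a₂ • x₁ + b₂ • x₂ + (unzip₃ m).2.1, a₃ • x₁ + b₃ • x₂ + (unzip₃ m).2.2)) (y₁, y₂, z) := by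
  have h := law_powMass (pmfMass ν) (fun t (m : F × F × F) => (a₁ * x₁ t + b₁ * x₂ t + m.1,
    a₂ * x₁ t + b₂ * x₂ t + m.2.1, a₃ * x₁ t + b₃ * x₂ t + m.2.2)) (fun t => (y₁ t, y₂ t, z t))
  rw [← law_comp_injective _ _ unzip₃_injective] at h
  refine Eq.trans ?_ h.symm
  simp only [← pmfMass_map]
  rfl

/-- The mass function of `(M, X)` for a uniform message `M` and a nonadaptive encoder. -/
def messageMass {X : Type*} [Fintype X] (m : ℕ) (enc : Fin m → PMF X) : Fin m × X → ℝ :=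
  jointMass (fun _ => 1 / (m : ℝ)) enc

theorem isMass_messageMass {X : Type*} [Fintype X] {m : ℕ} (hm : 0 < m) (enc : Fin m → PMF X) :
    IsMass (messageMass m enc) := by
  have : Nonempty (Fin m) := ⟨⟨0, hm⟩⟩
  have h := isMass_uniform (A := Fin m)
  rw [Fintype.card_fin] at h
  exact h.joint enc

/-- Without feedback a whole block is a single use of the additive channel over sequences. This is
what makes the single-letter inequalities apply to codes. -/
theorem mass_nonadaptive (K : Code F F F F .nonadaptive d n) :
    K.mass (additiveChannel a₁ b₁ a₂ b₂ a₃ b₃ ν) =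
      law (prodMass (prodMass (messageMass K.size₁ K.enc₁) (messageMass K.size₂ K.enc₂))
        (powMass (pmfMass ν) n)) (outMap a₁ b₁ a₂ b₂ a₃ b₃ unzip₃) := by
  ext ⟨m₁, m₂, x₁, x₂, y₁, y₂, z⟩
  rw [law_outMap, ← prod_additiveChannel]
  simp only [Code.mass, messageMass, jointMass, Encoder.prob, pmfMass]
  ring

theorem law_powMass_unzip₁ : law (powMass (pmfMass ν) n) (fun m => (unzip₃ m).1) =
    powMass (pmfMass (noise₁ ν)) n := by
  ext y
  rw [pmfMass_noise₁]
  exact law_powMass _ (fun _ (m : F × F × F) => m.1) y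

theorem law_powMass_unzip₂ : law (powMass (pmfMass ν) n) (fun m => (unzip₃ m).2.1) =
    powMass (pmfMass (noise₂ ν)) n := by
  ext y
  rw [pmfMass_noise₂]
  exact law_powMass _ (fun _ (m : F × F × F) => m.2.1) y

theorem law_powMass_unzip₃ : law (powMass (pmfMass ν) n) (fun m => (unzip₃ m).2.2) =
    powMass (pmfMass (noise₃ ν)) n := by
  ext y
  rw [pmfMass_noise₃]
  exact law_powMass _ (fun _ (m : F × F × F) => m.2.2) y

variable {a₁ b₁ a₂ b₂ a₃ b₃} {ν}

theorem one_sub_errorProb_le_left {W : Channel F F F F F} (K : Code F F F F c d n)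
    (hK : IsMass (K.mass W)) : 1 - K.errorProb W ≤ ∑ y : K.Outcome F,
      if K.dec₂.estimate y.2.1 y.2.2.2.1 y.2.2.2.2.2.1 = y.1 then K.mass W y else 0 := by
  rw [← hK.sum_eq_one, Code.errorProb, ← Finset.sum_sub_distrib]
  refine Finset.sum_le_sum fun y _ => ?_
  obtain ⟨m₁, m₂, x₁, x₂, y₁, y₂, z⟩ := y
  have := hK.nonneg (m₁, m₂, x₁, x₂, y₁, y₂, z)
  by_cases h : K.dec₂.estimate m₂ x₂ y₂ = m₁
  · simp only [h, if_true]
    split_ifs <;> linarith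
  · simp [h]

theorem one_sub_errorProb_le_right {W : Channel F F F F F} (K : Code F F F F c d n)
    (hK : IsMass (K.mass W)) : 1 - K.errorProb W ≤ ∑ y : K.Outcome F,
      if K.dec₁.estimate y.1 y.2.2.1 y.2.2.2.2.1 = y.2.1 then K.mass W y else 0 := by
  rw [← hK.sum_eq_one, Code.errorProb, ← Finset.sum_sub_distrib]
  refine Finset.sum_le_sum fun y _ => ?_
  obtain ⟨m₁, m₂, x₁, x₂, y₁, y₂, z⟩ := y
  have := hK.nonneg (m₁, m₂, x₁, x₂, y₁, y₂, z)
  by_cases h : K.dec₁.estimate m₁ x₁ y₁ = m₂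
  · simp only [h, if_true]
    split_ifs <;> linarith
  · simp [h]

theorem Code.log_size₁_nonneg (K : Code F F F F c d n) : 0 ≤ Real.log K.size₁ :=
  Real.log_nonneg (by exact_mod_cast K.size₁_pos)

theorem Code.log_size₂_nonneg (K : Code F F F F c d n) : 0 ≤ Real.log K.size₂ :=
  Real.log_nonneg (by exact_mod_cast K.size₂_pos)

variable (a₁ b₁ a₂ b₂ a₃ b₃) in
theorem isMass_nonadaptive (K : Code F F F F .nonadaptive d n) :
    IsMass (K.mass (additiveChannel a₁ b₁ a₂ b₂ a₃ b₃ ν)) := by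
  rw [mass_nonadaptive]
  exact (((isMass_messageMass K.size₁_pos K.enc₁).prod (isMass_messageMass K.size₂_pos K.enc₂)).prod
    ((isMass_pmfMass ν).pow n)).law _

/-- Fano's inequality with the observation (M₂, X₂, Y₂), which contains all that a decoder of either
type sees. -/
theorem log_size₁_le_signalInfo (K : Code F F F F .nonadaptive d n) :
    (1 - K.errorProb (additiveChannel a₁ b₁ a₂ b₂ a₃ b₃ ν)) * Real.log K.size₁ - 1 ≤
      signalInfo (messageMass K.size₁ K.enc₁) (powMass (pmfMass (noise₂ ν)) n) a₂ := by
  have : Nonempty (Fin K.size₁) := ⟨⟨0, K.size₁_pos⟩⟩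
  have hr₁ := isMass_messageMass K.size₁_pos K.enc₁
  have hr₂ := isMass_messageMass K.size₂_pos K.enc₂
  have hw := (isMass_pmfMass ν).pow n
  have hK := isMass_nonadaptive a₁ b₁ a₂ b₂ a₃ b₃ (ν := ν) K
  have h1 := one_sub_errorProb_le_left K hK
  have h2 := prob_mul_log_card_sub_one_le hK (fun y => y.1)
    (fun y => ((y.2.1, y.2.2.2.1), y.2.2.2.2.2.1)) ?_
    (fun u => K.dec₂.estimate u.1.1 u.1.2 u.2)
  · rw [← law_powMass_unzip₂, ← mutualInfo_outMap_left a₁ b₁ a₂ b₂ a₃ b₃ _ hr₁ hr₂ hw,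
      ← mass_nonadaptive]
    refine le_trans ?_ h2
    rw [Fintype.card_fin]
    exact sub_le_sub_right (mul_le_mul_of_nonneg_right h1 K.log_size₁_nonneg) 1
  · intro m
    rw [mass_nonadaptive, law_law, Fintype.card_fin]
    have e1 := law_prodMass_fst (prodMass (messageMass K.size₁ K.enc₁)
      (messageMass K.size₂ K.enc₂)) hw (fun x => x.1.1)
    have e2 := law_prodMass_fst (messageMass K.size₁ K.enc₁) hr₂ Prod.fst
    simp only [outMap]
    rw [e1, e2]
    exact congrFun (law_jointMass_fst _ _) m

theorem log_size₂_le_signalInfo (K : Code F F F F .nonadaptive d n) :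
    (1 - K.errorProb (additiveChannel a₁ b₁ a₂ b₂ a₃ b₃ ν)) * Real.log K.size₂ - 1 ≤
      signalInfo (messageMass K.size₂ K.enc₂) (powMass (pmfMass (noise₁ ν)) n) b₁ := by
  have : Nonempty (Fin K.size₂) := ⟨⟨0, K.size₂_pos⟩⟩
  have hr₁ := isMass_messageMass K.size₁_pos K.enc₁
  have hr₂ := isMass_messageMass K.size₂_pos K.enc₂
  have hw := (isMass_pmfMass ν).pow n
  have hK := isMass_nonadaptive a₁ b₁ a₂ b₂ a₃ b₃ (ν := ν) K
  have h1 := one_sub_errorProb_le_right K hK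
  have h2 := prob_mul_log_card_sub_one_le hK (fun y => y.2.1)
    (fun y => ((y.1, y.2.2.1), y.2.2.2.2.1)) ?_
    (fun u => K.dec₁.estimate u.1.1 u.1.2 u.2)
  · rw [← law_powMass_unzip₁, ← mutualInfo_outMap_right a₁ b₁ a₂ b₂ a₃ b₃ _ hr₁ hr₂ hw,
      ← mass_nonadaptive]
    refine le_trans ?_ h2
    rw [Fintype.card_fin]
    exact sub_le_sub_right (mul_le_mul_of_nonneg_right h1 K.log_size₂_nonneg) 1
  · intro m
    rw [mass_nonadaptive, law_law, Fintype.card_fin]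
    have e1 := law_prodMass_fst (prodMass (messageMass K.size₁ K.enc₁)
      (messageMass K.size₂ K.enc₂)) hw (fun x => x.2.1)
    have e2 := law_prodMass_snd hr₁ (messageMass K.size₂ K.enc₂) Prod.fst
    simp only [outMap]
    rw [e1, e2]
    exact congrFun (law_jointMass_fst _ _) m

theorem jointLeakage_eq_sumInfo (K : Code F F F F .nonadaptive d n) :
    K.jointLeakage (additiveChannel a₁ b₁ a₂ b₂ a₃ b₃ ν) =
      sumInfo (messageMass K.size₁ K.enc₁) (messageMass K.size₂ K.enc₂)
        (powMass (pmfMass (noise₃ ν)) n) a₃ b₃ := by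
  rw [← law_powMass_unzip₃, ← mutualInfo_outMap_sum a₁ b₁ a₂ b₂ a₃ b₃ unzip₃, ← mass_nonadaptive]
  rfl

theorem log_card_sequences (n : ℕ) :
    Real.log (Fintype.card (Fin n → F)) = n * Real.log (Fintype.card F) := by
  rw [Fintype.card_fun, Fintype.card_fin, Nat.cast_pow, Real.log_pow]

theorem sum_negMulLog_pmf (p : PMF F) :
    ∑ x, Real.negMulLog (powMass (pmfMass p) n x) = n * pmfEntropy p :=
  sum_negMulLog_powMass (isMass_pmfMass p) n

theorem log_size₁_le_nonadaptive (K : Code F F F F .nonadaptive d n) :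
    (1 - K.errorProb (additiveChannel a₁ b₁ a₂ b₂ a₃ b₃ ν)) * Real.log K.size₁ - 1 ≤
      n * (Real.log (Fintype.card F) - pmfEntropy (noise₂ ν)) := by
  refine (log_size₁_le_signalInfo K).trans ((signalInfo_le (isMass_messageMass K.size₁_pos K.enc₁)
    ((isMass_pmfMass _).pow n) a₂).trans_eq ?_)
  rw [log_card_sequences, sum_negMulLog_pmf, mul_sub]

theorem log_size₂_le_nonadaptive (K : Code F F F F .nonadaptive d n) :
    (1 - K.errorProb (additiveChannel a₁ b₁ a₂ b₂ a₃ b₃ ν)) * Real.log K.size₂ - 1 ≤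
      n * (Real.log (Fintype.card F) - pmfEntropy (noise₁ ν)) := by
  refine (log_size₂_le_signalInfo K).trans ((signalInfo_le (isMass_messageMass K.size₂_pos K.enc₂)
    ((isMass_pmfMass _).pow n) b₁).trans_eq ?_)
  rw [log_card_sequences, sum_negMulLog_pmf, mul_sub]

/-- The leakage is exactly I(V₁,V₂;Z) for V the messages, so the entropy inequality over sequences
applies after two uses of Fano's inequality, each of which costs 1. -/
theorem log_size_add_log_size_le_nonadaptive (hb₁ : b₁ ≠ 0) (ha₂ : a₂ ≠ 0) (hb₃ : b₃ ≠ 0)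
    (hν : NoiseDecomposes (b₃ / b₁) (a₃ / a₂) ν) (K : Code F F F F .nonadaptive d n) :
    (1 - K.errorProb (additiveChannel a₁ b₁ a₂ b₂ a₃ b₃ ν)) *
        (Real.log K.size₁ + Real.log K.size₂) -
      (2 + K.jointLeakage (additiveChannel a₁ b₁ a₂ b₂ a₃ b₃ ν)) ≤
      n * (Real.log (Fintype.card F) + pmfEntropy (noise₃ ν) - pmfEntropy (noise₁ ν)
        - pmfEntropy (noise₂ ν)) := by
  obtain ⟨ρ, hρ⟩ := hν.exists_mass
  have h := signalInfo_add_signalInfo_sub_sumInfo_le (isMass_messageMass K.size₁_pos K.enc₁)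
    (isMass_messageMass K.size₂_pos K.enc₂) ((isMass_pmfMass (noise₁ ν)).pow n)
    ((isMass_pmfMass (noise₂ ν)).pow n) ((isMass_pmfMass ρ).pow n) a₃ b₃ ha₂ hb₁ hb₃
    (μ₃ := powMass (pmfMass (noise₃ ν)) n) (by
      rw [hρ, powMass_prodMass_law]
      rfl)
  have h1 := log_size₁_le_signalInfo (a₁ := a₁) (b₁ := b₁) (a₂ := a₂) (b₂ := b₂) (a₃ := a₃)
    (b₃ := b₃) (ν := ν) K
  have h2 := log_size₂_le_signalInfo (a₁ := a₁) (b₁ := b₁) (a₂ := a₂) (b₂ := b₂) (a₃ := a₃)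
    (b₃ := b₃) (ν := ν) K
  rw [log_card_sequences, sum_negMulLog_pmf, sum_negMulLog_pmf, sum_negMulLog_pmf] at h
  rw [jointLeakage_eq_sumInfo]
  linarith

/-- The error `P` is only bounded above by a null sequence, so it is replaced by `ε` before dividing
by n and passing to the limit; l ≥ 0 makes this legitimate. -/
theorem le_of_tendsto_rate {l P ε e : ℕ → ℝ} {R C : ℝ}
    (hR : Tendsto (fun n : ℕ => l n / n) atTop (𝓝 R)) (hl : ∀ n, 0 ≤ l n) (hP : ∀ n, P n ≤ ε n)
    (hε : Tendsto ε atTop (𝓝 0)) (he : Tendsto (fun n : ℕ => e n / n) atTop (𝓝 0))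
    (h : ∀ n : ℕ, (1 - P n) * l n - e n ≤ n * C) : R ≤ C := by
  have h1 : Tendsto (fun n : ℕ => (1 - ε n) * (l n / n) - e n / n) atTop (𝓝 ((1 - 0) * R - 0)) :=
    ((tendsto_const_nhds.sub hε).mul hR).sub he
  rw [sub_zero, sub_zero, one_mul] at h1
  refine le_of_tendsto h1 ?_
  filter_upwards [eventually_gt_atTop 0] with n hn
  have hn' : (0 : ℝ) < n := by exact_mod_cast hn
  have h2 : (1 - ε n) * l n - e n ≤ n * C :=
    (sub_le_sub_right (mul_le_mul_of_nonneg_right (by linarith [hP n]) (hl n)) _).trans (h n)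
  rw [← mul_div_assoc, ← sub_div, div_le_iff₀ hn']
  linarith

theorem SecrecyStrength.tendsto_bound_div (b : SecrecyStrength) {τ : ℕ → ℝ}
    (hτ : Tendsto τ atTop (𝓝 0)) :
    Tendsto (fun n : ℕ => b.bound n (τ n) / n) atTop (𝓝 0) := by
  cases b with
  | strong => exact hτ.div_atTop tendsto_natCast_atTop_atTop
  | weak =>
    refine hτ.congr' ?_
    filter_upwards [eventually_gt_atTop 0] with n hn
    have hn' : (n : ℝ) ≠ 0 := by exact_mod_cast hn.ne'
    simp only [SecrecyStrength.bound]
    rw [mul_div_cancel_left₀ _ hn']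

theorem capacityRegion_nonadaptive_subset (hb₁ : b₁ ≠ 0) (ha₂ : a₂ ≠ 0) (hb₃ : b₃ ≠ 0)
    (hν : NoiseDecomposes (b₃ / b₁) (a₃ / a₂) ν) (b : SecrecyStrength) (d : DecoderKind) :
    capacityRegion (additiveChannel a₁ b₁ a₂ b₂ a₃ b₃ ν) .joint b .nonadaptive d ⊆
      jointRegion ν := by
  rintro ⟨R₁, R₂⟩ ⟨K, ε, τ, h1, h2, hε, hτ, h⟩
  have hc : ∀ x : ℝ, Tendsto (fun n : ℕ => x / (n : ℝ)) atTop (𝓝 0) := fun x =>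
    tendsto_const_nhds.div_atTop tendsto_natCast_atTop_atTop
  refine ⟨ge_of_tendsto' h1 fun n => div_nonneg (K n).log_size₁_nonneg (by positivity),
    ge_of_tendsto' h2 fun n => div_nonneg (K n).log_size₂_nonneg (by positivity), ?_, ?_, ?_⟩
  · exact le_of_tendsto_rate h1 (fun n => (K n).log_size₁_nonneg) (fun n => (h n).1) hε (hc 1)
      fun n => log_size₁_le_nonadaptive (K n)
  · exact le_of_tendsto_rate h2 (fun n => (K n).log_size₂_nonneg) (fun n => (h n).1) hε (hc 1)
      fun n => log_size₂_le_nonadaptive (K n)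
  · have h12 := h1.add h2
    simp only [Code.rate₁, Code.rate₂, ← add_div] at h12
    have he : Tendsto (fun n : ℕ => (2 + b.bound n (τ n)) / n) atTop (𝓝 0) := by
      have := (hc 2).add (b.tendsto_bound_div hτ)
      simpa only [← add_div, add_zero] using this
    refine le_of_tendsto_rate h12 (fun n => add_nonneg (K n).log_size₁_nonneg
      (K n).log_size₂_nonneg) (fun n => (h n).1) hε he fun n => ?_
    have h3 := log_size_add_log_size_le_nonadaptive (a₁ := a₁) (b₂ := b₂) hb₁ ha₂ hb₃ hν (K n)
    have h4 := (h n).2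
    simp only [Code.LeaksAtMost] at h4
    linarith

end CodeConverse

/-- Summing out a causal sequence of kernels. -/
theorem sum_prod_causal {U : Type*} [Fintype U] : ∀ {n : ℕ}
    (g : (t : Fin n) → (Fin (t : ℕ) → U) → U → ℝ) (c : Fin n → ℝ)
    (_ : ∀ t v, ∑ u, g t v u = c t),
    ∑ u : Fin n → U, ∏ t, g t (past t u) (u t) = ∏ t, c t
  | 0, g, c, _ => by simp
  | n + 1, g, c, h => by
    rw [← (Fin.snocEquiv fun _ => U).sum_comp, Fintype.sum_prod_type_right]
    have h1 := sum_prod_causal (fun t : Fin n => g t.castSucc) (fun t => c t.castSucc)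
      (fun t => h t.castSucc)
    rw [Fin.prod_univ_castSucc, ← h1, Finset.sum_mul]
    refine Finset.sum_congr rfl fun u _ => ?_
    rw [← h (Fin.last n) u, Finset.mul_sum]
    refine Finset.sum_congr rfl fun a _ => ?_
    have e1 : ∀ t : Fin n, past t.castSucc (Fin.snocEquiv (fun _ => U) (a, u)) = past t u := by
      intro t
      funext s
      exact Fin.snoc_castSucc (α := fun _ => U) a u (Fin.castLE t.isLt.le s)
    have e2 : past (Fin.last n) (Fin.snocEquiv (fun _ => U) (a, u)) = u := by
      funext s
      exact Fin.snoc_castSucc (α := fun _ => U) a u s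
    rw [Fin.prod_univ_castSucc, e2]
    congr 1
    · refine Finset.prod_congr rfl fun t _ => ?_
      rw [e1 t]
      congr 1
      exact Fin.snoc_castSucc (α := fun _ => U) a u t
    · congr 1
      exact Fin.snoc_last (α := fun _ => U) a u

/-! ### The outer bound for adaptive codes, by a change of measure on the noise. -/

section Adaptive

variable {F : Type*} [Field F] [Fintype F] (a₁ b₁ a₂ b₂ a₃ b₃ : F)

/-- The noise triple that leads from the inputs `x₁`, `x₂` to the outputs `y`. -/
def noiseOf (x₁ x₂ : F) (y : F × F × F) : F × F × F :=
  y - (a₁ * x₁ + b₁ * x₂, a₂ * x₁ + b₂ * x₂, a₃ * x₁ + b₃ * x₂)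

theorem additiveChannel_apply (ν : PMF (F × F × F)) (x₁ x₂ : F) (y : F × F × F) :
    (additiveChannel a₁ b₁ a₂ b₂ a₃ b₃ ν x₁ x₂ y).toReal =
      pmfMass ν (noiseOf a₁ b₁ a₂ b₂ a₃ b₃ x₁ x₂ y) := by
  have h := law_comp_injective (pmfMass ν) (fun n => n)
    (add_right_injective (a₁ * x₁ + b₁ * x₂, a₂ * x₁ + b₂ * x₂, a₃ * x₁ + b₃ * x₂))
    (noiseOf a₁ b₁ a₂ b₂ a₃ b₃ x₁ x₂ y)
  rw [law_id, ← pmfMass_map, noiseOf, add_sub_cancel] at h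
  exact h

variable {M₁ M₂ : Type} {n : ℕ}

/-- For given inputs the outputs of one use correspond bijectively to the noise triple, and the
encoder factors depend on the past only. Summing causally, each use contributes the total weight of
its noise, whatever the encoders do. -/
theorem sum_adaptive (e₁ : Encoder .adaptive M₁ F F n) (e₂ : Encoder .adaptive M₂ F F n)
    (m₁ : M₁) (m₂ : M₂) (h : Fin n → F × F × F → ℝ) :
    ∑ v : (Fin n → F) × (Fin n → F) × (Fin n → F) × (Fin n → F) × (Fin n → F),
      e₁.prob m₁ v.1 v.2.2.1 * e₂.prob m₂ v.2.1 v.2.2.2.1 *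
        ∏ t, h t (noiseOf a₁ b₁ a₂ b₂ a₃ b₃ (v.1 t) (v.2.1 t)
          (v.2.2.1 t, v.2.2.2.1 t, v.2.2.2.2 t)) = ∏ t, ∑ m, h t m := by
  let e : (Fin n → F × F × F × F × F) ≃
      (Fin n → F) × (Fin n → F) × (Fin n → F) × (Fin n → F) × (Fin n → F) :=
    ⟨fun u => (fun t => (u t).1, fun t => (u t).2.1, fun t => (u t).2.2.1,
      fun t => (u t).2.2.2.1, fun t => (u t).2.2.2.2),
      fun v t => (v.1 t, v.2.1 t, v.2.2.1 t, v.2.2.2.1 t, v.2.2.2.2 t), fun _ => rfl, fun _ => rfl⟩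
  rw [← e.sum_comp, ← sum_prod_causal (U := F × F × F × F × F) (fun t p u =>
    (e₁ t m₁ (fun s => (p s).1) (fun s => (p s).2.2.1) u.1).toReal *
    (e₂ t m₂ (fun s => (p s).2.1) (fun s => (p s).2.2.2.1) u.2.1).toReal *
      h t (noiseOf a₁ b₁ a₂ b₂ a₃ b₃ u.1 u.2.1 u.2.2)) (fun t => ∑ m, h t m)]
  · refine Finset.sum_congr rfl fun u _ => ?_
    simp only [Finset.prod_mul_distrib]
    rfl
  · intro t p
    rw [Fintype.sum_prod_type]
    simp only [Fintype.sum_prod_type (α₂ := F × F × F), mul_assoc, ← Finset.mul_sum]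
    have : ∀ x₁ x₂ : F, ∑ y, h t (noiseOf a₁ b₁ a₂ b₂ a₃ b₃ x₁ x₂ y) = ∑ m, h t m :=
      fun x₁ x₂ => (Equiv.subRight _).sum_comp (h t)
    simp only [this, ← Finset.sum_mul]
    have h1 := fun q => (isMass_pmfMass (e₁ t m₁ (fun s => (p s).1) q)).sum_eq_one
    have h2 := fun q => (isMass_pmfMass (e₂ t m₂ (fun s => (p s).2.1) q)).sum_eq_one
    simp only [pmfMass] at h1 h2
    rw [h1, h2, one_mul, one_mul]

/-- Sums out everything that User 2 does not see. The symbol of User 2 fixes N₂ once x₁ is given; as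
the marginal weight of N₂ is constant, x₁ leaves no trace. -/
theorem sum_adaptive_left (e₁ : Encoder .adaptive M₁ F F n) (m₁ : M₁) (x₂ y₂ : Fin n → F)
    (g : F × F × F → ℝ) (c : ℝ) (hg : ∀ n₂, ∑ n₁, ∑ n₃, g (n₁, n₂, n₃) = c) :
    ∑ v : (Fin n → F) × (Fin n → F) × (Fin n → F), e₁.prob m₁ v.1 v.2.1 *
      ∏ t, g (noiseOf a₁ b₁ a₂ b₂ a₃ b₃ (v.1 t) (x₂ t) (v.2.1 t, y₂ t, v.2.2 t)) = c ^ n := by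
  let e : (Fin n → F × F × F) ≃ (Fin n → F) × (Fin n → F) × (Fin n → F) :=
    ⟨fun u => (fun t => (u t).1, fun t => (u t).2.1, fun t => (u t).2.2),
      fun v t => (v.1 t, v.2.1 t, v.2.2 t), fun _ => rfl, fun _ => rfl⟩
  have key := sum_prod_causal (U := F × F × F) (fun (t : Fin n) p u =>
    (e₁ t m₁ (fun s => (p s).1) (fun s => (p s).2.1) u.1).toReal *
      g (noiseOf a₁ b₁ a₂ b₂ a₃ b₃ u.1 (x₂ t) (u.2.1, y₂ t, u.2.2))) (fun _ => c) ?_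
  · rw [← e.sum_comp]
    rw [Finset.prod_const, Finset.card_univ, Fintype.card_fin] at key
    rw [← key]
    refine Finset.sum_congr rfl fun u _ => ?_
    simp only [Finset.prod_mul_distrib]
    rfl
  · intro t p
    simp only [Fintype.sum_prod_type, ← Finset.mul_sum]
    have : ∀ x₁ : F, ∑ y₁, ∑ z, g (noiseOf a₁ b₁ a₂ b₂ a₃ b₃ x₁ (x₂ t) (y₁, y₂ t, z)) = c := by
      intro x₁
      rw [← hg (y₂ t - (a₂ * x₁ + b₂ * x₂ t))]
      exact Fintype.sum_equiv (Equiv.subRight (a₁ * x₁ + b₁ * x₂ t)) _ _ fun y₁ =>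
        Fintype.sum_equiv (Equiv.subRight (a₃ * x₁ + b₃ * x₂ t)) _ _ fun z => rfl
    simp only [this, ← Finset.sum_mul]
    have h1 := fun q => (isMass_pmfMass (e₁ t m₁ (fun s => (p s).1) q)).sum_eq_one
    simp only [pmfMass] at h1
    rw [h1, one_mul]

/-- For fixed received symbols the inputs have total probability 1, so what is counted is the number
of received sequences. -/
theorem sum_encoder_prob (e₂ : Encoder .adaptive M₂ F F n) (m₂ : M₂) :
    ∑ v : (Fin n → F) × (Fin n → F), e₂.prob m₂ v.1 v.2 = (Fintype.card F : ℝ) ^ n := by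
  let e : (Fin n → F × F) ≃ (Fin n → F) × (Fin n → F) :=
    ⟨fun u => (fun t => (u t).1, fun t => (u t).2), fun v t => (v.1 t, v.2 t),
      fun _ => rfl, fun _ => rfl⟩
  have key := sum_prod_causal (U := F × F) (fun (t : Fin n) p u =>
    (e₂ t m₂ (fun s => (p s).1) (fun s => (p s).2) u.1).toReal) (fun _ => Fintype.card F) ?_
  · rw [← e.sum_comp]
    rw [Finset.prod_const, Finset.card_univ, Fintype.card_fin] at key
    rw [← key]
    rfl
  · intro t p
    rw [Fintype.sum_prod_type_right]
    have h1 := fun q => (isMass_pmfMass (e₂ t m₂ (fun s => (p s).1) q)).sum_eq_one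
    simp only [pmfMass] at h1
    simp [h1]

variable {d : DecoderKind}

/-- The joint mass function of a code when the noise triples are weighted by `g`. -/
def Code.noiseMass (K : Code F F F F .adaptive d n) (g : F × F × F → ℝ) (y : K.Outcome F) : ℝ :=
  1 / ((K.size₁ : ℝ) * K.size₂) * (K.enc₁.prob y.1 y.2.2.1 y.2.2.2.2.1 *
    K.enc₂.prob y.2.1 y.2.2.2.1 y.2.2.2.2.2.1 *
      ∏ t, g (noiseOf a₁ b₁ a₂ b₂ a₃ b₃ (y.2.2.1 t) (y.2.2.2.1 t)
        (y.2.2.2.2.1 t, y.2.2.2.2.2.1 t, y.2.2.2.2.2.2 t)))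

theorem Code.mass_eq_noiseMass (K : Code F F F F .adaptive d n) (ν : PMF (F × F × F)) :
    K.mass (additiveChannel a₁ b₁ a₂ b₂ a₃ b₃ ν) =
      K.noiseMass a₁ b₁ a₂ b₂ a₃ b₃ (pmfMass ν) := by
  ext ⟨m₁, m₂, x₁, x₂, y₁, y₂, z⟩
  simp only [Code.mass, Code.noiseMass, additiveChannel_apply]
  ring

theorem Encoder.prob_nonneg (e : Encoder .adaptive M₁ F F n) (m : M₁) (x y : Fin n → F) :
    0 ≤ e.prob m x y :=
  Finset.prod_nonneg fun _ _ => ENNReal.toReal_nonneg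

theorem Code.noiseMass_nonneg (K : Code F F F F .adaptive d n) {g : F × F × F → ℝ}
    (hg : ∀ m, 0 ≤ g m) (y : K.Outcome F) : 0 ≤ K.noiseMass a₁ b₁ a₂ b₂ a₃ b₃ g y :=
  mul_nonneg (by positivity) (mul_nonneg (mul_nonneg (Encoder.prob_nonneg _ _ _ _)
    (Encoder.prob_nonneg _ _ _ _)) (Finset.prod_nonneg fun _ _ => hg _))

theorem Code.sum_inv_sizes (K : Code F F F F .adaptive d n) (c : ℝ) :
    ∑ _m₁ : Fin K.size₁, ∑ _m₂ : Fin K.size₂, 1 / ((K.size₁ : ℝ) * K.size₂) * c = c := by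
  have h1 : (K.size₁ : ℝ) ≠ 0 := by exact_mod_cast K.size₁_pos.ne'
  have h2 : (K.size₂ : ℝ) ≠ 0 := by exact_mod_cast K.size₂_pos.ne'
  simp only [Finset.sum_const, Finset.card_univ, Fintype.card_fin, nsmul_eq_mul]
  field_simp

theorem Code.sum_noiseMass_mul (K : Code F F F F .adaptive d n) {g : F × F × F → ℝ}
    (hg : ∑ m, g m = 1) (t : Fin n) (φ : F × F × F → ℝ) :
    ∑ y : K.Outcome F, K.noiseMass a₁ b₁ a₂ b₂ a₃ b₃ g y *
      φ (noiseOf a₁ b₁ a₂ b₂ a₃ b₃ (y.2.2.1 t) (y.2.2.2.1 t)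
        (y.2.2.2.2.1 t, y.2.2.2.2.2.1 t, y.2.2.2.2.2.2 t)) = ∑ m, g m * φ m := by
  rw [← K.sum_inv_sizes (∑ m, g m * φ m), Fintype.sum_prod_type]
  refine Finset.sum_congr rfl fun m₁ _ => ?_
  rw [Fintype.sum_prod_type]
  refine Finset.sum_congr rfl fun m₂ _ => ?_
  have h := sum_adaptive a₁ b₁ a₂ b₂ a₃ b₃ K.enc₁ K.enc₂ m₁ m₂
    (fun s m => g m * if s = t then φ m else 1)
  rw [Finset.prod_eq_single t] at h
  · simp only [if_true] at h
    rw [← h, Finset.mul_sum]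
    refine Finset.sum_congr rfl fun v _ => ?_
    rw [Finset.prod_mul_distrib, Finset.prod_ite_eq' Finset.univ t fun s =>
      φ (noiseOf a₁ b₁ a₂ b₂ a₃ b₃ (v.1 s) (v.2.1 s) (v.2.2.1 s, v.2.2.2.1 s, v.2.2.2.2 s))]
    simp only [Code.noiseMass, Finset.mem_univ, if_true]
    ring
  · intro s _ hs
    simp [hs, hg]
  · simp

theorem Code.sum_noiseMass (K : Code F F F F .adaptive d n) {g : F × F × F → ℝ}
    (hg : ∑ m, g m = 1) : ∑ y : K.Outcome F, K.noiseMass a₁ b₁ a₂ b₂ a₃ b₃ g y = 1 := by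
  rw [← K.sum_inv_sizes 1, Fintype.sum_prod_type]
  refine Finset.sum_congr rfl fun m₁ _ => ?_
  rw [Fintype.sum_prod_type]
  refine Finset.sum_congr rfl fun m₂ _ => ?_
  have h := sum_adaptive a₁ b₁ a₂ b₂ a₃ b₃ K.enc₁ K.enc₂ m₁ m₂ (fun _ m => g m)
  simp only [hg, Finset.prod_const_one] at h
  simp only [Code.noiseMass]
  rw [← Finset.mul_sum, h]

/-- If the noise of user 2 is uniform under `g` and independent of the other noises, then user 2
can only guess the message of user 1. -/
theorem Code.sum_noiseMass_decoded (K : Code F F F F .adaptive d n) {g : F × F × F → ℝ}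
    (hg : ∀ n₂, ∑ n₁, ∑ n₃, g (n₁, n₂, n₃) = 1 / (Fintype.card F : ℝ)) :
    ∑ y : K.Outcome F, (if K.dec₂.estimate y.2.1 y.2.2.2.1 y.2.2.2.2.2.1 = y.1 then
      K.noiseMass a₁ b₁ a₂ b₂ a₃ b₃ g y else 0) = 1 / K.size₁ := by
  have hq : (Fintype.card F : ℝ) ≠ 0 := by exact_mod_cast Fintype.card_ne_zero
  have h1 : (K.size₁ : ℝ) ≠ 0 := by exact_mod_cast K.size₁_pos.ne'
  have h2 : (K.size₂ : ℝ) ≠ 0 := by exact_mod_cast K.size₂_pos.ne'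
  -- Splits the outcome into what User 2 sees and the rest. For each view only the message that it
  -- decodes to contributes, and the weight does not depend on which message that is.
  let e : K.Outcome F ≃ (Fin K.size₂ × ((Fin n → F) × (Fin n → F))) × Fin K.size₁ ×
      (Fin n → F) × (Fin n → F) × (Fin n → F) :=
    ⟨fun y => ((y.2.1, y.2.2.2.1, y.2.2.2.2.2.1), y.1, y.2.2.1, y.2.2.2.2.1, y.2.2.2.2.2.2),
      fun v => (v.2.1, v.1.1, v.2.2.1, v.1.2.1, v.2.2.2.1, v.1.2.2, v.2.2.2.2),
      fun _ => rfl, fun _ => rfl⟩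
  rw [← e.symm.sum_comp, Fintype.sum_prod_type]
  have inner : ∀ u : Fin K.size₂ × ((Fin n → F) × (Fin n → F)),
      ∑ v : Fin K.size₁ × (Fin n → F) × (Fin n → F) × (Fin n → F),
        (if K.dec₂.estimate (e.symm (u, v)).2.1 (e.symm (u, v)).2.2.2.1
          (e.symm (u, v)).2.2.2.2.2.1 = (e.symm (u, v)).1 then
            K.noiseMass a₁ b₁ a₂ b₂ a₃ b₃ g (e.symm (u, v)) else 0) =
        1 / ((K.size₁ : ℝ) * K.size₂) * (1 / (Fintype.card F : ℝ)) ^ n *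
          K.enc₂.prob u.1 u.2.1 u.2.2 := by
    intro u
    rw [Fintype.sum_prod_type, Finset.sum_eq_single (K.dec₂.estimate u.1 u.2.1 u.2.2)]
    · rw [← sum_adaptive_left a₁ b₁ a₂ b₂ a₃ b₃ K.enc₁ (K.dec₂.estimate u.1 u.2.1 u.2.2) u.2.1
        u.2.2 g _ hg, Finset.mul_sum, Finset.sum_mul]
      refine Finset.sum_congr rfl fun v _ => ?_
      simp only [e, Equiv.coe_fn_symm_mk, if_true, Code.noiseMass]
      ring
    · intro m₁ _ hm
      exact Finset.sum_eq_zero fun v _ => if_neg (Ne.symm hm)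
    · simp
  simp only [inner]
  rw [← Finset.mul_sum, Fintype.sum_prod_type]
  simp only [sum_encoder_prob, Finset.sum_const, Finset.card_univ, Fintype.card_fin, nsmul_eq_mul]
  field_simp
  rw [← mul_pow, one_div_mul_cancel hq, one_pow]

/-- Under the tilted noise law `g` User 2 guesses correctly with probability 1 / `size₁`, and the
likelihood ratio is a product over the uses of q μ(N₂). Its mean logarithm is additive since each
noise triple keeps its law under any adaptive encoding. -/
theorem log_size₁_le_adaptive (ν : PMF (F × F × F)) (K : Code F F F F .adaptive d n) :
    (1 - K.errorProb (additiveChannel a₁ b₁ a₂ b₂ a₃ b₃ ν)) * Real.log K.size₁ - 1 ≤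
      n * (Real.log (Fintype.card F) - pmfEntropy (noise₂ ν)) := by
  classical
  have hq : (0 : ℝ) < Fintype.card F := by exact_mod_cast Fintype.card_pos
  have hν := isMass_pmfMass ν
  have hmass := K.mass_eq_noiseMass a₁ b₁ a₂ b₂ a₃ b₃ ν
  have hK : IsMass (K.mass (additiveChannel a₁ b₁ a₂ b₂ a₃ b₃ ν)) := by
    rw [hmass]
    exact ⟨K.noiseMass_nonneg _ _ _ _ _ _ hν.nonneg, K.sum_noiseMass _ _ _ _ _ _ hν.sum_eq_one⟩
  have h1 := one_sub_errorProb_le_left K hK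
  set μ := pmfMass (noise₂ ν) with hμ
  have hμm : IsMass μ := isMass_pmfMass _
  have hμν : ∀ n₂, ∑ n₁, ∑ n₃, pmfMass ν (n₁, n₂, n₃) = μ n₂ := by
    intro n₂
    rw [hμ, pmfMass_noise₂, law_eq_sum_mul]
    simp only [Fintype.sum_prod_type]
    refine Finset.sum_congr rfl fun n₁ _ => ?_
    rw [Finset.sum_comm]
    simp
  -- N₂ becomes uniform and the other noises keep their conditional law. Where that law is
  -- undefined, 1 / q³ still gives each value of N₂ the weight q² / q³ = 1 / q.
  let g : F × F × F → ℝ := fun m => if μ m.2.1 = 0 then 1 / (Fintype.card F : ℝ) ^ 3 else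
    pmfMass ν m / (Fintype.card F * μ m.2.1)
  have hg0 : ∀ m, 0 ≤ g m := by
    intro m
    simp only [g]
    split_ifs
    · positivity
    · exact div_nonneg (hν.nonneg _) (mul_nonneg hq.le (hμm.nonneg _))
  have hg : ∀ n₂, ∑ n₁, ∑ n₃, g (n₁, n₂, n₃) = 1 / (Fintype.card F : ℝ) := by
    intro n₂
    by_cases h0 : μ n₂ = 0
    · simp only [g, h0, if_true, Finset.sum_const, Finset.card_univ, nsmul_eq_mul]
      field_simp
    · simp only [g, h0, if_false, ← Finset.sum_div, hμν]
      field_simp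
  have hg1 : ∑ m, g m = 1 := by
    rw [Fintype.sum_prod_type]
    simp only [Fintype.sum_prod_type]
    rw [Finset.sum_comm]
    simp only [hg, Finset.sum_const, Finset.card_univ, nsmul_eq_mul]
    field_simp
  let N : K.Outcome F → Fin n → F × F × F := fun y t =>
    noiseOf a₁ b₁ a₂ b₂ a₃ b₃ (y.2.2.1 t) (y.2.2.2.1 t)
      (y.2.2.2.2.1 t, y.2.2.2.2.2.1 t, y.2.2.2.2.2.2 t)
  have key := prob_mul_log_sub_one_le hK (Q := K.noiseMass a₁ b₁ a₂ b₂ a₃ b₃ g)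
    (i := fun y => ∑ t, Real.log (Fintype.card F * μ (N y t).2.1))
    (K.sum_noiseMass _ _ _ _ _ _ hg1).le (K.noiseMass_nonneg _ _ _ _ _ _ hg0) ?_
    (fun y => K.dec₂.estimate y.2.1 y.2.2.2.1 y.2.2.2.2.2.1 = y.1)
    (by exact_mod_cast K.size₁_pos) (K.sum_noiseMass_decoded _ _ _ _ _ _ hg).le
  · refine (sub_le_sub_right (mul_le_mul_of_nonneg_right h1 K.log_size₁_nonneg) 1).trans
      (key.trans_eq ?_)
    rw [hmass]
    simp only [Finset.mul_sum]
    rw [Finset.sum_comm]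
    have e : ∀ t, ∑ y, K.noiseMass a₁ b₁ a₂ b₂ a₃ b₃ (pmfMass ν) y *
        Real.log (Fintype.card F * μ (N y t).2.1) =
        Real.log (Fintype.card F) - pmfEntropy (noise₂ ν) := by
      intro t
      rw [K.sum_noiseMass_mul a₁ b₁ a₂ b₂ a₃ b₃ hν.sum_eq_one t
        fun m => Real.log (Fintype.card F * μ m.2.1)]
      have h2 := sum_law_mul (pmfMass ν) (fun m => m.2.1)
        (fun m => Real.log (Fintype.card F * μ m))
      rw [← h2, ← pmfMass_noise₂, ← hμ, pmfEntropy_eq, ← hμ, eq_sub_iff_add_eq,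
        ← Finset.sum_add_distrib]
      have h3 : ∀ m, μ m * Real.log (Fintype.card F * μ m) + Real.negMulLog (μ m) =
          μ m * Real.log (Fintype.card F) := by
        intro m
        by_cases h0 : μ m = 0
        · simp [h0]
        · rw [Real.log_mul hq.ne' h0, Real.negMulLog]
          ring
      simp only [h3, ← Finset.sum_mul, hμm.sum_eq_one, one_mul]
    simp only [e, Finset.sum_const, Finset.card_univ, Fintype.card_fin, nsmul_eq_mul]
  · intro y
    rw [hmass]
    -- The likelihood ratio is exact on possible noise sequences; on the others the true law
    -- vanishes and only `Q ≥ 0` is needed.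
    by_cases h0 : ∏ t, pmfMass ν (N y t) = 0
    · have : K.noiseMass a₁ b₁ a₂ b₂ a₃ b₃ (pmfMass ν) y = 0 := by
        simp only [Code.noiseMass]
        simp only [N] at h0
        rw [h0, mul_zero, mul_zero]
      rw [this, zero_mul]
      exact K.noiseMass_nonneg _ _ _ _ _ _ hg0 y
    · have hpos : ∀ t, 0 < μ (N y t).2.1 := by
        intro t
        have h3 := Finset.prod_ne_zero_iff.1 h0 t (Finset.mem_univ t)
        have h4 := le_law hν.nonneg (fun m => m.2.1) (N y t)
        rw [← pmfMass_noise₂, ← hμ] at h4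
        exact ((hν.nonneg _).lt_of_ne' h3).trans_le h4
      refine le_of_eq ?_
      have h5 : ∏ t, g (N y t) = (∏ t, pmfMass ν (N y t)) *
          Real.exp (-∑ t, Real.log (Fintype.card F * μ (N y t).2.1)) := by
        rw [← Finset.sum_neg_distrib, Real.exp_sum, ← Finset.prod_mul_distrib]
        refine Finset.prod_congr rfl fun t _ => ?_
        rw [Real.exp_neg, Real.exp_log (mul_pos hq (hpos t)), ← div_eq_mul_inv]
        exact if_neg (hpos t).ne'
      simp only [Code.noiseMass]
      simp only [N] at h5
      rw [h5]
      ring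

/-- The code with the roles of the users exchanged. -/
def Code.swap (K : Code F F F F .adaptive d n) : Code F F F F .adaptive d n where
  size₁ := K.size₂
  size₂ := K.size₁
  size₁_pos := K.size₂_pos
  size₂_pos := K.size₁_pos
  enc₁ := K.enc₂
  enc₂ := K.enc₁
  dec₁ := K.dec₂
  dec₂ := K.dec₁

/-- The noise law with the roles of the users exchanged. -/
def swapNoise (ν : PMF (F × F × F)) : PMF (F × F × F) := ν.map fun m => (m.2.1, m.1, m.2.2)

theorem pmfMass_swapNoise (ν : PMF (F × F × F)) (m : F × F × F) :
    pmfMass (swapNoise ν) (m.2.1, m.1, m.2.2) = pmfMass ν m := by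
  have h := law_comp_injective (pmfMass ν) (fun m => m)
    (g := fun m : F × F × F => (m.2.1, m.1, m.2.2)) (fun x y h => by
      simp only [Prod.mk.injEq] at h
      exact Prod.ext h.2.1 (Prod.ext h.1 h.2.2)) m
  rwa [law_id, ← pmfMass_map] at h

theorem noise₂_swapNoise (ν : PMF (F × F × F)) : noise₂ (swapNoise ν) = noise₁ ν := by
  rw [noise₂, swapNoise, PMF.map_comp]
  rfl

theorem Code.errorProb_swap (K : Code F F F F .adaptive d n) (ν : PMF (F × F × F)) :
    K.swap.errorProb (additiveChannel b₂ a₂ b₁ a₁ b₃ a₃ (swapNoise ν)) =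
      K.errorProb (additiveChannel a₁ b₁ a₂ b₂ a₃ b₃ ν) := by
  let e : K.Outcome F ≃ K.swap.Outcome F :=
    ⟨fun y => (y.2.1, y.1, y.2.2.2.1, y.2.2.1, y.2.2.2.2.2.1, y.2.2.2.2.1, y.2.2.2.2.2.2),
      fun y => (y.2.1, y.1, y.2.2.2.1, y.2.2.1, y.2.2.2.2.2.1, y.2.2.2.2.1, y.2.2.2.2.2.2),
      fun _ => rfl, fun _ => rfl⟩
  rw [Code.errorProb, Code.errorProb, ← e.sum_comp]
  refine Finset.sum_congr rfl fun y _ => ?_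
  obtain ⟨m₁, m₂, x₁, x₂, y₁, y₂, z⟩ := y
  have hm : K.swap.mass (additiveChannel b₂ a₂ b₁ a₁ b₃ a₃ (swapNoise ν))
      (m₂, m₁, x₂, x₁, y₂, y₁, z) =
        K.mass (additiveChannel a₁ b₁ a₂ b₂ a₃ b₃ ν) (m₁, m₂, x₁, x₂, y₁, y₂, z) := by
    rw [Code.mass_eq_noiseMass, Code.mass_eq_noiseMass]
    simp only [Code.noiseMass]
    have : ∀ t, pmfMass (swapNoise ν) (noiseOf b₂ a₂ b₁ a₁ b₃ a₃ (x₂ t) (x₁ t)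
        (y₂ t, y₁ t, z t)) =
        pmfMass ν (noiseOf a₁ b₁ a₂ b₂ a₃ b₃ (x₁ t) (x₂ t) (y₁ t, y₂ t, z t)) := by
      intro t
      rw [← pmfMass_swapNoise ν]
      congr 1
      simp only [noiseOf, Prod.mk_sub_mk, Prod.mk.injEq]
      exact ⟨by ring, by ring, by ring⟩
    simp only [this, Code.swap]
    ring
  simp only [e, Equiv.coe_fn_mk, hm]
  by_cases h1 : K.dec₂.estimate m₂ x₂ y₂ = m₁ <;> by_cases h2 : K.dec₁.estimate m₁ x₁ y₁ = m₂ <;>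
    simp [Code.swap, h1, h2]

theorem log_size₂_le_adaptive (ν : PMF (F × F × F)) (K : Code F F F F .adaptive d n) :
    (1 - K.errorProb (additiveChannel a₁ b₁ a₂ b₂ a₃ b₃ ν)) * Real.log K.size₂ - 1 ≤
      n * (Real.log (Fintype.card F) - pmfEntropy (noise₁ ν)) := by
  rw [← noise₂_swapNoise, ← K.errorProb_swap]
  exact log_size₁_le_adaptive b₂ a₂ b₁ a₁ b₃ a₃ (swapNoise ν) K.swap

theorem capacityRegion_adaptive_subset (ν : PMF (F × F × F)) (a : SecrecyKind)
    (b : SecrecyStrength) (d : DecoderKind) :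
    capacityRegion (additiveChannel a₁ b₁ a₂ b₂ a₃ b₃ ν) a b .adaptive d ⊆ outerRegion ν := by
  rintro ⟨R₁, R₂⟩ ⟨K, ε, τ, h1, h2, hε, hτ, h⟩
  have hc : Tendsto (fun n : ℕ => (1 : ℝ) / (n : ℝ)) atTop (𝓝 0) :=
    tendsto_const_nhds.div_atTop tendsto_natCast_atTop_atTop
  exact ⟨ge_of_tendsto' h1 fun n => div_nonneg (K n).log_size₁_nonneg (by positivity),
    ge_of_tendsto' h2 fun n => div_nonneg (K n).log_size₂_nonneg (by positivity),
    le_of_tendsto_rate h1 (fun n => (K n).log_size₁_nonneg) (fun n => (h n).1) hε hc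
      fun n => log_size₁_le_adaptive a₁ b₁ a₂ b₂ a₃ b₃ ν (K n),
    le_of_tendsto_rate h2 (fun n => (K n).log_size₂_nonneg) (fun n => (h n).1) hε hc
      fun n => log_size₂_le_adaptive a₁ b₁ a₂ b₂ a₃ b₃ ν (K n)⟩

end Adaptive

/-! ### Random coding: Chernoff bounds and uniform codebooks. -/

section RandomCoding

variable {A : Type*} [Fintype A]

/-- The exponential moment equals 1 at s = 0 and has the negative mean as its derivative there, so
it drops below 1 for small s > 0. -/
theorem exists_exp_moment_lt_one {p : A → ℝ} (hp : IsMass p) (l : A → ℝ)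
    (h : ∑ a, p a * l a < 0) :
    ∃ s : ℝ, 0 < s ∧ s ≤ 1 ∧ ∑ a, p a * Real.exp (s * l a) < 1 := by
  have hd : HasDerivAt (fun s : ℝ => ∑ a, p a * Real.exp (s * l a)) (∑ a, p a * l a) 0 := by
    have h1 : ∀ a ∈ (Finset.univ : Finset A), HasDerivAt (fun s : ℝ => p a * Real.exp (s * l a))
        (p a * l a) 0 := by
      intro a _
      have := (((hasDerivAt_id (0 : ℝ)).mul_const (l a)).exp).const_mul (p a)
      simpa using this
    simpa using HasDerivAt.fun_sum h1
  have hs := hd.tendsto_slope.mono_left (nhdsGT_le_nhdsNE (0 : ℝ))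
  have h1 : ∀ᶠ s in 𝓝[>] (0 : ℝ), slope (fun s : ℝ => ∑ a, p a * Real.exp (s * l a)) 0 s < 0 :=
    hs.eventually (eventually_lt_nhds h)
  have h2 : ∀ᶠ s in 𝓝[>] (0 : ℝ), s ∈ Set.Ioc (0 : ℝ) 1 := Ioc_mem_nhdsGT one_pos
  obtain ⟨s, hs1, hs2⟩ := (h1.and h2).exists
  refine ⟨s, hs2.1, hs2.2, ?_⟩
  rw [slope_def_field, sub_zero, div_neg_iff] at hs1
  rcases hs1 with hs1 | hs1
  · linarith [hs1.2, hs2.1]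
  · have := hs1.1
    simp only [zero_mul, Real.exp_zero, mul_one, hp.sum_eq_one] at this
    linarith

theorem sum_powMass_mul_exp (μ : A → ℝ) (l : A → ℝ) (s : ℝ) (n : ℕ) :
    ∑ x, powMass μ n x * Real.exp (s * ∑ t, l (x t)) =
      (∑ a, μ a * Real.exp (s * l a)) ^ n := by
  have : ∀ x : Fin n → A, powMass μ n x * Real.exp (s * ∑ t, l (x t)) =
      ∏ t, (μ (x t) * Real.exp (s * l (x t))) := by
    intro x
    rw [Finset.mul_sum, Real.exp_sum, Finset.prod_mul_distrib, powMass]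
  simp only [this]
  rw [sum_prod_apply (fun _ a => μ a * Real.exp (s * l a))]
  simp

/-- Turns the logarithm in the leakage bound into an exponential moment: s log (1 + x) = log ((1 +
x)^s) ≤ (1 + x)^s - 1 ≤ x^s. -/
theorem log_one_add_le {x s : ℝ} (hx : 0 < x) (hs : 0 < s) (hs1 : s ≤ 1) :
    Real.log (1 + x) ≤ 1 / s * Real.exp (s * Real.log x) := by
  have h1 : (1 + x) ^ s ≤ 1 + x ^ s := by
    simpa using Real.rpow_add_le_add_rpow zero_le_one hx.le hs.le hs1
  have h2 : s * Real.log (1 + x) ≤ x ^ s := by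
    rw [← Real.log_rpow (by linarith)]
    have h3 : 0 < (1 + x) ^ s := Real.rpow_pos_of_pos (by linarith) s
    linarith [Real.log_le_sub_one_of_pos h3]
  rw [mul_comm s (Real.log x), ← Real.rpow_def_of_pos hx, one_div, ← div_eq_inv_mul,
    le_div_iff₀ hs]
  linarith

/-- A surjective homomorphism maps the uniform law to the uniform law. -/
theorem sum_comp_hom_mul_card {T G : Type*} [Fintype T] [AddCommGroup T] [Fintype G]
    [AddCommGroup G] (φ : T →+ G) (hφ : Function.Surjective φ) (f : G → ℝ) :
    (∑ x, f (φ x)) * Fintype.card G = Fintype.card T * ∑ g, f g := by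
  -- By surjectivity a shift by g is a shift of the summation variable in `T`; averaging over all g
  -- then gives the claim.
  have h1 : ∀ g : G, ∑ x, f (φ x + g) = ∑ x, f (φ x) := by
    intro g
    obtain ⟨c, rfl⟩ := hφ g
    simpa using Equiv.sum_comp (Equiv.addRight c) fun x => f (φ x)
  have h2 : ∑ g : G, ∑ x, f (φ x + g) = ∑ x : T, ∑ g, f g := by
    rw [Finset.sum_comm]
    exact Finset.sum_congr rfl fun x _ => Equiv.sum_comp (Equiv.addLeft (φ x)) f
  simp only [h1, Finset.sum_const, Finset.card_univ, nsmul_eq_mul] at h2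
  linarith

variable {F G I J : Type*} [Field F] [AddCommGroup G] [Module F G] [Fintype G] [Fintype I]
  [Fintype J]

/-! ### Average error probability of threshold decoding. -/

section Decoding

variable [Nonempty I] [DecidableEq I]

open Classical in
/-- The threshold decoder of a codebook: it looks for a codeword for which the resulting noise is
not too unlikely. -/
def thresholdDecoder (a : F) (w : G → ℝ) (θ : ℝ) (C : I → G) (y : G) : I :=
  if h : ∃ i, θ ≤ w (y - a • C i) then h.choose else Classical.arbitrary I

/-- The probability that the threshold decoder errs. -/
def decodingError (a : F) (w : G → ℝ) (θ : ℝ) (C : I → G) : ℝ :=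
  1 / Fintype.card I * ∑ i, ∑ m, w m *
    if thresholdDecoder a w θ C (a • C i + m) = i then 0 else 1

/-- An error requires that the true noise fails the threshold or that some wrong codeword passes it;
the union bound counts the latter. -/
theorem thresholdDecoder_error_le (a : F) (w : G → ℝ) (θ : ℝ) (C : I → G) (i : I) (m : G) :
    (if thresholdDecoder a w θ C (a • C i + m) = i then (0 : ℝ) else 1) ≤
      (if w m < θ then 1 else 0) +
        ∑ j, if j ≠ i ∧ θ ≤ w (a • (C i - C j) + m) then (1 : ℝ) else 0 := by
  have hnn : ∀ j, (0 : ℝ) ≤ if j ≠ i ∧ θ ≤ w (a • (C i - C j) + m) then (1 : ℝ) else 0 :=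
    fun j => by split_ifs <;> simp
  have hn := Finset.sum_nonneg fun j (_ : j ∈ (Finset.univ : Finset I)) => hnn j
  by_cases hd : thresholdDecoder a w θ C (a • C i + m) = i
  · rw [if_pos hd]
    refine add_nonneg ?_ hn
    split_ifs <;> simp
  · rw [if_neg hd]
    by_cases hm : w m < θ
    · rw [if_pos hm]
      linarith
    · rw [if_neg hm, zero_add]
      have hex : ∃ j, θ ≤ w (a • C i + m - a • C j) := ⟨i, by simpa using hm⟩
      have hj := hex.choose_spec
      have hdj : thresholdDecoder a w θ C (a • C i + m) = hex.choose := dif_pos hex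
      rw [hdj] at hd
      refine le_trans (le_of_eq ?_) (Finset.single_le_sum (fun j _ => hnn j)
        (Finset.mem_univ hex.choose))
      have he : a • C i + m - a • C hex.choose = a • (C i - C hex.choose) + m := by
        rw [smul_sub]
        abel
      rw [he] at hj
      rw [if_pos ⟨hd, hj⟩]

/-- The scaled difference is a homomorphism on codebooks. It is surjective, as a codebook with a
single nonzero word shows, so it is uniform for a uniform codebook. -/
theorem sum_codebooks_difference [DecidableEq G] {a : F} (ha : a ≠ 0) {i j : I} (hij : j ≠ i)
    (f : G → ℝ) : (∑ C : I → G, f (a • (C i - C j))) * Fintype.card G =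
      Fintype.card (I → G) * ∑ g, f g := by
  let φ : (I → G) →+ G :=
    { toFun := fun C => a • (C i - C j)
      map_zero' := by simp
      map_add' := fun C D => by
        rw [← smul_add]
        congr 1
        simp only [Pi.add_apply]
        abel }
  refine sum_comp_hom_mul_card φ (fun g => ⟨Pi.single i (a⁻¹ • g), ?_⟩) f
  change a • ((Pi.single i (a⁻¹ • g) : I → G) i - (Pi.single i (a⁻¹ • g) : I → G) j) = g
  rw [Pi.single_eq_same, Pi.single_eq_of_ne hij, sub_zero, smul_inv_smul₀ ha]

/-- Markov's inequality for the counting measure. -/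
theorem sum_indicator_le {w : G → ℝ} (hw : IsMass w) {θ : ℝ} (hθ : 0 < θ) (m : G) :
    ∑ g, (if θ ≤ w (g + m) then (1 : ℝ) else 0) ≤ 1 / θ := by
  have h1 : ∑ g, (if θ ≤ w (g + m) then (1 : ℝ) else 0) ≤ ∑ g, w (g + m) / θ := by
    refine Finset.sum_le_sum fun g _ => ?_
    split_ifs with h
    · rwa [le_div_iff₀ hθ, one_mul]
    · exact div_nonneg (hw.nonneg _) hθ.le
  refine h1.trans_eq ?_
  rw [← Finset.sum_div]
  congr 1
  rw [← hw.sum_eq_one]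
  exact Equiv.sum_comp (Equiv.addRight m) w

/-- The average over all codebooks of the error probability of the threshold decoder. -/
theorem sum_decodingError_le [DecidableEq G] {a : F} (ha : a ≠ 0) {w : G → ℝ} (hw : IsMass w)
    {θ : ℝ} (hθ : 0 < θ) : ∑ C : I → G, decodingError a w θ C ≤ (Fintype.card (I → G) : ℝ) *
      ((∑ m, w m * if w m < θ then 1 else 0) + Fintype.card I / (θ * Fintype.card G)) := by
  have hG : (0 : ℝ) < Fintype.card G := by exact_mod_cast Fintype.card_pos
  have hI : (0 : ℝ) < Fintype.card I := by exact_mod_cast Fintype.card_pos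
  set T : ℝ := ((Fintype.card (I → G) : ℕ) : ℝ) with hT
  have hT0 : 0 ≤ T := by positivity
  have hpair : ∀ (i : I) (m : G) (j : I),
      ∑ C : I → G, (if j ≠ i ∧ θ ≤ w (a • (C i - C j) + m) then (1 : ℝ) else 0) ≤
        T * (1 / (θ * Fintype.card G)) := by
    intro i m j
    by_cases hij : j ≠ i
    · simp only [ne_eq, hij, not_false_eq_true, true_and]
      have h1 := sum_codebooks_difference ha hij (fun g => if θ ≤ w (g + m) then (1 : ℝ) else 0)
      have h2 := mul_le_mul_of_nonneg_left (sum_indicator_le hw hθ m) hT0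
      rw [← h1, ← le_div_iff₀ hG] at h2
      refine h2.trans_eq ?_
      field_simp
    · simp only [hij, false_and, if_false, Finset.sum_const_zero]
      positivity
  have hone : ∀ (i : I) (m : G), ∑ C : I → G,
      (if thresholdDecoder a w θ C (a • C i + m) = i then (0 : ℝ) else 1) ≤
        T * ((if w m < θ then 1 else 0) + Fintype.card I / (θ * Fintype.card G)) := by
    intro i m
    refine (Finset.sum_le_sum fun C _ => thresholdDecoder_error_le a w θ C i m).trans ?_
    rw [Finset.sum_add_distrib, mul_add, Finset.sum_comm]
    refine add_le_add (le_of_eq ?_) ?_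
    · rw [Finset.sum_const, Finset.card_univ, nsmul_eq_mul]
    · refine (Finset.sum_le_sum fun j _ => hpair i m j).trans_eq ?_
      rw [Finset.sum_const, Finset.card_univ, nsmul_eq_mul]
      ring
  simp only [decodingError]
  rw [← Finset.mul_sum, Finset.sum_comm]
  have h1 : ∀ i : I, ∑ C : I → G, ∑ m, w m *
      (if thresholdDecoder a w θ C (a • C i + m) = i then (0 : ℝ) else 1) ≤
      T * ((∑ m, w m * if w m < θ then 1 else 0) + Fintype.card I / (θ * Fintype.card G)) := by
    intro i
    rw [Finset.sum_comm]
    have h2 : ∀ m, ∑ C : I → G, w m *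
        (if thresholdDecoder a w θ C (a • C i + m) = i then (0 : ℝ) else 1) ≤
        T * (w m * (if w m < θ then 1 else 0)) +
          w m * (T * (Fintype.card I / (θ * Fintype.card G))) := by
      intro m
      rw [← Finset.mul_sum]
      refine (mul_le_mul_of_nonneg_left (hone i m) (hw.nonneg m)).trans_eq ?_
      ring
    refine (Finset.sum_le_sum fun m _ => h2 m).trans_eq ?_
    rw [Finset.sum_add_distrib, ← Finset.mul_sum, ← Finset.sum_mul, hw.sum_eq_one]
    ring
  refine (mul_le_mul_of_nonneg_left (Finset.sum_le_sum fun i _ => h1 i) (by positivity)).trans_eq ?_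
  rw [Finset.sum_const, Finset.card_univ, nsmul_eq_mul, ← mul_assoc,
    one_div_mul_cancel hI.ne', one_mul]

end Decoding

/-! ### Resolvability: the output of randomly chosen words is nearly uniform. -/

section Resolvability

/-- The mass function of the output when a uniformly chosen one of the words `S i` is sent over
the additive channel with noise mass function `w`. -/
def mixtureMass (w : G → ℝ) (S : I → G) (z : G) : ℝ :=
  1 / Fintype.card I * ∑ i, w (z - S i)

theorem isMass_mixtureMass [Nonempty I] {w : G → ℝ} (hw : IsMass w) (S : I → G) :
    IsMass (mixtureMass w S) := by
  refine ⟨fun z => mul_nonneg (by positivity) (Finset.sum_nonneg fun i _ => hw.nonneg _), ?_⟩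
  simp only [mixtureMass]
  rw [← Finset.mul_sum, Finset.sum_comm]
  have : ∀ i, ∑ z, w (z - S i) = 1 := fun i => by
    rw [← hw.sum_eq_one]
    exact (Equiv.subRight (S i)).sum_comp w
  simp [this]

/-- The relative entropy of the output with respect to the uniform law. -/
theorem log_card_sub_entropy_mixture_le [Nonempty I] {w : G → ℝ} (hw : IsMass w) (S : I → G)
    (t : G → ℝ) (ht : ∀ m, 0 < t m) :
    Real.log (Fintype.card G) - ∑ z, Real.negMulLog (mixtureMass w S z) ≤
      1 / Fintype.card I * ∑ i, ∑ m, w m *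
        (Real.log (t m) - 1 + Fintype.card G / t m * mixtureMass w S (m + S i)) := by
  have hG : (0 : ℝ) < Fintype.card G := by
    have : Nonempty G := ⟨0⟩
    exact_mod_cast Fintype.card_pos
  have hI : (0 : ℝ) < Fintype.card I := by exact_mod_cast Fintype.card_pos
  have hP := isMass_mixtureMass hw S
  have e1 : Real.log (Fintype.card G) - ∑ z, Real.negMulLog (mixtureMass w S z) =
      ∑ z, mixtureMass w S z * (Real.log (Fintype.card G) + Real.log (mixtureMass w S z)) := by
    simp only [mul_add, Finset.sum_add_distrib, ← Finset.sum_mul, hP.sum_eq_one, one_mul,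
      Real.negMulLog, neg_mul, Finset.sum_neg_distrib, sub_neg_eq_add]
  have e2 : ∀ f : G → ℝ, ∑ z, mixtureMass w S z * f z =
      1 / Fintype.card I * ∑ i, ∑ m, w m * f (m + S i) := by
    intro f
    have h1 : ∀ i, ∑ m, w m * f (m + S i) = ∑ z, w (z - S i) * f z := by
      intro i
      rw [← (Equiv.subRight (S i)).sum_comp]
      simp
    simp only [h1]
    rw [Finset.sum_comm, Finset.mul_sum]
    refine Finset.sum_congr rfl fun z _ => ?_
    rw [mixtureMass, ← Finset.sum_mul, mul_assoc]
  rw [e1, e2]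
  refine mul_le_mul_of_nonneg_left (Finset.sum_le_sum fun i _ => Finset.sum_le_sum fun m _ => ?_)
    (by positivity)
  rcases (hw.nonneg m).eq_or_lt with h0 | h0
  · simp [← h0]
  · refine mul_le_mul_of_nonneg_left ?_ h0.le
    have hpos : 0 < mixtureMass w S (m + S i) := by
      refine mul_pos (by positivity) ?_
      refine lt_of_lt_of_le ?_ (Finset.single_le_sum (fun j _ => hw.nonneg _) (Finset.mem_univ i))
      simpa using h0
    -- The tangent to the logarithm at `t m` makes the bound affine in the mixture, so that
    -- averaging over codebooks acts as Jensen's inequality.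
    have := Real.log_le_sub_one_of_pos (div_pos (mul_pos hG hpos) (ht m))
    rw [Real.log_div (mul_pos hG hpos).ne' (ht m).ne', Real.log_mul hG.ne' hpos.ne'] at this
    have e3 : Fintype.card G / t m * mixtureMass w S (m + S i) =
      Fintype.card G * mixtureMass w S (m + S i) / t m := by ring
    rw [e3]
    linarith

/-- If the differences of the random words are uniform, the output is on average close to
uniform. -/
theorem sum_log_card_sub_entropy_mixture_le {T : Type*} [Fintype T] [Nonempty I] {w : G → ℝ}
    (hw : IsMass w) (S : T → I → G) (hS : ∀ i j, j ≠ i → ∀ f : G → ℝ,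
      (∑ x, f (S x i - S x j)) * Fintype.card G = Fintype.card T * ∑ g, f g) :
    ∑ x, (Real.log (Fintype.card G) - ∑ z, Real.negMulLog (mixtureMass w (S x) z)) ≤
      Fintype.card T * ∑ m, w m * Real.log (1 + Fintype.card G * w m / Fintype.card I) := by
  classical
  have hG : (0 : ℝ) < Fintype.card G := by
    have : Nonempty G := ⟨0⟩
    exact_mod_cast Fintype.card_pos
  have hI : (0 : ℝ) < Fintype.card I := by exact_mod_cast Fintype.card_pos
  set t : G → ℝ := fun m => 1 + Fintype.card G * w m / Fintype.card I with ht
  have ht0 : ∀ m, 0 < t m := fun m => by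
    have := hw.nonneg m
    positivity
  refine (Finset.sum_le_sum fun x _ => log_card_sub_entropy_mixture_le hw (S x) t ht0).trans ?_
  have hmix : ∀ (i : I) (m : G),
      ∑ x, mixtureMass w (S x) (m + S x i) ≤ Fintype.card T * (t m / Fintype.card G) := by
    intro i m
    simp only [mixtureMass]
    rw [← Finset.mul_sum, Finset.sum_comm, ← Finset.add_sum_erase _ _ (Finset.mem_univ i)]
    have h1 : ∑ x : T, w (m + S x i - S x i) = Fintype.card T * w m := by simp
    have h2 : ∀ j ∈ Finset.univ.erase i, ∑ x, w (m + S x i - S x j) =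
        Fintype.card T / Fintype.card G := by
      intro j hj
      have h3 := hS i j (Finset.ne_of_mem_erase hj) (fun g => w (m + g))
      have h4 : ∑ g, w (m + g) = 1 := by
        rw [← hw.sum_eq_one]
        exact Equiv.sum_comp (Equiv.addLeft m) w
      rw [h4, mul_one, ← eq_div_iff hG.ne'] at h3
      rw [← h3]
      simp only [add_sub_assoc]
    rw [h1, Finset.sum_congr rfl h2, Finset.sum_const, nsmul_eq_mul]
    have h5 : ((Finset.univ.erase i).card : ℝ) ≤ Fintype.card I := by
      exact_mod_cast (Finset.card_le_univ _)
    have h6 : ((Finset.univ.erase i).card : ℝ) * (Fintype.card T / Fintype.card G) ≤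
        Fintype.card I * (Fintype.card T / Fintype.card G) :=
      mul_le_mul_of_nonneg_right h5 (by positivity)
    refine (mul_le_mul_of_nonneg_left (add_le_add_right h6 _) (by positivity)).trans_eq ?_
    simp only [ht]
    field_simp
    ring
  rw [← Finset.mul_sum, Finset.sum_comm]
  have hi : ∀ i : I, ∑ x, ∑ m, w m *
      (Real.log (t m) - 1 + Fintype.card G / t m * mixtureMass w (S x) (m + S x i)) ≤
      Fintype.card T * ∑ m, w m * Real.log (t m) := by
    intro i
    rw [Finset.sum_comm, Finset.mul_sum]
    refine Finset.sum_le_sum fun m _ => ?_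
    rw [← Finset.mul_sum, Finset.sum_add_distrib, ← Finset.mul_sum, Finset.sum_const,
      Finset.card_univ, nsmul_eq_mul]
    have h1 := mul_le_mul_of_nonneg_left (hmix i m) (div_pos hG (ht0 m)).le
    have h2 : Fintype.card G / t m * (Fintype.card T * (t m / Fintype.card G)) =
        Fintype.card T := by
      have := (ht0 m).ne'
      field_simp
    rw [h2] at h1
    have h3 := mul_le_mul_of_nonneg_left h1 (hw.nonneg m)
    linarith
  refine (mul_le_mul_of_nonneg_left (Finset.sum_le_sum fun i _ => hi i) (by positivity)).trans_eq ?_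
  rw [Finset.sum_const, Finset.card_univ, nsmul_eq_mul, ← mul_assoc,
    one_div_mul_cancel hI.ne', one_mul]

end Resolvability

end RandomCoding

/-! ### From codebooks to codes: error probability and leakage of a random code. -/

section CodeConstruction

variable {A B N G : Type*} [Fintype A] [Fintype B] [Fintype N] [Fintype G]

/-- The uniform mass function. -/
def uniformMass (A : Type*) [Fintype A] : A → ℝ := fun _ => 1 / (Fintype.card A : ℝ)

theorem isMass_uniformMass [Nonempty A] : IsMass (uniformMass A) := isMass_uniform

theorem prodMass_uniformMass : prodMass (uniformMass A) (uniformMass B) = uniformMass (A × B) := by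
  ext x
  simp only [prodMass, uniformMass, Fintype.card_prod, Nat.cast_mul]
  rw [div_mul_div_comm, one_mul]

theorem pmfMass_uniform [Nonempty A] : pmfMass (PMF.uniformOfFintype A) = uniformMass A := by
  ext x
  simp [pmfMass, uniformMass]

theorem sum_left_noise [Nonempty B] (p : A → ℝ) (w : N → ℝ) (k : N → G) (ψ : A → G → ℝ) :
    ∑ ω, prodMass (prodMass p (uniformMass B)) w ω * ψ ω.1.1 (k ω.2) =
      ∑ a, p a * ∑ g, law w k g * ψ a g := by
  rw [← sum_law_mul (prodMass (prodMass p (uniformMass B)) w)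
    (fun ω => ((ω.1.1, k ω.2), ω.1.2)) (fun x => ψ x.1.1 x.1.2), law_prodMass_left_noise,
    Fintype.sum_prod_type]
  simp only [prodMass, mul_right_comm _ (uniformMass B _)]
  simp only [← Finset.mul_sum, isMass_uniformMass.sum_eq_one, mul_one]
  rw [Fintype.sum_prod_type]
  simp only [Finset.mul_sum, mul_assoc]

theorem sum_right_noise [Nonempty A] (q : B → ℝ) (w : N → ℝ) (k : N → G) (ψ : B → G → ℝ) :
    ∑ ω, prodMass (prodMass (uniformMass A) q) w ω * ψ ω.1.2 (k ω.2) =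
      ∑ b, q b * ∑ g, law w k g * ψ b g := by
  rw [← sum_left_noise (B := A),
    ← Equiv.sum_comp (Equiv.prodCongr (Equiv.prodComm A B) (Equiv.refl N))]
  refine Finset.sum_congr rfl fun ω _ => ?_
  simp only [prodMass, Equiv.prodCongr_apply, Equiv.prodComm_apply, Prod.map, Prod.fst_swap,
    Prod.snd_swap, Equiv.refl_apply]
  ring

variable {F : Type*} [Field F] [Fintype F] {n m₁ m₂ k₁ k₂ m k : ℕ}

/-- The encoder that sends a randomly chosen one of the codewords of the message. -/
def bookEncoder [NeZero k] (C : Fin m × Fin k → Fin n → F) : Fin m → PMF (Fin n → F) :=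
  fun i => (PMF.uniformOfFintype (Fin k)).map fun j => C (i, j)

theorem messageMass_bookEncoder [NeZero k] (C : Fin m × Fin k → Fin n → F) :
    messageMass m (bookEncoder C) =
      law (uniformMass (Fin m × Fin k)) (fun i => (i.1, C i)) := by
  ext ⟨i, x⟩
  rw [← prodMass_uniformMass, law_prodMass_skew (uniformMass (Fin m)) (uniformMass (Fin k))
    (fun i j => C (i, j)) i x, ← pmfMass_uniform (A := Fin k), ← pmfMass_map]
  simp [messageMass, jointMass, uniformMass, bookEncoder]

/-- A decoder which does not use the own message. -/
def ownMessageFree {M M' : Type} {X Y : Type u} (d : DecoderKind)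
    (ψ : (Fin n → X) → (Fin n → Y) → M') : Decoder d M M' X Y n :=
  match d with
  | .first => fun _ x y => ψ x y
  | .second => ψ

theorem estimate_ownMessageFree {M M' : Type} {X Y : Type u} (d : DecoderKind)
    (ψ : (Fin n → X) → (Fin n → Y) → M') (i : M) (x : Fin n → X) (y : Fin n → Y) :
    (ownMessageFree d ψ : Decoder d M M' X Y n).estimate i x y = ψ x y := by
  cases d <;> rfl

variable (a₁ b₁ a₂ b₂ a₃ b₃ : F) (ν : PMF (F × F × F))
variable [NeZero m₁] [NeZero k₁] [NeZero m₂] [NeZero k₂]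

/-- The code with the codebooks `C₁`, `C₂` and threshold decoders. -/
def bookCode (d : DecoderKind) (θ₁ θ₂ : ℝ) (C₁ : Fin m₁ × Fin k₁ → Fin n → F)
    (C₂ : Fin m₂ × Fin k₂ → Fin n → F) : Code F F F F .nonadaptive d n where
  size₁ := m₁
  size₂ := m₂
  size₁_pos := Nat.pos_of_ne_zero (NeZero.ne m₁)
  size₂_pos := Nat.pos_of_ne_zero (NeZero.ne m₂)
  enc₁ := bookEncoder C₁
  enc₂ := bookEncoder C₂
  dec₁ := ownMessageFree d fun x y =>
    (thresholdDecoder b₁ (powMass (pmfMass (noise₁ ν)) n) θ₁ C₂ (y - a₁ • x)).1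
  dec₂ := ownMessageFree d fun x y =>
    (thresholdDecoder a₂ (powMass (pmfMass (noise₂ ν)) n) θ₂ C₁ (y - b₂ • x)).1

variable {a₁ b₁ a₂ b₂ a₃ b₃} {ν}

/-- Replaces the randomized encoders by uniform pairs (message, codeword index), on which all
outcomes are functions together with the noise. -/
theorem mass_bookCode (d : DecoderKind) (θ₁ θ₂ : ℝ) (C₁ : Fin m₁ × Fin k₁ → Fin n → F)
    (C₂ : Fin m₂ × Fin k₂ → Fin n → F) :
    (bookCode a₁ b₁ a₂ b₂ ν d θ₁ θ₂ C₁ C₂).mass (additiveChannel a₁ b₁ a₂ b₂ a₃ b₃ ν) =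
      law (prodMass (prodMass (uniformMass (Fin m₁ × Fin k₁)) (uniformMass (Fin m₂ × Fin k₂)))
        (powMass (pmfMass ν) n))
        (fun ω => outMap a₁ b₁ a₂ b₂ a₃ b₃ unzip₃
          (((ω.1.1.1, C₁ ω.1.1), (ω.1.2.1, C₂ ω.1.2)), ω.2)) := by
  rw [mass_nonadaptive]
  have h1 := law_prodMass (prodMass (uniformMass (Fin m₁ × Fin k₁)) (uniformMass (Fin m₂ × Fin k₂)))
    (powMass (pmfMass ν) n) (fun x => ((x.1.1, C₁ x.1), (x.2.1, C₂ x.2))) (fun x => x)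
  rw [law_id, law_prodMass _ _ (fun x => (x.1, C₁ x)) (fun x => (x.1, C₂ x)),
    ← messageMass_bookEncoder, ← messageMass_bookEncoder] at h1
  have h2 := congrArg (fun p => law p (outMap a₁ b₁ a₂ b₂ a₃ b₃ unzip₃)) h1
  simp only [law_law] at h2
  exact h2.symm

/-- Each user subtracts its own input and decodes message and index together, so a wrong message
implies a wrong pair. A single message is never decoded wrongly, whatever happens to the index. -/
theorem errorProb_bookCode_le (d : DecoderKind) (θ₁ θ₂ : ℝ) (C₁ : Fin m₁ × Fin k₁ → Fin n → F)
    (C₂ : Fin m₂ × Fin k₂ → Fin n → F) :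
    (bookCode a₁ b₁ a₂ b₂ ν d θ₁ θ₂ C₁ C₂).errorProb (additiveChannel a₁ b₁ a₂ b₂ a₃ b₃ ν) ≤
      (if m₁ = 1 then 0 else decodingError a₂ (powMass (pmfMass (noise₂ ν)) n) θ₂ C₁) +
      (if m₂ = 1 then 0 else decodingError b₁ (powMass (pmfMass (noise₁ ν)) n) θ₁ C₂) := by
  set w₁ := powMass (pmfMass (noise₁ ν)) n with hw₁
  set w₂ := powMass (pmfMass (noise₂ ν)) n with hw₂
  set K := bookCode a₁ b₁ a₂ b₂ ν d θ₁ θ₂ C₁ C₂ with hK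
  set p := prodMass (prodMass (uniformMass (Fin m₁ × Fin k₁)) (uniformMass (Fin m₂ × Fin k₂)))
    (powMass (pmfMass ν) n) with hp
  have hpm : IsMass p :=
    (isMass_uniformMass.prod isMass_uniformMass).prod ((isMass_pmfMass ν).pow n)
  let ψ₁ : Fin m₁ × Fin k₁ → (Fin n → F) → ℝ := fun i g => if m₁ = 1 then 0 else
    if thresholdDecoder a₂ w₂ θ₂ C₁ (a₂ • C₁ i + g) = i then 0 else 1
  let ψ₂ : Fin m₂ × Fin k₂ → (Fin n → F) → ℝ := fun i g => if m₂ = 1 then 0 else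
    if thresholdDecoder b₁ w₁ θ₁ C₂ (b₁ • C₂ i + g) = i then 0 else 1
  have hψ₁ : ∀ i g, 0 ≤ ψ₁ i g := fun i g => by
    simp only [ψ₁]
    split_ifs <;> simp
  have hψ₂ : ∀ i g, 0 ≤ ψ₂ i g := fun i g => by
    simp only [ψ₂]
    split_ifs <;> simp
  have e1 : K.errorProb (additiveChannel a₁ b₁ a₂ b₂ a₃ b₃ ν) =
      ∑ y : K.Outcome F, K.mass (additiveChannel a₁ b₁ a₂ b₂ a₃ b₃ ν) y *
        (if K.dec₂.estimate y.2.1 y.2.2.2.1 y.2.2.2.2.2.1 ≠ y.1 ∨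
          K.dec₁.estimate y.1 y.2.2.1 y.2.2.2.2.1 ≠ y.2.1 then 1 else 0) := by
    rw [Code.errorProb]
    refine Finset.sum_congr rfl fun y _ => ?_
    rw [mul_ite, mul_one, mul_zero]
  have e2 : ∑ y : K.Outcome F, K.mass (additiveChannel a₁ b₁ a₂ b₂ a₃ b₃ ν) y *
        (if K.dec₂.estimate y.2.1 y.2.2.2.1 y.2.2.2.2.2.1 ≠ y.1 ∨
          K.dec₁.estimate y.1 y.2.2.1 y.2.2.2.2.1 ≠ y.2.1 then 1 else 0) ≤
      ∑ ω, p ω * (ψ₁ ω.1.1 (unzip₃ ω.2).2.1 + ψ₂ ω.1.2 (unzip₃ ω.2).1) := by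
    let T : ((Fin m₁ × Fin k₁) × (Fin m₂ × Fin k₂)) × (Fin n → F × F × F) → K.Outcome F :=
      fun ω => outMap a₁ b₁ a₂ b₂ a₃ b₃ unzip₃
        (((ω.1.1.1, C₁ ω.1.1), (ω.1.2.1, C₂ ω.1.2)), ω.2)
    have hm : K.mass (additiveChannel a₁ b₁ a₂ b₂ a₃ b₃ ν) = law p T :=
      mass_bookCode d θ₁ θ₂ C₁ C₂
    rw [hm, sum_law_mul]
    refine Finset.sum_le_sum fun ω _ => mul_le_mul_of_nonneg_left ?_ (hpm.nonneg ω)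
    have h1 := hψ₁ ω.1.1 (unzip₃ ω.2).2.1
    have h2 := hψ₂ ω.1.2 (unzip₃ ω.2).1
    split_ifs with h
    · rcases h with h | h
      · have : ψ₁ ω.1.1 (unzip₃ ω.2).2.1 = 1 := by
          simp only [ψ₁]
          rw [if_neg, if_neg]
          · intro h3
            refine h ((estimate_ownMessageFree d _ _ _ _).trans ?_)
            have h4 : a₂ • C₁ ω.1.1 + b₂ • C₂ ω.1.2 + (unzip₃ ω.2).2.1 - b₂ • C₂ ω.1.2 =
              a₂ • C₁ ω.1.1 + (unzip₃ ω.2).2.1 := by abel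
            exact congrArg Prod.fst ((congrArg _ h4).trans h3)
          · rintro rfl
            exact h (Subsingleton.elim (α := Fin 1) _ _)
        linarith
      · have : ψ₂ ω.1.2 (unzip₃ ω.2).1 = 1 := by
          simp only [ψ₂]
          rw [if_neg, if_neg]
          · intro h3
            refine h ((estimate_ownMessageFree d _ _ _ _).trans ?_)
            have h4 : a₁ • C₁ ω.1.1 + b₁ • C₂ ω.1.2 + (unzip₃ ω.2).1 - a₁ • C₁ ω.1.1 =
              b₁ • C₂ ω.1.2 + (unzip₃ ω.2).1 := by abel
            exact congrArg Prod.fst ((congrArg _ h4).trans h3)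
          · rintro rfl
            exact h (Subsingleton.elim (α := Fin 1) _ _)
        linarith
    · linarith
  rw [e1]
  refine e2.trans_eq ?_
  simp only [mul_add, Finset.sum_add_distrib]
  rw [hp, sum_left_noise _ _ (fun x => (unzip₃ x).2.1) ψ₁,
    sum_right_noise _ _ (fun x => (unzip₃ x).1) ψ₂, law_powMass_unzip₁, law_powMass_unzip₂]
  simp only [ψ₁, ψ₂, decodingError]
  congr 1
  · split_ifs
    · simp
    · rw [Finset.mul_sum]
      rfl
  · split_ifs
    · simp
    · rw [Finset.mul_sum]
      rfl

/-- The words that the eavesdropper receives for a message pair, up to noise. -/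
def eavesdroppedWords (a b : F) (C₁ : Fin m₁ × Fin k₁ → Fin n → F)
    (C₂ : Fin m₂ × Fin k₂ → Fin n → F) (i : Fin m₁ × Fin m₂) (j : Fin k₁ × Fin k₂) : Fin n → F :=
  a • C₁ (i.1, j.1) + b • C₂ (i.2, j.2)

theorem law_message_eavesdropped (a b : F) (w : (Fin n → F) → ℝ) (C₁ : Fin m₁ × Fin k₁ → Fin n → F)
    (C₂ : Fin m₂ × Fin k₂ → Fin n → F) (i : Fin m₁ × Fin m₂) (z : Fin n → F) :
    law (prodMass (prodMass (uniformMass (Fin m₁ × Fin k₁)) (uniformMass (Fin m₂ × Fin k₂))) w)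
      (fun ω => ((ω.1.1.1, ω.1.2.1), a • C₁ ω.1.1 + b • C₂ ω.1.2 + ω.2)) (i, z) =
      1 / Fintype.card (Fin m₁ × Fin m₂) * mixtureMass w (eavesdroppedWords a b C₁ C₂ i) z := by
  classical
  let e : (Fin m₁ × Fin m₂) × ((Fin k₁ × Fin k₂) × (Fin n → F)) ≃
      ((Fin m₁ × Fin k₁) × (Fin m₂ × Fin k₂)) × (Fin n → F) :=
    ⟨fun x => (((x.1.1, x.2.1.1), (x.1.2, x.2.1.2)), x.2.2),
      fun x => ((x.1.1.1, x.1.2.1), ((x.1.1.2, x.1.2.2), x.2)), fun _ => rfl, fun _ => rfl⟩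
  rw [← law_comp_equiv _ e]
  have h1 : (fun ω => prodMass (prodMass (uniformMass (Fin m₁ × Fin k₁))
      (uniformMass (Fin m₂ × Fin k₂))) w (e ω)) =
      prodMass (uniformMass (Fin m₁ × Fin m₂)) (prodMass (uniformMass (Fin k₁ × Fin k₂)) w) := by
    ext ω
    simp only [← prodMass_uniformMass]
    simp only [prodMass, e, Equiv.coe_fn_mk]
    ring
  rw [h1]
  refine (law_prodMass_skew (uniformMass (Fin m₁ × Fin m₂))
    (prodMass (uniformMass (Fin k₁ × Fin k₂)) w)
    (fun i x => eavesdroppedWords a b C₁ C₂ i x.1 + x.2) i z).trans ?_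
  rw [uniformMass, law_eq_sum_mul, mixtureMass, Fintype.sum_prod_type]
  congr 1
  rw [Finset.mul_sum]
  refine Finset.sum_congr rfl fun j _ => ?_
  simp only [prodMass, uniformMass, mul_assoc, ← Finset.mul_sum]
  congr 1
  rw [Finset.sum_eq_single (z - eavesdroppedWords a b C₁ C₂ i j)]
  · simp
  · intro x _ hx
    rw [if_neg, mul_zero]
    rintro rfl
    simp at hx
  · simp

/-- The average relative entropy of the law of the eavesdropper's output, given the messages, with
respect to the uniform law. -/
def leakageBound (a b : F) (w : (Fin n → F) → ℝ) (C₁ : Fin m₁ × Fin k₁ → Fin n → F)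
    (C₂ : Fin m₂ × Fin k₂ → Fin n → F) : ℝ :=
  1 / Fintype.card (Fin m₁ × Fin m₂) * ∑ i, (Real.log (Fintype.card (Fin n → F)) -
    ∑ z, Real.negMulLog (mixtureMass w (eavesdroppedWords a b C₁ C₂ i) z))

/-- I(M;Z) = H(Z) - H(Z | M), where H(Z) is at most the entropy of the uniform law and the law of Z
given M is a mixture over the codeword indices. -/
theorem jointLeakage_bookCode_le (d : DecoderKind) (θ₁ θ₂ : ℝ) (C₁ : Fin m₁ × Fin k₁ → Fin n → F)
    (C₂ : Fin m₂ × Fin k₂ → Fin n → F) :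
    (bookCode a₁ b₁ a₂ b₂ ν d θ₁ θ₂ C₁ C₂).jointLeakage (additiveChannel a₁ b₁ a₂ b₂ a₃ b₃ ν) ≤
      leakageBound a₃ b₃ (powMass (pmfMass (noise₃ ν)) n) C₁ C₂ := by
  set w := powMass (pmfMass (noise₃ ν)) n with hw
  have hwm : IsMass w := (isMass_pmfMass _).pow n
  have hc : (0 : ℝ) < Fintype.card (Fin m₁ × Fin m₂) := by exact_mod_cast Fintype.card_pos
  set p := prodMass (prodMass (uniformMass (Fin m₁ × Fin k₁)) (uniformMass (Fin m₂ × Fin k₂))) w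
    with hp
  have hpm : IsMass p := (isMass_uniformMass.prod isMass_uniformMass).prod hwm
  have h1 := law_prodMass (prodMass (uniformMass (Fin m₁ × Fin k₁)) (uniformMass (Fin m₂ × Fin k₂)))
    w (fun x => ((x.1.1, C₁ x.1), (x.2.1, C₂ x.2))) (fun x => x)
  rw [law_id, law_prodMass _ _ (fun x => (x.1, C₁ x)) (fun x => (x.1, C₂ x)),
    ← messageMass_bookEncoder, ← messageMass_bookEncoder] at h1
  have h2 : (bookCode a₁ b₁ a₂ b₂ ν d θ₁ θ₂ C₁ C₂).jointLeakage
      (additiveChannel a₁ b₁ a₂ b₂ a₃ b₃ ν) =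
      mutualInfo p (fun ω => (ω.1.1.1, ω.1.2.1))
        (fun ω => a₃ • C₁ ω.1.1 + b₃ • C₂ ω.1.2 + ω.2) := by
    rw [jointLeakage_eq_sumInfo]
    change sumInfo (messageMass m₁ (bookEncoder C₁)) (messageMass m₂ (bookEncoder C₂)) w a₃ b₃ = _
    rw [sumInfo, ← h1, mutualInfo_law]
  have h3 : entropy p (fun ω => ((ω.1.1.1, ω.1.2.1), a₃ • C₁ ω.1.1 + b₃ • C₂ ω.1.2 + ω.2)) =
      Real.log (Fintype.card (Fin m₁ × Fin m₂)) + 1 / Fintype.card (Fin m₁ × Fin m₂) *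
        ∑ i, ∑ z, Real.negMulLog (mixtureMass w (eavesdroppedWords a₃ b₃ C₁ C₂ i) z) := by
    rw [entropy, Fintype.sum_prod_type]
    simp only [hp, law_message_eavesdropped, Real.negMulLog_mul, Finset.sum_add_distrib,
      ← Finset.sum_mul, ← Finset.mul_sum, (isMass_mixtureMass hwm _).sum_eq_one]
    congr 1
    rw [Finset.sum_const, Finset.card_univ, nsmul_eq_mul, mul_one, Real.negMulLog, one_div,
      Real.log_inv]
    field_simp
  have h4 := entropy_le_log_card hpm (fun ω => (ω.1.1.1, ω.1.2.1))
  have h5 := entropy_le_log_card hpm (fun ω => a₃ • C₁ ω.1.1 + b₃ • C₂ ω.1.2 + ω.2)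
  rw [h2, mutualInfo, h3, leakageBound, Finset.sum_sub_distrib, Finset.sum_const,
    Finset.card_univ, nsmul_eq_mul, mul_sub, ← mul_assoc, one_div_mul_cancel hc.ne', one_mul]
  linarith

/-- Two distinct index pairs differ in at least one component, and the codeword of that user alone
already makes the difference surjective. This is why only the product of the two index ranges
matters for secrecy. -/
theorem sum_eavesdroppedWords_sub [DecidableEq F] {a b : F} (ha : a ≠ 0) (hb : b ≠ 0)
    (i : Fin m₁ × Fin m₂)
    (j j' : Fin k₁ × Fin k₂) (hj : j' ≠ j) (f : (Fin n → F) → ℝ) :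
    (∑ C : (Fin m₁ × Fin k₁ → Fin n → F) × (Fin m₂ × Fin k₂ → Fin n → F),
      f (eavesdroppedWords a b C.1 C.2 i j - eavesdroppedWords a b C.1 C.2 i j')) *
        Fintype.card (Fin n → F) =
      Fintype.card ((Fin m₁ × Fin k₁ → Fin n → F) × (Fin m₂ × Fin k₂ → Fin n → F)) *
        ∑ g, f g := by
  let φ : (Fin m₁ × Fin k₁ → Fin n → F) × (Fin m₂ × Fin k₂ → Fin n → F) →+ (Fin n → F) :=
    { toFun := fun C => eavesdroppedWords a b C.1 C.2 i j - eavesdroppedWords a b C.1 C.2 i j'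
      map_zero' := by simp [eavesdroppedWords]
      map_add' := fun C D => by
        simp only [eavesdroppedWords, Prod.fst_add, Prod.snd_add, Pi.add_apply, smul_add]
        abel }
  refine sum_comp_hom_mul_card φ (fun g => ?_) f
  by_cases h1 : j'.1 = j.1
  · have h2 : (i.2, j'.2) ≠ (i.2, j.2) := fun h => hj (Prod.ext h1 (Prod.mk.inj h).2)
    refine ⟨(0, Pi.single (i.2, j.2) (b⁻¹ • g)), ?_⟩
    simp only [φ, AddMonoidHom.coe_mk, ZeroHom.coe_mk, eavesdroppedWords, Pi.single_eq_same,
      Pi.single_eq_of_ne h2, Pi.zero_apply, smul_zero, zero_add, sub_zero, smul_inv_smul₀ hb]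
  · have h2 : (i.1, j'.1) ≠ (i.1, j.1) := fun h => h1 (Prod.mk.inj h).2
    refine ⟨(Pi.single (i.1, j.1) (a⁻¹ • g), 0), ?_⟩
    simp only [φ, AddMonoidHom.coe_mk, ZeroHom.coe_mk, eavesdroppedWords, Pi.single_eq_same,
      Pi.single_eq_of_ne h2, Pi.zero_apply, smul_zero, add_zero, sub_zero, smul_inv_smul₀ ha]

theorem sum_leakageBound_le [DecidableEq F] {a b : F} (ha : a ≠ 0) (hb : b ≠ 0)
    {w : (Fin n → F) → ℝ} (hw : IsMass w) :
    ∑ C : (Fin m₁ × Fin k₁ → Fin n → F) × (Fin m₂ × Fin k₂ → Fin n → F),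
      leakageBound a b w C.1 C.2 ≤
      (Fintype.card ((Fin m₁ × Fin k₁ → Fin n → F) × (Fin m₂ × Fin k₂ → Fin n → F)) : ℝ) *
        ∑ x, w x * Real.log (1 + Fintype.card (Fin n → F) * w x /
          Fintype.card (Fin k₁ × Fin k₂)) := by
  have hc : (0 : ℝ) < Fintype.card (Fin m₁ × Fin m₂) := by exact_mod_cast Fintype.card_pos
  simp only [leakageBound]
  rw [← Finset.mul_sum, Finset.sum_comm]
  refine (mul_le_mul_of_nonneg_left (Finset.sum_le_sum fun i _ =>
    sum_log_card_sub_entropy_mixture_le hw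
      (fun (C : (Fin m₁ × Fin k₁ → Fin n → F) × (Fin m₂ × Fin k₂ → Fin n → F)) =>
        eavesdroppedWords a b C.1 C.2 i)
      (sum_eavesdroppedWords_sub ha hb i)) (by positivity)).trans_eq ?_
  rw [Finset.sum_const, Finset.card_univ, nsmul_eq_mul, ← mul_assoc, one_div_mul_cancel hc.ne',
    one_mul]

/-- The bound on the average error probability of a codebook with `m * k` words. -/
def errorBound (m k : ℕ) (p : PMF F) (n : ℕ) (θ : ℝ) : ℝ :=
  if m = 1 then 0 else (∑ x, powMass (pmfMass p) n x *
    if powMass (pmfMass p) n x < θ then 1 else 0) + m * k / (θ * (Fintype.card F : ℝ) ^ n)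

theorem sum_decodingError_le_errorBound [NeZero m] [NeZero k] {a : F} (ha : a ≠ 0)
    [DecidableEq F] (p : PMF F) {θ : ℝ} (hθ : 0 < θ) :
    ∑ C : Fin m × Fin k → Fin n → F,
      (if m = 1 then 0 else decodingError a (powMass (pmfMass p) n) θ C) ≤
      (Fintype.card (Fin m × Fin k → Fin n → F) : ℝ) * errorBound m k p n θ := by
  rw [errorBound]
  split_ifs with h
  · simp
  · refine (sum_decodingError_le ha ((isMass_pmfMass p).pow n) hθ).trans_eq ?_
    simp

/-- There is a code that is at least as good as the average of the random codes. -/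
theorem exists_code (ha₂ : a₂ ≠ 0) (hb₁ : b₁ ≠ 0) (ha₃ : a₃ ≠ 0) (hb₃ : b₃ ≠ 0) (d : DecoderKind)
    (m₁ m₂ k₁ k₂ n : ℕ) [NeZero m₁] [NeZero k₁] [NeZero m₂] [NeZero k₂] {θ₁ θ₂ : ℝ}
    (hθ₁ : 0 < θ₁) (hθ₂ : 0 < θ₂) : ∃ K : Code F F F F .nonadaptive d n,
      K.size₁ = m₁ ∧ K.size₂ = m₂ ∧
      K.errorProb (additiveChannel a₁ b₁ a₂ b₂ a₃ b₃ ν) +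
        K.jointLeakage (additiveChannel a₁ b₁ a₂ b₂ a₃ b₃ ν) ≤
      errorBound m₁ k₁ (noise₂ ν) n θ₂ + errorBound m₂ k₂ (noise₁ ν) n θ₁ +
        ∑ x, powMass (pmfMass (noise₃ ν)) n x * Real.log (1 + (Fintype.card F : ℝ) ^ n *
          powMass (pmfMass (noise₃ ν)) n x / (k₁ * k₂)) := by
  classical
  set E₂ := errorBound m₁ k₁ (noise₂ ν) n θ₂ with hE₂
  set E₁ := errorBound m₂ k₂ (noise₁ ν) n θ₁ with hE₁
  set L := ∑ x, powMass (pmfMass (noise₃ ν)) n x * Real.log (1 + (Fintype.card F : ℝ) ^ n *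
          powMass (pmfMass (noise₃ ν)) n x / (k₁ * k₂)) with hL
  let D₁ : (Fin m₁ × Fin k₁ → Fin n → F) → ℝ := fun C =>
    if m₁ = 1 then 0 else decodingError a₂ (powMass (pmfMass (noise₂ ν)) n) θ₂ C
  let D₂ : (Fin m₂ × Fin k₂ → Fin n → F) → ℝ := fun C =>
    if m₂ = 1 then 0 else decodingError b₁ (powMass (pmfMass (noise₁ ν)) n) θ₁ C
  have h1 : ∑ C, D₁ C ≤ (Fintype.card (Fin m₁ × Fin k₁ → Fin n → F) : ℝ) * E₂ :=
    sum_decodingError_le_errorBound ha₂ _ hθ₂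
  have h2 : ∑ C, D₂ C ≤ (Fintype.card (Fin m₂ × Fin k₂ → Fin n → F) : ℝ) * E₁ :=
    sum_decodingError_le_errorBound hb₁ _ hθ₁
  have h3 := sum_leakageBound_le (m₁ := m₁) (m₂ := m₂) (k₁ := k₁) (k₂ := k₂) ha₃ hb₃
    ((isMass_pmfMass (noise₃ ν)).pow n)
  have hcast : (Fintype.card (Fin n → F) : ℝ) = (Fintype.card F : ℝ) ^ n := by simp
  have hcast' : (Fintype.card (Fin k₁ × Fin k₂) : ℝ) = k₁ * k₂ := by simp
  rw [hcast, hcast', ← hL] at h3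
  -- Averaging the sum of both errors and the leakage yields one pair of codebooks that is good for
  -- all three.
  obtain ⟨C, -, hC⟩ := Finset.exists_le_of_sum_le
    (s := (Finset.univ : Finset ((Fin m₁ × Fin k₁ → Fin n → F) × (Fin m₂ × Fin k₂ → Fin n → F))))
    (f := fun C => D₁ C.1 + D₂ C.2 + leakageBound a₃ b₃ (powMass (pmfMass (noise₃ ν)) n) C.1 C.2)
    (g := fun _ => E₂ + E₁ + L) Finset.univ_nonempty (by
      rw [Finset.sum_add_distrib, Finset.sum_add_distrib, Finset.sum_const, Finset.card_univ,
        nsmul_eq_mul, Fintype.sum_prod_type (f := fun C :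
          (Fin m₁ × Fin k₁ → Fin n → F) × (Fin m₂ × Fin k₂ → Fin n → F) => D₁ C.1),
        Fintype.sum_prod_type (f := fun C :
          (Fin m₁ × Fin k₁ → Fin n → F) × (Fin m₂ × Fin k₂ → Fin n → F) => D₂ C.2)]
      simp only [Finset.sum_const, Finset.card_univ, nsmul_eq_mul, ← Finset.mul_sum]
      rw [Fintype.card_prod, Nat.cast_mul] at h3 ⊢
      have h4 := mul_le_mul_of_nonneg_left h1
        (Nat.cast_nonneg (α := ℝ) (Fintype.card (Fin m₂ × Fin k₂ → Fin n → F)))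
      have h5 := mul_le_mul_of_nonneg_left h2
        (Nat.cast_nonneg (α := ℝ) (Fintype.card (Fin m₁ × Fin k₁ → Fin n → F)))
      linarith)
  refine ⟨bookCode a₁ b₁ a₂ b₂ ν d θ₁ θ₂ C.1 C.2, rfl, rfl, ?_⟩
  have h6 := errorProb_bookCode_le (a₁ := a₁) (b₁ := b₁) (a₂ := a₂) (b₂ := b₂) (a₃ := a₃)
    (b₃ := b₃) (ν := ν) d θ₁ θ₂ C.1 C.2
  have h7 := jointLeakage_bookCode_le (a₁ := a₁) (b₁ := b₁) (a₂ := a₂) (b₂ := b₂) (a₃ := a₃)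
    (b₃ := b₃) (ν := ν) d θ₁ θ₂ C.1 C.2
  exact (add_le_add h6 h7).trans hC

end CodeConstruction

/-! ### Exponential decay of the error and leakage bounds. -/

section Asymptotics

/-- The least integer that is at least `e ^ (n R)`. -/
def bookSize (R : ℝ) (n : ℕ) : ℕ := ⌈Real.exp (n * R)⌉₊

instance (R : ℝ) (n : ℕ) : NeZero (bookSize R n) :=
  ⟨(Nat.ceil_pos.2 (Real.exp_pos _)).ne'⟩

theorem exp_le_bookSize (R : ℝ) (n : ℕ) : Real.exp (n * R) ≤ bookSize R n := Nat.le_ceil _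

theorem bookSize_le {R : ℝ} (hR : 0 ≤ R) (n : ℕ) : (bookSize R n : ℝ) ≤ 2 * Real.exp (n * R) := by
  have h1 : (bookSize R n : ℝ) < Real.exp (n * R) + 1 := Nat.ceil_lt_add_one (Real.exp_pos _).le
  have h2 : 1 ≤ Real.exp (n * R) := Real.one_le_exp (by positivity)
  linarith

/-- Rate zero means exactly one message, so `errorBound` vanishes there. -/
theorem bookSize_zero (n : ℕ) : bookSize 0 n = 1 := by simp [bookSize]

theorem tendsto_log_bookSize_div {R : ℝ} (hR : 0 ≤ R) :
    Tendsto (fun n : ℕ => Real.log (bookSize R n) / n) atTop (𝓝 R) := by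
  have h1 : Tendsto (fun n : ℕ => R + Real.log 2 / n) atTop (𝓝 (R + 0)) :=
    tendsto_const_nhds.add (tendsto_const_nhds.div_atTop tendsto_natCast_atTop_atTop)
  rw [add_zero] at h1
  refine tendsto_of_tendsto_of_tendsto_of_le_of_le' tendsto_const_nhds h1 ?_ ?_
  · filter_upwards [eventually_gt_atTop 0] with n hn
    have hn' : (0 : ℝ) < n := by exact_mod_cast hn
    rw [le_div_iff₀ hn']
    have := Real.log_le_log (Real.exp_pos _) (exp_le_bookSize R n)
    rw [Real.log_exp] at this
    linarith
  · filter_upwards [eventually_gt_atTop 0] with n hn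
    have hn' : (0 : ℝ) < n := by exact_mod_cast hn
    have h2 := Real.log_le_log ((Real.exp_pos _).trans_le (exp_le_bookSize R n)) (bookSize_le hR n)
    rw [Real.log_mul two_ne_zero (Real.exp_pos _).ne', Real.log_exp] at h2
    rw [div_le_iff₀ hn', add_mul, div_mul_cancel₀ _ hn'.ne']
    linarith

variable {F : Type*} [Field F] [Fintype F]

/-- The threshold is e^(-n τ) with τ halfway between H(p) and log q - (R + r). The noise is that
unlikely with exponentially small probability, by Chernoff; wrong codewords contribute at most 4
e^(-n δ), where 4 = 2 · 2 pays for rounding up the two sizes. -/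
theorem exists_tendsto_errorBound (p : PMF F) {R r : ℝ} (hR : 0 ≤ R) (hr : 0 ≤ r)
    (h : R = 0 ∨ R + r < Real.log (Fintype.card F) - pmfEntropy p) :
    ∃ θ : ℕ → ℝ, (∀ n, 0 < θ n) ∧
      Tendsto (fun n => errorBound (bookSize R n) (bookSize r n) p n (θ n)) atTop (𝓝 0) := by
  rcases h with rfl | h
  · refine ⟨fun _ => 1, fun _ => one_pos, ?_⟩
    simp [errorBound, bookSize_zero]
  have hq : (0 : ℝ) < Fintype.card F := by exact_mod_cast Fintype.card_pos
  have hp := isMass_pmfMass p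
  obtain ⟨δ, hδ, hδe⟩ : ∃ δ : ℝ, 0 < δ ∧
      Real.log (Fintype.card F) = pmfEntropy p + (R + r) + 2 * δ :=
    ⟨(Real.log (Fintype.card F) - pmfEntropy p - (R + r)) / 2, by linarith, by ring⟩
  set τ := pmfEntropy p + δ with hτ
  obtain ⟨s, hs, -, hf⟩ := exists_exp_moment_lt_one hp (fun a => -Real.log (pmfMass p a) - τ) (by
    have : ∀ a, pmfMass p a * (-Real.log (pmfMass p a) - τ) =
        Real.negMulLog (pmfMass p a) - pmfMass p a * τ := fun a => by
      rw [Real.negMulLog]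
      ring
    simp only [this, Finset.sum_sub_distrib, ← Finset.sum_mul, hp.sum_eq_one, ← pmfEntropy_eq]
    linarith)
  set f := ∑ a, pmfMass p a * Real.exp (s * (-Real.log (pmfMass p a) - τ)) with hfdef
  have hf0 : 0 ≤ f := Finset.sum_nonneg fun a _ => mul_nonneg (hp.nonneg a) (Real.exp_pos _).le
  refine ⟨fun n => Real.exp (-(n * τ)), fun n => Real.exp_pos _, ?_⟩
  have hlim : Tendsto (fun n : ℕ => f ^ n + 4 * Real.exp (-δ) ^ n) atTop (𝓝 (0 + 4 * 0)) :=
    (tendsto_pow_atTop_nhds_zero_of_lt_one hf0 hf).add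
      ((tendsto_pow_atTop_nhds_zero_of_lt_one (Real.exp_pos _).le
        (Real.exp_zero ▸ Real.exp_lt_exp.2 (neg_lt_zero.2 hδ))).const_mul 4)
  rw [mul_zero, add_zero] at hlim
  have hterm : ∀ n (x : Fin n → F), powMass (pmfMass p) n x *
      (if powMass (pmfMass p) n x < Real.exp (-(n * τ)) then 1 else 0) ≤
      powMass (pmfMass p) n x * Real.exp (s * ∑ t, (-Real.log (pmfMass p (x t)) - τ)) := by
    intro n x
    have hw := (hp.pow n).nonneg x
    rcases hw.eq_or_lt with h0 | h0
    · rw [← h0, zero_mul, zero_mul]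
    refine mul_le_mul_of_nonneg_left ?_ hw
    split_ifs with h1
    · refine Real.one_le_exp (mul_nonneg hs.le ?_)
      have h2 : Real.log (powMass (pmfMass p) n x) = ∑ t, Real.log (pmfMass p (x t)) :=
        Real.log_prod fun t ht => Finset.prod_ne_zero_iff.1 h0.ne' t ht
      have h3 := Real.log_lt_log h0 h1
      rw [Real.log_exp, h2] at h3
      simp only [Finset.sum_sub_distrib, Finset.sum_neg_distrib, Finset.sum_const,
        Finset.card_univ, Fintype.card_fin, nsmul_eq_mul]
      linarith
    · exact (Real.exp_pos _).le
  refine squeeze_zero (fun n => ?_) (fun n => ?_) hlim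
  · rw [errorBound]
    split_ifs
    · exact le_rfl
    · refine add_nonneg (Finset.sum_nonneg fun x _ => mul_nonneg ((hp.pow n).nonneg x) ?_)
        (by positivity)
      split_ifs <;> simp
  · rw [errorBound]
    split_ifs
    · positivity
    · refine add_le_add ?_ ?_
      · rw [hfdef, ← sum_powMass_mul_exp]
        exact Finset.sum_le_sum fun x _ => hterm n x
      · have h1 : (bookSize R n : ℝ) * bookSize r n ≤
            2 * Real.exp (n * R) * (2 * Real.exp (n * r)) :=
          mul_le_mul (bookSize_le hR n) (bookSize_le hr n) (Nat.cast_nonneg _) (by positivity)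
        have h2 : (Fintype.card F : ℝ) ^ n = Real.exp (n * Real.log (Fintype.card F)) := by
          rw [Real.exp_nat_mul, Real.exp_log hq]
        rw [h2, div_le_iff₀ (by positivity)]
        refine h1.trans_eq ?_
        rw [← Real.exp_nat_mul]
        have h3 : 2 * Real.exp (n * R) * (2 * Real.exp (n * r)) =
            4 * Real.exp (n * R + n * r) := by
          rw [Real.exp_add]
          ring
        rw [h3, mul_assoc, ← Real.exp_add, ← Real.exp_add, hδe, hτ]
        congr 2
        ring

/-- The argument of the logarithm is at most 1 + e^(∑ (log p + c)), and log p + c has negative mean,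
so `log_one_add_le` and an exponential moment below 1 give exponential decay. -/
theorem tendsto_resolvability (p : PMF F) {r₁ r₂ : ℝ}
    (h : Real.log (Fintype.card F) - pmfEntropy p < r₁ + r₂) :
    Tendsto (fun n => ∑ x, powMass (pmfMass p) n x * Real.log (1 + (Fintype.card F : ℝ) ^ n *
      powMass (pmfMass p) n x / (bookSize r₁ n * bookSize r₂ n))) atTop (𝓝 0) := by
  have hq : (0 : ℝ) < Fintype.card F := by exact_mod_cast Fintype.card_pos
  have hp := isMass_pmfMass p
  set c := Real.log (Fintype.card F) - (r₁ + r₂) with hc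
  obtain ⟨s, hs, hs1, hf⟩ := exists_exp_moment_lt_one hp (fun a => Real.log (pmfMass p a) + c) (by
    have : ∀ a, pmfMass p a * (Real.log (pmfMass p a) + c) =
        pmfMass p a * c - Real.negMulLog (pmfMass p a) := fun a => by
      rw [Real.negMulLog]
      ring
    simp only [this, Finset.sum_sub_distrib, ← Finset.sum_mul, hp.sum_eq_one, ← pmfEntropy_eq]
    linarith)
  set f := ∑ a, pmfMass p a * Real.exp (s * (Real.log (pmfMass p a) + c)) with hfdef
  have hf0 : 0 ≤ f := Finset.sum_nonneg fun a _ => mul_nonneg (hp.nonneg a) (Real.exp_pos _).le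
  have hlim : Tendsto (fun n : ℕ => 1 / s * f ^ n) atTop (𝓝 (1 / s * 0)) :=
    (tendsto_pow_atTop_nhds_zero_of_lt_one hf0 hf).const_mul _
  rw [mul_zero] at hlim
  refine squeeze_zero (fun n => Finset.sum_nonneg fun x _ => mul_nonneg ((hp.pow n).nonneg x)
    (Real.log_nonneg ?_)) (fun n => ?_) hlim
  · have := (hp.pow n).nonneg x
    have : 0 ≤ (Fintype.card F : ℝ) ^ n * powMass (pmfMass p) n x /
      (bookSize r₁ n * bookSize r₂ n) := by positivity
    linarith
  · rw [hfdef, ← sum_powMass_mul_exp, Finset.mul_sum]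
    refine Finset.sum_le_sum fun x _ => ?_
    rcases ((hp.pow n).nonneg x).eq_or_lt with h0 | h0
    · rw [← h0]
      simp
    · rw [mul_left_comm]
      refine mul_le_mul_of_nonneg_left ?_ h0.le
      have hk₁ := (Real.exp_pos _).trans_le (exp_le_bookSize r₁ n)
      have hk₂ := (Real.exp_pos _).trans_le (exp_le_bookSize r₂ n)
      refine (log_one_add_le (div_pos (mul_pos (pow_pos hq n) h0) (mul_pos hk₁ hk₂)) hs hs1).trans
        (mul_le_mul_of_nonneg_left (Real.exp_le_exp.2 (mul_le_mul_of_nonneg_left ?_ hs.le))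
          (by positivity))
      have h2 : Real.log (powMass (pmfMass p) n x) = ∑ t, Real.log (pmfMass p (x t)) :=
        Real.log_prod fun t ht => Finset.prod_ne_zero_iff.1 h0.ne' t ht
      have h3 := Real.log_le_log (Real.exp_pos _) (exp_le_bookSize r₁ n)
      have h4 := Real.log_le_log (Real.exp_pos _) (exp_le_bookSize r₂ n)
      rw [Real.log_exp] at h3 h4
      rw [Real.log_div (mul_pos (pow_pos hq n) h0).ne' (mul_pos hk₁ hk₂).ne',
        Real.log_mul (pow_pos hq n).ne' h0.ne', Real.log_mul hk₁.ne' hk₂.ne', Real.log_pow, h2]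
      simp only [Finset.sum_add_distrib, Finset.sum_const, Finset.card_univ, Fintype.card_fin,
        nsmul_eq_mul]
      rw [hc]
      linarith

end Asymptotics

/-! ### Achievability of the explicit region by nonadaptive codes. -/

section Achievability

variable {F : Type*} [Field F] [Fintype F] {a₁ b₁ a₂ b₂ a₃ b₃ : F} {ν : PMF (F × F × F)}
  {d : DecoderKind} {n : ℕ}

theorem errorProb_nonneg (K : Code F F F F .nonadaptive d n) :
    0 ≤ K.errorProb (additiveChannel a₁ b₁ a₂ b₂ a₃ b₃ ν) := by
  refine Finset.sum_nonneg fun y _ => ?_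
  have := (isMass_nonadaptive a₁ b₁ a₂ b₂ a₃ b₃ (ν := ν) K).nonneg y
  obtain ⟨m₁, m₂, x₁, x₂, y₁, y₂, z⟩ := y
  simp only
  split_ifs
  · exact this
  · exact le_rfl

theorem jointLeakage_nonneg (K : Code F F F F .nonadaptive d n) :
    0 ≤ K.jointLeakage (additiveChannel a₁ b₁ a₂ b₂ a₃ b₃ ν) :=
  mutualInfo_nonneg (isMass_nonadaptive a₁ b₁ a₂ b₂ a₃ b₃ (ν := ν) K) _ _

theorem jointLeakage_le_log_card (K : Code F F F F .nonadaptive d n) :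
    K.jointLeakage (additiveChannel a₁ b₁ a₂ b₂ a₃ b₃ ν) ≤ n * Real.log (Fintype.card F) := by
  have hK := isMass_nonadaptive a₁ b₁ a₂ b₂ a₃ b₃ (ν := ν) K
  rw [← log_card_sequences]
  have h1 := entropy_le_log_card hK (fun (_, _, _, _, _, _, z) => z)
  have h2 := entropy_fst_le hK (fun (m₁, m₂, _, _, _, _, _) => (m₁, m₂))
    (fun (_, _, _, _, _, _, z) => z)
  rw [Code.jointLeakage, mutualInfo]
  linarith

/-- The distance of a code from being an ideal code with rates `R`. -/
def Code.defect (K : Code F F F F .nonadaptive d n) (W : Channel F F F F F) (R : ℝ × ℝ) : ℝ :=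
  |K.rate₁ - R.1| + |K.rate₂ - R.2| + (K.errorProb W + K.jointLeakage W)

/-- Choosing for each n a code whose defect is within 1 / (n + 1) of the infimum replaces a diagonal
argument over η. The leakage itself serves as `τ` for both strengths of secrecy. -/
theorem mem_capacityRegion_of_defect {R : ℝ × ℝ}
    (hne : ∀ n, Nonempty (Code F F F F .nonadaptive d n))
    (h : ∀ η > 0, ∀ᶠ n in atTop, ∃ K : Code F F F F .nonadaptive d n,
      K.defect (additiveChannel a₁ b₁ a₂ b₂ a₃ b₃ ν) R < η) (b : SecrecyStrength) :
    R ∈ capacityRegion (additiveChannel a₁ b₁ a₂ b₂ a₃ b₃ ν) .joint b .nonadaptive d := by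
  set W := additiveChannel a₁ b₁ a₂ b₂ a₃ b₃ ν with hW
  have hpos : ∀ {n} (K : Code F F F F .nonadaptive d n), 0 ≤ K.defect W R := fun K =>
    add_nonneg (by positivity) (add_nonneg (errorProb_nonneg K) (jointLeakage_nonneg K))
  have hbdd : ∀ n, BddBelow (Set.range fun K : Code F F F F .nonadaptive d n => K.defect W R) :=
    fun n => ⟨0, by
      rintro _ ⟨K, rfl⟩
      exact hpos K⟩
  have hex : ∀ n : ℕ, ∃ K : Code F F F F .nonadaptive d n, K.defect W R <
      sInf (Set.range fun K : Code F F F F .nonadaptive d n => K.defect W R) + 1 / ((n : ℝ) + 1) := by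
    intro n
    have := hne n
    obtain ⟨_, ⟨K, rfl⟩, hK⟩ := exists_lt_of_csInf_lt
      (Set.range_nonempty fun K : Code F F F F .nonadaptive d n => K.defect W R)
      (lt_add_of_pos_right _ (Nat.one_div_pos_of_nat (α := ℝ) (n := n)))
    exact ⟨K, hK⟩
  choose K hK using hex
  have hlim : Tendsto (fun n => (K n).defect W R) atTop (𝓝 0) := by
    rw [Metric.tendsto_atTop']
    intro η hη
    have h1 : ∀ᶠ n : ℕ in atTop, 1 / ((n : ℝ) + 1) < η / 2 :=
      (tendsto_one_div_add_atTop_nhds_zero_nat (𝕜 := ℝ)).eventually (gt_mem_nhds (by linarith))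
    obtain ⟨N, hN⟩ := eventually_atTop.1 (h1.and (h (η / 2) (by linarith)))
    refine ⟨N, fun n hn => ?_⟩
    obtain ⟨h2, K', hK'⟩ := hN n hn.le
    have h3 := csInf_le (hbdd n) ⟨K', rfl⟩
    rw [Real.dist_eq, sub_zero, abs_of_nonneg (hpos (K n))]
    have := hK n
    simp only at h3
    linarith
  have ha₁ : ∀ n, |(K n).rate₁ - R.1| ≤ (K n).defect W R := fun n => by
    have h1 := abs_nonneg ((K n).rate₂ - R.2)
    have h2 : 0 ≤ (K n).errorProb W := errorProb_nonneg (K n)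
    have h3 : 0 ≤ (K n).jointLeakage W := jointLeakage_nonneg (K n)
    rw [Code.defect]
    linarith
  have ha₂ : ∀ n, |(K n).rate₂ - R.2| ≤ (K n).defect W R := fun n => by
    have h1 := abs_nonneg ((K n).rate₁ - R.1)
    have h2 : 0 ≤ (K n).errorProb W := errorProb_nonneg (K n)
    have h3 : 0 ≤ (K n).jointLeakage W := jointLeakage_nonneg (K n)
    rw [Code.defect]
    linarith
  have ha : ∀ n, (K n).errorProb W + (K n).jointLeakage W ≤ (K n).defect W R := fun n => by
    have h1 := abs_nonneg ((K n).rate₁ - R.1)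
    have h2 := abs_nonneg ((K n).rate₂ - R.2)
    rw [Code.defect]
    linarith
  refine ⟨K, fun n => (K n).errorProb W, fun n => (K n).jointLeakage W, ?_, ?_, ?_, ?_,
    fun n => ⟨le_rfl, ?_⟩⟩
  · exact tendsto_iff_norm_sub_tendsto_zero.2
      (squeeze_zero (fun _ => norm_nonneg _) ha₁ hlim)
  · exact tendsto_iff_norm_sub_tendsto_zero.2
      (squeeze_zero (fun _ => norm_nonneg _) ha₂ hlim)
  · refine squeeze_zero (fun n => errorProb_nonneg (K n)) (fun n => ?_) hlim
    have h3 : 0 ≤ (K n).jointLeakage W := jointLeakage_nonneg (K n)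
    linarith [ha n]
  · refine squeeze_zero (fun n => jointLeakage_nonneg (K n)) (fun n => ?_) hlim
    have h3 : 0 ≤ (K n).errorProb W := errorProb_nonneg (K n)
    linarith [ha n]
  · have h3 : 0 ≤ (K n).jointLeakage W := jointLeakage_nonneg (K n)
    cases b with
    | strong => exact le_rfl
    | weak =>
      simp only [Code.LeaksAtMost, SecrecyStrength.bound]
      -- For n = 0 the weak bound is 0, and a block of length 0 leaks nothing.
      rcases Nat.eq_zero_or_pos n with rfl | hn
      · have h4 : (K 0).jointLeakage W ≤ _ := jointLeakage_le_log_card (K 0)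
        simpa using h4
      · have hn' : (1 : ℝ) ≤ n := by exact_mod_cast hn
        nlinarith

theorem eventually_exists_code_defect_lt (ha₂ : a₂ ≠ 0) (hb₁ : b₁ ≠ 0) (ha₃ : a₃ ≠ 0)
    (hb₃ : b₃ ≠ 0) (d : DecoderKind) {R₁ R₂ r₁ r₂ : ℝ} (hR₁ : 0 ≤ R₁) (hR₂ : 0 ≤ R₂)
    (hr₁ : 0 ≤ r₁) (hr₂ : 0 ≤ r₂)
    (h₁ : R₁ = 0 ∨ R₁ + r₁ < Real.log (Fintype.card F) - pmfEntropy (noise₂ ν))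
    (h₂ : R₂ = 0 ∨ R₂ + r₂ < Real.log (Fintype.card F) - pmfEntropy (noise₁ ν))
    (h₃ : Real.log (Fintype.card F) - pmfEntropy (noise₃ ν) < r₁ + r₂) {η : ℝ} (hη : 0 < η) :
    ∀ᶠ n in atTop, ∃ K : Code F F F F .nonadaptive d n,
      K.defect (additiveChannel a₁ b₁ a₂ b₂ a₃ b₃ ν) (R₁, R₂) < η := by
  obtain ⟨θ₂, hθ₂, hE₂⟩ := exists_tendsto_errorBound (noise₂ ν) hR₁ hr₁ h₁
  obtain ⟨θ₁, hθ₁, hE₁⟩ := exists_tendsto_errorBound (noise₁ ν) hR₂ hr₂ h₂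
  have hL := tendsto_resolvability (noise₃ ν) h₃
  have hT₁ := (tendsto_iff_norm_sub_tendsto_zero.1 (tendsto_log_bookSize_div hR₁))
  have hT₂ := (tendsto_iff_norm_sub_tendsto_zero.1 (tendsto_log_bookSize_div hR₂))
  have hall := (hT₁.add hT₂).add ((hE₂.add hE₁).add hL)
  simp only [add_zero] at hall
  filter_upwards [hall.eventually (gt_mem_nhds hη)] with n hn
  obtain ⟨K, hK₁, hK₂, hK⟩ := exists_code (a₁ := a₁) (b₂ := b₂) (ν := ν) ha₂ hb₁ ha₃ hb₃ d
    (bookSize R₁ n) (bookSize R₂ n) (bookSize r₁ n) (bookSize r₂ n) n (hθ₁ n) (hθ₂ n)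
  refine ⟨K, lt_of_le_of_lt ?_ hn⟩
  rw [Code.defect, Code.rate₁, Code.rate₂, hK₁, hK₂]
  exact add_le_add le_rfl hK

/-- Scaling the rates by 1 - δ makes the constraints on positive rates strict. Then r₁, r₂ are
chosen just below the decoding limits, where the sum constraint leaves enough randomness to hide the
messages. -/
theorem jointRegion_subset_capacityRegion (ha₂ : a₂ ≠ 0) (hb₁ : b₁ ≠ 0) (ha₃ : a₃ ≠ 0)
    (hb₃ : b₃ ≠ 0) (b : SecrecyStrength) (d : DecoderKind) : jointRegion ν ⊆
      capacityRegion (additiveChannel a₁ b₁ a₂ b₂ a₃ b₃ ν) .joint b .nonadaptive d := by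
  rintro ⟨R₁, R₂⟩ ⟨hR₁, hR₂, h₁, h₂, h₃⟩
  simp only at hR₁ hR₂ h₁ h₂ h₃
  refine mem_capacityRegion_of_defect (fun n => ?_) (fun η hη => ?_) b
  · obtain ⟨K, -⟩ := exists_code (a₁ := a₁) (b₂ := b₂) (ν := ν) ha₂ hb₁ ha₃ hb₃ d 1 1 1 1 n
      one_pos one_pos
    exact ⟨K⟩
  set C₁ := Real.log (Fintype.card F) - pmfEntropy (noise₂ ν) with hC₁
  set C₂ := Real.log (Fintype.card F) - pmfEntropy (noise₁ ν) with hC₂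
  set D := Real.log (Fintype.card F) - pmfEntropy (noise₃ ν) with hD
  have h₃' : R₁ + R₂ ≤ C₁ + C₂ - D := by
    rw [hC₁, hC₂, hD]
    linarith
  obtain ⟨δ, hδ, hδ1, hδη⟩ : ∃ δ : ℝ, 0 < δ ∧ δ < 1 ∧ δ * (R₁ + R₂) < η / 2 := by
    have h0 : Tendsto (fun δ : ℝ => δ * (R₁ + R₂)) (𝓝[>] 0) (𝓝 (0 * (R₁ + R₂))) :=
      (tendsto_id.mul_const _).mono_left nhdsWithin_le_nhds
    rw [zero_mul] at h0
    have h1 : ∀ᶠ δ in 𝓝[>] (0 : ℝ), δ * (R₁ + R₂) < η / 2 :=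
      h0.eventually (gt_mem_nhds (by linarith))
    have h2 : ∀ᶠ δ in 𝓝[>] (0 : ℝ), δ ∈ Set.Ioo (0 : ℝ) 1 := Ioo_mem_nhdsGT one_pos
    obtain ⟨δ, hδ1, hδ2⟩ := (h1.and h2).exists
    exact ⟨δ, hδ2.1, hδ2.2, hδ1⟩
  have hs₁ : R₁ = 0 ∨ R₁ - δ * R₁ < C₁ := by
    rcases hR₁.eq_or_lt with h | h
    · exact Or.inl h.symm
    · exact Or.inr (by nlinarith)
  have hs₂ : R₂ = 0 ∨ R₂ - δ * R₂ < C₂ := by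
    rcases hR₂.eq_or_lt with h | h
    · exact Or.inl h.symm
    · exact Or.inr (by nlinarith)
  have hz : ∀ R : ℝ, R = 0 → R - δ * R = 0 := fun R h => by rw [h, mul_zero, sub_zero]
  obtain ⟨r₁, r₂, hr₁, hr₂, k₁, k₂, k₃⟩ : ∃ r₁ r₂ : ℝ, 0 ≤ r₁ ∧ 0 ≤ r₂ ∧
      (R₁ - δ * R₁ = 0 ∨ R₁ - δ * R₁ + r₁ < C₁) ∧ (R₂ - δ * R₂ = 0 ∨ R₂ - δ * R₂ + r₂ < C₂) ∧
      D < r₁ + r₂ := by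
    have hD1 : D < |D| + 1 := by linarith [le_abs_self D]
    -- A user of rate zero is not decoded, so it may supply all the randomness: |D| + 1 exceeds D
    -- and is nonnegative even if D < 0.
    rcases hs₁ with hs₁ | hs₁
    · refine ⟨|D| + 1, 0, by positivity, le_rfl, Or.inl (hz _ hs₁), ?_, by rwa [add_zero]⟩
      exact hs₂.imp (hz _) fun h => by rwa [add_zero]
    rcases hs₂ with hs₂ | hs₂
    · exact ⟨0, |D| + 1, le_rfl, by positivity, Or.inr (by rwa [add_zero]), Or.inl (hz _ hs₂),
        by rwa [zero_add]⟩
    by_cases hsum : R₁ + R₂ = 0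
    · have e1 : R₁ = 0 := by linarith
      have e2 : R₂ = 0 := by linarith
      exact ⟨|D| + 1, 0, by positivity, le_rfl, Or.inl (hz _ e1), Or.inl (hz _ e2),
        by rwa [add_zero]⟩
    have hsum' : 0 < R₁ + R₂ := lt_of_le_of_ne (by linarith) (Ne.symm hsum)
    have hs₃ : (R₁ - δ * R₁) + (R₂ - δ * R₂) < C₁ + C₂ - D := by nlinarith
    -- The first two terms keep r₁, r₂ nonnegative. The last is a third of the slack in the sum
    -- constraint, so lowering both by γ keeps r₁ + r₂ above D.
    set γ := min (min (C₁ - (R₁ - δ * R₁)) (C₂ - (R₂ - δ * R₂)))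
      ((C₁ + C₂ - D - (R₁ - δ * R₁) - (R₂ - δ * R₂)) / 3) with hγ
    have hγ0 : 0 < γ := lt_min (lt_min (by linarith) (by linarith)) (by linarith)
    have hγ1 : γ ≤ C₁ - (R₁ - δ * R₁) := (min_le_left _ _).trans (min_le_left _ _)
    have hγ2 : γ ≤ C₂ - (R₂ - δ * R₂) := (min_le_left _ _).trans (min_le_right _ _)
    have hγ3 : γ ≤ (C₁ + C₂ - D - (R₁ - δ * R₁) - (R₂ - δ * R₂)) / 3 := min_le_right _ _
    exact ⟨C₁ - (R₁ - δ * R₁) - γ, C₂ - (R₂ - δ * R₂) - γ, by linarith, by linarith,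
      Or.inr (by linarith), Or.inr (by linarith), by linarith⟩
  filter_upwards [eventually_exists_code_defect_lt (a₁ := a₁) (b₂ := b₂) ha₂ hb₁ ha₃ hb₃ d
    (by nlinarith : 0 ≤ R₁ - δ * R₁) (by nlinarith : 0 ≤ R₂ - δ * R₂) hr₁ hr₂ k₁ k₂ k₃
    (half_pos hη)] with n hn
  obtain ⟨K, hK⟩ := hn
  refine ⟨K, ?_⟩
  rw [Code.defect] at hK ⊢
  simp only at hK ⊢
  have t₁ : |K.rate₁ - R₁| ≤ |K.rate₁ - (R₁ - δ * R₁)| + δ * R₁ := by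
    have := abs_sub_le K.rate₁ (R₁ - δ * R₁) R₁
    have e : |R₁ - δ * R₁ - R₁| = δ * R₁ := by
      rw [abs_sub_comm, abs_of_nonneg] <;> nlinarith
    linarith
  have t₂ : |K.rate₂ - R₂| ≤ |K.rate₂ - (R₂ - δ * R₂)| + δ * R₂ := by
    have := abs_sub_le K.rate₂ (R₂ - δ * R₂) R₂
    have e : |R₂ - δ * R₂ - R₂| = δ * R₂ := by
      rw [abs_sub_comm, abs_of_nonneg] <;> nlinarith
    linarith
  linarith

end Achievability

/-! ### Uniform inputs: full rates and perfect masking. -/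

section UniformInputs

variable {A B C D V G F : Type*} [Fintype A] [Fintype B] [Fintype C] [Fintype D] [Fintype V]
  [Fintype G] [AddCommGroup G] [Field F] [Module F G]

theorem mutualInfo_comp_equiv (p : A → ℝ) (e : B ≃ A) (f : A → C) (g : A → D) :
    mutualInfo (fun x => p (e x)) (fun x => f (e x)) (fun x => g (e x)) = mutualInfo p f g := by
  simp only [mutualInfo, entropy, law_comp_equiv p e f, law_comp_equiv p e g,
    law_comp_equiv p e (fun x => (f x, g x))]

theorem entropy_uniformMass [Nonempty V] :
    entropy (uniformMass V) (fun v => v) = Real.log (Fintype.card V) := by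
  have hc : (0 : ℝ) < Fintype.card V := by exact_mod_cast Fintype.card_pos
  rw [entropy_id]
  simp only [uniformMass, Finset.sum_const, Finset.card_univ, nsmul_eq_mul, Real.negMulLog,
    one_div, Real.log_inv]
  field_simp

theorem law_uniformMass_bijective {f : V → G} (hf : Function.Bijective f) :
    law (uniformMass V) f = uniformMass G := by
  ext g
  obtain ⟨v, rfl⟩ := hf.2 g
  have h := law_comp_injective (uniformMass V) (fun v => v) hf.1 v
  rw [law_id] at h
  rw [h, uniformMass, uniformMass, Fintype.card_of_bijective hf]

/-- Uniform inputs make the sum with independent noise uniform. -/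
theorem law_uniform_add [Nonempty V] {f : V → G} (hf : Function.Bijective f) {μ : A → ℝ}
    (hμ : IsMass μ) (k : A → G) :
    law (prodMass (uniformMass V) μ) (fun ω => f ω.1 + k ω.2) = uniformMass G := by
  classical
  have h1 : law (prodMass (uniformMass V) μ) (fun ω => f ω.1 + k ω.2) =
      law (prodMass (uniformMass G) μ) (fun ω => ω.1 + k ω.2) := by
    have h2 := law_prodMass (uniformMass V) μ f (fun x => x)
    rw [law_id, law_uniformMass_bijective hf] at h2
    rw [← h2, law_law]
  rw [h1]
  ext g
  rw [law_eq_sum_mul, Fintype.sum_prod_type_right]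
  have h3 : ∀ a, ∑ x : G, prodMass (uniformMass G) μ (x, a) * (if x + k a = g then 1 else 0) =
      uniformMass G g * μ a := by
    intro a
    rw [Finset.sum_eq_single (g - k a)]
    · simp [prodMass, uniformMass]
    · intro x _ hx
      rw [if_neg, mul_zero]
      rintro rfl
      simp at hx
    · simp
  simp only [h3, ← Finset.mul_sum, hμ.sum_eq_one, mul_one]

/-- An output that is masked by an independent uniform input carries no information. -/
theorem mutualInfo_masked_le {P : A → ℝ} {Q : B → ℝ} (hP : IsMass P) (hQ : IsMass Q)
    (f : A → G) {g : B → G} (hg : law Q g = uniformMass G) :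
    mutualInfo (prodMass P Q) (fun ω => f ω.1 + g ω.2) (fun ω => ω.1) ≤ 0 := by
  have hPQ := hP.prod hQ
  have : Nonempty G := ⟨0⟩
  have h1 := entropy_le_log_card hPQ (fun ω => f ω.1 + g ω.2)
  have h2 : entropy (prodMass P Q) (fun ω => (f ω.1 + g ω.2, ω.1)) =
      entropy P (fun x => x) + Real.log (Fintype.card G) := by
    rw [← entropy_uniformMass (V := G), ← hg, entropy_law, ← entropy_prodMass hP hQ]
    refine entropy_congr_of_injective _ (fun x => (f x.1 + x.2, x.1)) ?_ fun _ => rfl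
    rintro ⟨x, y⟩ ⟨x', y'⟩ h
    simp only [Prod.mk.injEq] at h
    obtain ⟨h, rfl⟩ := h
    simpa using h
  rw [mutualInfo, h2, entropy_prodMass_fst P hQ (fun x => x)]
  linarith

theorem bijective_smul_equiv {a : F} (ha : a ≠ 0) (e : V ≃ G) :
    Function.Bijective fun v => a • e v :=
  (MulAction.bijective (Units.mk0 a ha)).comp e.bijective

variable [Nonempty V]

/-- A uniform input makes the output uniform, and given the input only the noise is left; hence the
bound of `signalInfo_le` is attained. -/
theorem le_signalInfo_uniform {a : F} (ha : a ≠ 0) (e : V ≃ G) {μ : G → ℝ} (hμ : IsMass μ) :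
    Real.log (Fintype.card G) - ∑ g, Real.negMulLog (μ g) ≤
      signalInfo (law (uniformMass V) fun v => (v, e v)) μ a := by
  have hu := isMass_uniformMass (A := V)
  have : Nonempty G := ⟨0⟩
  have h1 := law_prodMass (uniformMass V) μ (fun v => (v, e v)) (fun x => x)
  rw [law_id] at h1
  have h2 : entropy (prodMass (uniformMass V) μ) (fun ω => (ω.1, a • e ω.1 + ω.2)) =
      entropy (uniformMass V) (fun v => v) + entropy μ (fun x => x) := by
    rw [← entropy_prodMass hu hμ]
    refine entropy_congr_of_injective _ (fun x => (x.1, a • e x.1 + x.2)) ?_ fun _ => rfl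
    rintro ⟨x, y⟩ ⟨x', y'⟩ h
    simp only [Prod.mk.injEq] at h
    obtain ⟨rfl, h⟩ := h
    simpa using h
  have h3 : entropy (prodMass (uniformMass V) μ) (fun ω => a • e ω.1 + ω.2) =
      Real.log (Fintype.card G) := by
    rw [← entropy_uniformMass, ← law_uniform_add (bijective_smul_equiv ha e) hμ (fun x => x),
      entropy_law]
  rw [signalInfo, ← h1, mutualInfo_law, mutualInfo, h2, h3,
    entropy_prodMass_fst (uniformMass V) hμ (fun x => x), entropy_id μ]
  linarith

theorem sumInfo_uniform_le (a b : F) (e : V ≃ G) {μ : G → ℝ} (hμ : IsMass μ) :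
    sumInfo (law (uniformMass V) fun v => (v, e v)) (law (uniformMass V) fun v => (v, e v)) μ a b ≤
      Real.log (Fintype.card G) - ∑ g, Real.negMulLog (μ g) := by
  have hu := isMass_uniformMass (A := V)
  have huu := hu.prod hu
  have h1 := law_prodMass (prodMass (uniformMass V) (uniformMass V)) μ
    (fun v => ((v.1, e v.1), (v.2, e v.2))) (fun x => x)
  rw [law_id, law_prodMass _ _ (fun v => (v, e v)) (fun v => (v, e v))] at h1
  have h2 : entropy (prodMass (prodMass (uniformMass V) (uniformMass V)) μ)
      (fun ω => ((ω.1.1, ω.1.2), a • e ω.1.1 + b • e ω.1.2 + ω.2)) =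
      entropy (prodMass (uniformMass V) (uniformMass V)) (fun v => v) + entropy μ (fun x => x) := by
    rw [← entropy_prodMass huu hμ]
    refine entropy_congr_of_injective _ (fun x => (x.1, a • e x.1.1 + b • e x.1.2 + x.2)) ?_
      fun _ => rfl
    rintro ⟨x, y⟩ ⟨x', y'⟩ h
    simp only [Prod.mk.injEq] at h
    obtain ⟨rfl, h⟩ := h
    simpa using h
  have h3 := entropy_le_log_card (huu.prod hμ) (fun ω => a • e ω.1.1 + b • e ω.1.2 + ω.2)
  have h4 : entropy (prodMass (prodMass (uniformMass V) (uniformMass V)) μ)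
      (fun ω => (ω.1.1, ω.1.2)) = entropy (prodMass (uniformMass V) (uniformMass V)) (fun v => v) :=
    entropy_prodMass_fst (prodMass (uniformMass V) (uniformMass V)) hμ (fun x => x)
  have h5 : sumInfo (law (uniformMass V) fun v => (v, e v)) (law (uniformMass V) fun v => (v, e v))
      μ a b = mutualInfo (prodMass (prodMass (uniformMass V) (uniformMass V)) μ)
        (fun ω => (ω.1.1, ω.1.2)) (fun ω => a • e ω.1.1 + b • e ω.1.2 + ω.2) := by
    rw [sumInfo, ← h1, mutualInfo_law]
  rw [entropy_id μ] at h2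
  rw [h5, mutualInfo]
  linarith

/-- The second input is uniform and b ≠ 0, so together with the noise it acts as a one-time pad for
the first input. -/
theorem mutualInfo_output_left_le {b : F} (a : F) (hb : b ≠ 0) (e : V ≃ G) {w : A → ℝ}
    (hw : IsMass w) (k : A → G) :
    mutualInfo (prodMass (prodMass (uniformMass V) (uniformMass V)) w)
      (fun ω => a • e ω.1.1 + b • e ω.1.2 + k ω.2) (fun ω => ω.1.1) ≤ 0 := by
  have hu := isMass_uniformMass (A := V)
  rw [← mutualInfo_comp_equiv _ (Equiv.prodAssoc V V A).symm]
  have h := mutualInfo_masked_le hu (hu.prod hw) (fun v => a • e v)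
    (law_uniform_add (bijective_smul_equiv hb e) hw k)
  convert h using 2
  · ext ω
    simp only [prodMass, Equiv.prodAssoc_symm_apply]
    ring
  · ext ω
    simp only [Equiv.prodAssoc_symm_apply]
    abel
  · rfl

theorem mutualInfo_output_right_le {a : F} (b : F) (ha : a ≠ 0) (e : V ≃ G) {w : A → ℝ}
    (hw : IsMass w) (k : A → G) :
    mutualInfo (prodMass (prodMass (uniformMass V) (uniformMass V)) w)
      (fun ω => a • e ω.1.1 + b • e ω.1.2 + k ω.2) (fun ω => ω.1.2) ≤ 0 := by
  have h := mutualInfo_output_left_le b ha e hw k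
  rw [← mutualInfo_comp_equiv _ (Equiv.prodCongr (Equiv.prodComm V V) (Equiv.refl A))] at h
  convert h using 2
  · ext ω
    simp only [prodMass, Equiv.prodCongr_apply, Equiv.prodComm_apply, Prod.map, Prod.fst_swap,
      Prod.snd_swap, Equiv.refl_apply]
    ring
  · ext ω
    simp only [Equiv.prodCongr_apply, Equiv.prodComm_apply, Prod.map, Prod.fst_swap,
      Prod.snd_swap, Equiv.refl_apply]
    abel
  · rfl

end UniformInputs

/-! ### The explicit region is contained in the single-letter region. -/

section InnerRegion

variable {F : Type*} [Field F] [Fintype F] {a₁ b₁ a₂ b₂ a₃ b₃ : F} {ν : PMF (F × F × F)}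

theorem jointMass_pure {V X : Type*} [Fintype V] [Nonempty V] [Fintype X] (f : V → X) :
    jointMass (pmfMass (PMF.uniformOfFintype V)) (fun v => PMF.pure (f v)) =
      law (uniformMass V) (fun v => (v, f v)) := by
  classical
  ext ⟨v, x⟩
  rw [law_eq_sum_mul, Finset.sum_eq_single v]
  · rw [jointMass, pmfMass_uniform]
    simp [pmfMass, PMF.pure_apply, eq_comm]
    split_ifs <;> simp
  · intro v' _ hv
    simp [hv]
  · simp

/-- A single choice, independent uniform inputs that are functions of equally large auxiliary
variables, already yields the whole region: the terms I(Z; Vᵢ) vanish by masking, and I(V₁,V₂;Z) is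
at most log q - H(N₃). -/
theorem jointRegion_subset_jointInnerRegion (ha₂ : a₂ ≠ 0) (hb₁ : b₁ ≠ 0) (ha₃ : a₃ ≠ 0)
    (hb₃ : b₃ ≠ 0) :
    jointRegion ν ⊆ jointInnerRegion (additiveChannel a₁ b₁ a₂ b₂ a₃ b₃ ν) := by
  intro R hR
  obtain ⟨h1, h2, h3, h4, h5⟩ := hR
  refine subset_closure (subset_convexHull ℝ _ ?_)
  -- Auxiliary alphabets are of the form `Fin k`, so V is an enumeration of the field rather than X
  -- itself.
  let e : Fin (Fintype.card F) ≃ F := (Fintype.equivFin F).symm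
  have : Nonempty (Fin (Fintype.card F)) := e.nonempty
  simp only [Set.mem_iUnion]
  refine ⟨Fintype.card F, Fintype.card F, PMF.uniformOfFintype _, PMF.uniformOfFintype _,
    fun v => PMF.pure (e v), fun v => PMF.pure (e v), ?_⟩
  have hu := isMass_uniformMass (A := Fin (Fintype.card F))
  have hr := hu.law (fun v => (v, e v))
  have hw := isMass_pmfMass ν
  have hm := singleLetterMass_additiveChannel a₁ b₁ a₂ b₂ a₃ b₃ ν
    (PMF.uniformOfFintype (Fin (Fintype.card F))) (PMF.uniformOfFintype (Fin (Fintype.card F)))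
    (fun v => PMF.pure (e v)) (fun v => PMF.pure (e v))
  rw [jointMass_pure] at hm
  have e1 := condMutualInfo_outMap_left a₁ b₁ a₂ b₂ a₃ b₃ (fun n => n) hr hr hw
  have e2 := condMutualInfo_outMap_right a₁ b₁ a₂ b₂ a₃ b₃ (fun n => n) hr hr hw
  have e3 := mutualInfo_outMap_sum a₁ b₁ a₂ b₂ a₃ b₃ (fun n => n)
    (r₁ := law (uniformMass (Fin (Fintype.card F))) (fun v => (v, e v)))
    (r₂ := law (uniformMass (Fin (Fintype.card F))) (fun v => (v, e v))) (w := pmfMass ν)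
  rw [← pmfMass_noise₂] at e1
  rw [← pmfMass_noise₁] at e2
  rw [← pmfMass_noise₃] at e3
  have i1 := le_signalInfo_uniform ha₂ e (isMass_pmfMass (noise₂ ν))
  have i2 := le_signalInfo_uniform hb₁ e (isMass_pmfMass (noise₁ ν))
  have i3 := sumInfo_uniform_le a₃ b₃ e (isMass_pmfMass (noise₃ ν))
  have hmass := law_prodMass (prodMass (uniformMass (Fin (Fintype.card F)))
    (uniformMass (Fin (Fintype.card F)))) (pmfMass ν)
    (fun v => ((v.1, e v.1), (v.2, e v.2))) (fun x => x)
  rw [law_id, law_prodMass _ _ (fun v => (v, e v)) (fun v => (v, e v))] at hmass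
  have j1 := mutualInfo_output_left_le a₃ hb₃ e hw (fun n => n.2.2)
  have j2 := mutualInfo_output_right_le b₃ ha₃ e hw (fun n => n.2.2)
  have l1 : mutualInfo (law (prodMass (prodMass (law (uniformMass (Fin (Fintype.card F)))
      (fun v => (v, e v))) (law (uniformMass (Fin (Fintype.card F))) (fun v => (v, e v))))
      (pmfMass ν)) (outMap a₁ b₁ a₂ b₂ a₃ b₃ fun n => n)) (fun y => y.2.2.2.2.2.2) (fun y => y.1) ≤
      0 := by
    rw [← hmass, mutualInfo_law, mutualInfo_law]
    exact j1
  have l2 : mutualInfo (law (prodMass (prodMass (law (uniformMass (Fin (Fintype.card F)))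
      (fun v => (v, e v))) (law (uniformMass (Fin (Fintype.card F))) (fun v => (v, e v))))
      (pmfMass ν)) (outMap a₁ b₁ a₂ b₂ a₃ b₃ fun n => n)) (fun y => y.2.2.2.2.2.2)
      (fun y => y.2.1) ≤ 0 := by
    rw [← hmass, mutualInfo_law, mutualInfo_law]
    exact j2
  rw [pmfEntropy_eq] at h3 h4
  rw [pmfEntropy_eq, pmfEntropy_eq, pmfEntropy_eq] at h5
  rw [jointSingleLetterRegion, hm]
  refine ⟨h1, h2, ?_, ?_, ?_⟩
  · refine h3.trans (i1.trans ?_)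
    rw [← e1]
    exact le_sub_self_iff _ |>.2 l1
  · refine h4.trans (i2.trans ?_)
    rw [← e2]
    exact le_sub_self_iff _ |>.2 l2
  · refine h5.trans (le_trans (b := signalInfo _ _ a₂ + signalInfo _ _ b₁ - sumInfo _ _ _ a₃ b₃)
      (by linarith) ?_)
    rw [← e1, ← e2, ← e3]

end InnerRegion

end TwoWayWiretap

end

theorem theorem4 {F : Type*} [Field F] [Fintype F]
    (a₁ b₁ a₂ b₂ a₃ b₃ : F) (ha₁ : a₁ ≠ 0) (hb₁ : b₁ ≠ 0) (ha₂ : a₂ ≠ 0) (hb₂ : b₂ ≠ 0)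
    (ha₃ : a₃ ≠ 0) (hb₃ : b₃ ≠ 0) (ν : PMF (F × F × F)) :
    capacityRegion (additiveChannel a₁ b₁ a₂ b₂ a₃ b₃ ν) .individual .weak .adaptive .first
        ⊆ outerRegion ν ∧
    (NoiseDecomposes (b₃ / b₁) (a₃ / a₂) ν →
      capacityRegion (additiveChannel a₁ b₁ a₂ b₂ a₃ b₃ ν) .joint .weak .nonadaptive .first
          ⊆ jointRegion ν ∧
      jointInnerRegion (additiveChannel a₁ b₁ a₂ b₂ a₃ b₃ ν) = jointRegion ν ∧
      ∀ (b : SecrecyStrength) (d : DecoderKind),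
        capacityRegion (additiveChannel a₁ b₁ a₂ b₂ a₃ b₃ ν) .joint b .nonadaptive d
          = jointRegion ν) := by
  refine ⟨capacityRegion_adaptive_subset a₁ b₁ a₂ b₂ a₃ b₃ ν _ _ _, fun hν =>
    ⟨capacityRegion_nonadaptive_subset hb₁ ha₂ hb₃ hν _ _, ?_, fun b d => ?_⟩⟩
  · exact (jointInnerRegion_subset hb₁ ha₂ hb₃ hν).antisymm
      (jointRegion_subset_jointInnerRegion ha₂ hb₁ ha₃ hb₃)
  · exact (capacityRegion_nonadaptive_subset hb₁ ha₂ hb₃ hν b d).antisymm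
      (jointRegion_subset_capacityRegion ha₂ hb₁ ha₃ hb₃ b d)
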